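/- \textbf{Setting.} A linear system $x_{t+1}=Ax_t+Bu_t+w_t$, $y_t=Cx_t+e_t$, $x_1=0$, with $u_t\in\mathbb R^{d_u}$, $y_t\in\mathbb R^{d_y}$ and arbitrary deterministic $w_t,e_t$, is run with a nominal linear controller $\pi_0$ driven by exogenous inputs $u^{\rm ex}_t$ and having an auxiliary output $\omega_t\in\mathbb R^{d_\omega}$: $$s_{t+1}=A_0s_t+B_0y_t+B_{\rm ex}u^{\rm ex}_t,\quad u_t=u^{\rm ex}_t+C_0s_t+D_0y_t,\quad \omega_t=C_\omega s_t+D_\omega y_t,\quad s_1=0,$$ where $d_u,d_\omega\ge1$. (Static feedback $u_t=u^{\rm ex}_t+Ky_t$ with $\omega_t=y_t$, i.e. the algorithm \textsc{Drc-Ons}, is the special case without internal state.) Put $v_t=(y_t,u_t)$. Let $v^{\rm nat}_t,\omega^{\rm nat}_t$ be the signals obtained for $u^{\rm ex}\equiv 0$, and let $G_v=(G_v^{[i]})_{i\ge0}$, $G_\omega=(G_\omega^{[i]})_{i\ge 0}$ be the Markov operators (impulse responses) of the closed loop from $u^{\rm ex}$ to $v$ and to $\omega$; so $v_t=v_t^{\rm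 nat}+\sum_{i=1}^tG_v^{[t-i]}u_i^{\rm ex}$ and likewise for $\omega$. For a Markov operator $G$ let $\psi_G(n)=\sum_{i\ge n}\|G^{[i]}\|_{\rm op}$, $\|G\|_{\ell_1,\rm op}=\psi_G(0)$, and $$\kappa(G)=\min\Big\{1,\ \inf\Big\{\sum_{n\ge0}\Big\|\sum_{i=0}^nG^{[i]}u_{n-i}\Big\|^2:\ \sum_{n\ge0}\|u_n\|^2=1\Big\}\Big\}.$$ A decay function is a non-negative non-increasing function $\psi:\mathbb N\to\mathbb R$. \textbf{Comparators.} For a linear dynamic controller $\pi$ (of any internal dimension, zero initial state) let $v^\pi_t$ be its closed-loop signal for the same $w,e$. A $\pi_0\to\pi$ conversion operator is a Markov operator $G$ such that, with $u^{{\rm ex},\pi_0\to\pi}_t=\sum_{i=1}^tG^{[t-i]}\omega_i^{\rm nat}$, one has $v_t^\pi=v_t^{\rm nat}+\sum_{i=1}^tG_v^{[t-i]}u_i^{{\rm ex},\pi_0\to\pi}$ for all $t\ge1$. Let $\Pi_\star$ be the set of all $\pi$ that have a conversion operator $G$ with $\|G\|_{\ell_1,\rm op}\le R_\star$ and $\psi_G(n)\le\psi_\star(n)$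 for all $n$, where $\psi_\star$ is a decay function. \textbf{Algorithm} (\textsc{Drc-Ons-Dyn}, known $G_v,G_\omega$; parameters $m,h\ge1$, $\eta,\lambda,R_{\mathcal M}$). Let $\mathcal M=\{M=(M^{[0]},\dots,M^{[m-1]}):M^{[i]}\in\mathbb R^{d_u\times d_\omega},\ \sum_{i<m}\|M^{[i]}\|_{\rm op}\le R_{\mathcal M}\}$, and identify $M$ with its vectorization $z\in\mathbb R^{md_ud_\omega}$. Start from any $z_1\in\mathcal M$ and $\Lambda_0=\lambda I$. In round $t=1,2,\dots$: observe $y_t,\omega_t$; recover $\omega^{\rm nat}_t=\omega_t-\sum_{i=1}^{t-1}G_\omega^{[t-i]}u^{\rm ex}_i$; play $u_t^{\rm ex}=Y_tz_t$, where $Y_t$ is the matrix with $Y_tz=\sum_{i=0}^{m-1}M^{[i]}\omega^{\rm nat}_{t-i}$ for $z\leftrightarrow M$ (with $\omega_s^{\rm nat}=0$ and $Y_s=0$ for $s\le0$); suffer $\ell_t(v_t)$ and observe $\ell_t$; recover $v^{\rm nat}_t=v_t-\sum_{i=1}^tG_v^{[t-i]}u^{\rm ex}_i$; put $H_t=\sum_{i=0}^hG_v^{[i]}Y_{t-i}$,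 $\nabla_t=H_t^\top\nabla\ell_t(v_t^{\rm nat}+H_tz_t)$, $\Lambda_t=\Lambda_{t-1}+H_t^\top H_t$, and $$z_{t+1}=\arg\min_{z\in\mathcal M}\big\|\Lambda_t^{1/2}\big(z-(z_t-\eta\Lambda_t^{-1}\nabla_t)\big)\big\|.$$ \textbf{Theorem.} There is a universal constant $C_0>0$ such that the following holds. Let $T\ge1$ and suppose that \begin{itemize} \item (losses) for some $\alpha>0$ and $L$, every $\ell_t$ is differentiable, $\alpha$-strongly convex, and $\|\nabla\ell_t(v)\|\le L\max\{1,\|v\|\}$ for all $v$; \item (stability) $R_{\pi_0}:=\max\{\|G_v\|_{\ell_1,\rm op},\|G_\omega\|_{\ell_1,\rm op}\}<\infty$, and $\psi_{\pi_0}$ is a decay function with $\psi_{G_v}\le\psi_{\pi_0}$ and $\psi_{G_\omega}\le\psi_{\pi_0}$; \item (bounded nature's iterates) $\|v_t^{\rm nat}\|,\|\omega_t^{\rm nat}\|\le R_{\rm nat}$ for all $t\ge1$, with $R_{\rm nat}\ge1$; \item (invertibility) $\kappa:=\kappa(G_v)>0$; \item (parameters) $\lambda=6hR_{\rm nat}^2R_{\pi_0}^2$,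 $\eta=1/\alpha$, $\psi_{\pi_0}(h+1)\le R_{\pi_0}/T$, $\psi_\star(m)\le cR_\star/T$ for some $c>0$, and $R_{\mathcal M}\ge\max\{1,R_\star\}$. \end{itemize} Then \textsc{Drc-Ons-Dyn} satisfies $$\sum_{t=1}^T\ell_t(v_t)-\inf_{\pi\in\Pi_\star}\sum_{t=1}^T\ell_t(v_t^\pi)\ \le\ C_0(1+c)\,(\alpha\sqrt\kappa)^{-1}\,m\,h^2\,d_u\,d_\omega\,R_{\pi_0}^3R_{\rm nat}^2R_{\mathcal M}^2L^2\log(1+T).$$ -/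

import Mathlib

open scoped Matrix.Norms.L2Operator ENNReal

noncomputable section

namespace Drc

/-- Real vectors with coordinates indexed by `ι`, with the Euclidean norm. Matrices carry the
induced operator norm throughout. -/
abbrev Vec (ι : Type) [Fintype ι] := EuclideanSpace ℝ ι

/-- Matrix-vector product on Euclidean vectors. -/
def act {ι κ : Type} [Fintype ι] [Fintype κ] (M : Matrix ι κ ℝ) (x : Vec κ) : Vec ι :=
  WithLp.toLp 2 (M.mulVec x.ofLp)

/-- The stacked vector `v = (y, u)`. -/
def joint {dy du : ℕ} (y : Vec (Fin dy)) (u : Vec (Fin du)) : Vec (Fin dy ⊕ Fin du) :=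
  WithLp.toLp 2 (Sum.elim y.ofLp u.ofLp)

/-- `trajectory step init t` is the state at the beginning of round `t`. Rounds are numbered
`1, 2, …`; round `1` starts in `init`, and round `t` is played by `step t`.
(The value at `0` is not used.) -/
def trajectory {σ : Type} (step : ℕ → σ → σ) (init : σ) : ℕ → σ
  | 0 => init
  | 1 => init
  | t + 2 => step (t + 1) (trajectory step init (t + 1))

/-! ### Systems and controllers -/

/-- The partially observed linear system
`x (t+1) = A x t + B u t + w t`, `y t = C x t + e t`, with `x 1 = 0`. -/
structure LinSys (dx dy du : ℕ) where
  A : Matrix (Fin dx) (Fin dx) ℝ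
  B : Matrix (Fin dx) (Fin du) ℝ
  C : Matrix (Fin dy) (Fin dx) ℝ

/-- A linear dynamic controller, of arbitrary internal dimension:
`s (t+1) = A s t + B y t`, `u t = C s t + D y t`, with `s 1 = 0`. -/
structure LDC (dy du : ℕ) where
  ds : ℕ
  A : Matrix (Fin ds) (Fin ds) ℝ
  B : Matrix (Fin ds) (Fin dy) ℝ
  C : Matrix (Fin du) (Fin ds) ℝ
  D : Matrix (Fin du) (Fin dy) ℝ

/-- A nominal controller `π₀`, driven by exogenous inputs `uex`, with an auxiliary output `ω`:
`s (t+1) = A s t + B y t + Bex uex t`, `u t = uex t + C s t + D y t`,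
`ω t = Cω s t + Dω y t`, with `s 1 = 0`. Static feedback `u = uex + K y` with `ω = y` is the case
`ds = 0`, `D = K`, `Dω = 1`. -/
structure NominalController (ds dy du dω : ℕ) where
  A : Matrix (Fin ds) (Fin ds) ℝ
  B : Matrix (Fin ds) (Fin dy) ℝ
  Bex : Matrix (Fin ds) (Fin du) ℝ
  C : Matrix (Fin du) (Fin ds) ℝ
  D : Matrix (Fin du) (Fin dy) ℝ
  Cω : Matrix (Fin dω) (Fin ds) ℝ
  Dω : Matrix (Fin dω) (Fin dy) ℝ

section ClosedLoops

variable {dx ds dy du dω : ℕ}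

/-- States `(x t, s t)` when the system is controlled by the linear dynamic controller `π`. -/
def policyState (S : LinSys dx dy du) (π : LDC dy du) (w : ℕ → Vec (Fin dx))
    (e : ℕ → Vec (Fin dy)) : ℕ → Vec (Fin dx) × Vec (Fin π.ds) :=
  trajectory
    (fun t p =>
      let y := act S.C p.1 + e t
      let u := act π.C p.2 + act π.D y
      (act S.A p.1 + act S.B u + w t, act π.A p.2 + act π.B y))
    (0, 0)

/-- `v^π t = (y^π t, u^π t)`. -/
def policyIterate (S : LinSys dx dy du) (π : LDC dy du) (w : ℕ → Vec (Fin dx))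
    (e : ℕ → Vec (Fin dy)) (t : ℕ) : Vec (Fin dy ⊕ Fin du) :=
  let p := policyState S π w e t
  let y := act S.C p.1 + e t
  joint y (act π.C p.2 + act π.D y)

/-- States `(x t, s t)` under the nominal controller, without exogenous input. -/
def natState (S : LinSys dx dy du) (π₀ : NominalController ds dy du dω) (w : ℕ → Vec (Fin dx))
    (e : ℕ → Vec (Fin dy)) : ℕ → Vec (Fin dx) × Vec (Fin ds) :=
  trajectory
    (fun t p =>
      let y := act S.C p.1 + e t
      let u := act π₀.C p.2 + act π₀.D y
      (act S.A p.1 + act S.B u + w t, act π₀.A p.2 + act π₀.B y))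
    (0, 0)

/-- Nature's iterates `v^nat t = (y^nat t, u^nat t)`. -/
def vNat (S : LinSys dx dy du) (π₀ : NominalController ds dy du dω) (w : ℕ → Vec (Fin dx))
    (e : ℕ → Vec (Fin dy)) (t : ℕ) : Vec (Fin dy ⊕ Fin du) :=
  let p := natState S π₀ w e t
  let y := act S.C p.1 + e t
  joint y (act π₀.C p.2 + act π₀.D y)

/-- Nature's iterates `ω^nat t`. -/
def omegaNat (S : LinSys dx dy du) (π₀ : NominalController ds dy du dω) (w : ℕ → Vec (Fin dx))
    (e : ℕ → Vec (Fin dy)) (t : ℕ) : Vec (Fin dω) :=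
  let p := natState S π₀ w e t
  act π₀.Cω p.2 + act π₀.Dω (act S.C p.1 + e t)

/-! ### Markov operators -/

/-- State matrix of the loop formed by the system and the nominal controller. -/
def loopA (S : LinSys dx dy du) (π₀ : NominalController ds dy du dω) :
    Matrix (Fin dx ⊕ Fin ds) (Fin dx ⊕ Fin ds) ℝ :=
  Matrix.fromBlocks (S.A + S.B * π₀.D * S.C) (S.B * π₀.C) (π₀.B * S.C) π₀.A

/-- Input matrix, from `uex`, of that loop. -/
def loopB (S : LinSys dx dy du) (π₀ : NominalController ds dy du dω) :
    Matrix (Fin dx ⊕ Fin ds) (Fin du) ℝ :=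
  Matrix.fromRows S.B π₀.Bex

/-- The Markov operator (impulse response) from `uex` to `v = (y, u)`. -/
def markovV (S : LinSys dx dy du) (π₀ : NominalController ds dy du dω) :
    ℕ → Matrix (Fin dy ⊕ Fin du) (Fin du) ℝ
  | 0 => Matrix.fromRows 0 1
  | i + 1 =>
      Matrix.fromBlocks S.C 0 (π₀.D * S.C) π₀.C * loopA S π₀ ^ i * loopB S π₀

/-- The Markov operator (impulse response) from `uex` to `ω`. -/
def markovOmega (S : LinSys dx dy du) (π₀ : NominalController ds dy du dω) :
    ℕ → Matrix (Fin dω) (Fin du) ℝ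
  | 0 => 0
  | i + 1 => Matrix.fromCols (π₀.Dω * S.C) π₀.Cω * loopA S π₀ ^ i * loopB S π₀

end ClosedLoops

section Operators

variable {ι κ : Type} [Fintype ι] [Fintype κ] [DecidableEq ι] [DecidableEq κ]

/-- The decay function `ψ_G(n) = ∑_{i ≥ n} ‖G i‖_op`, as an extended real. -/
def decay (G : ℕ → Matrix ι κ ℝ) (n : ℕ) : ℝ≥0∞ := ∑' i, ‖G (n + i)‖ₑ

/-- `‖G‖_{ℓ₁,op} = ∑_i ‖G i‖_op`, as an extended real. -/
def l1op (G : ℕ → Matrix ι κ ℝ) : ℝ≥0∞ := ∑' i, ‖G i‖ₑ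

/-- The invertibility modulus
`κ(G) = min {1, inf {∑_n ‖∑_{i ≤ n} G i u (n - i)‖² : ∑_n ‖u n‖² = 1}}`. -/
def invModulus (G : ℕ → Matrix ι κ ℝ) : ℝ :=
  (min 1 (⨅ (u : ℕ → Vec κ) (_ : ∑' n, ‖u n‖ₑ ^ 2 = 1),
    ∑' n, ‖∑ i ∈ Finset.range (n + 1), act (G i) (u (n - i))‖ₑ ^ 2)).toReal

end Operators

/-- Proper, stable decay functions. -/
def IsDecayFunction (ψ : ℕ → ℝ) : Prop := (∀ n, 0 ≤ ψ n) ∧ Antitone ψ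

/-- `R_{π₀} = max {‖G_{ex→v}‖_{ℓ₁,op}, ‖G_{ex→ω}‖_{ℓ₁,op}}`, as an extended real. -/
def nominalRadius {dx ds dy du dω : ℕ} (S : LinSys dx dy du)
    (π₀ : NominalController ds dy du dω) : ℝ≥0∞ :=
  max (l1op (markovV S π₀)) (l1op (markovOmega S π₀))

/-- Cost regularity: `ℓ` is differentiable, `α`-strongly convex, and
`‖∇ℓ(v)‖ ≤ L max {1, ‖v‖}`. -/
def LossRegular {ι : Type} [Fintype ι] (α L : ℝ) (ℓ : Vec ι → ℝ) : Prop :=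
  Differentiable ℝ ℓ ∧ StrongConvexOn Set.univ α ℓ ∧ ∀ v, ‖gradient ℓ v‖ ≤ L * max 1 ‖v‖

/-! ### The policy benchmark -/

section Benchmark

variable {dx ds dy du dω : ℕ}

/-- `G` is a `π₀ → π` conversion operator: the exogenous inputs
`uex t = ∑_{i=1}^t G (t - i) ω^nat i` on top of `π₀` reproduce the iterates of `π`. -/
def IsConversion (S : LinSys dx dy du) (π₀ : NominalController ds dy du dω)
    (w : ℕ → Vec (Fin dx)) (e : ℕ → Vec (Fin dy)) (π : LDC dy du)
    (G : ℕ → Matrix (Fin du) (Fin dω) ℝ) : Prop :=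
  let uex : ℕ → Vec (Fin du) := fun t =>
    ∑ i ∈ Finset.Icc 1 t, act (G (t - i)) (omegaNat S π₀ w e i)
  ∀ t, 1 ≤ t → policyIterate S π w e t =
    vNat S π₀ w e t + ∑ i ∈ Finset.Icc 1 t, act (markovV S π₀ (t - i)) (uex i)

/-- The comparator class `Π_{stab,π₀}(R, ψ)`. -/
def comparators (S : LinSys dx dy du) (π₀ : NominalController ds dy du dω)
    (w : ℕ → Vec (Fin dx)) (e : ℕ → Vec (Fin dy)) (R : ℝ) (ψ : ℕ → ℝ) : Set (LDC dy du) :=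
  {π | ∃ G, IsConversion S π₀ w e π G ∧ l1op G ≤ ENNReal.ofReal R ∧
    ∀ n, decay G n ≤ ENNReal.ofReal (ψ n)}

end Benchmark

/-! ### The algorithm -/

/-- Index set of the coordinates of the vectorized controller parameter `z = 𝔢(M)`,
`M = (M 0, …, M (m-1))` with each `M i` of size `du × dω`. -/
abbrev PIdx (m du dω : ℕ) := Fin m × Fin du × Fin dω

/-- The matrix `M i` encoded by `z`. -/
def block {m du dω : ℕ} (z : Vec (PIdx m du dω)) (i : Fin m) :
    Matrix (Fin du) (Fin dω) ℝ :=
  Matrix.of fun a b => z (i, a, b)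

/-- The constraint set `{M : ∑_{i<m} ‖M i‖_op ≤ R}`, in vectorized form. -/
def paramSet (m du dω : ℕ) (R : ℝ) : Set (Vec (PIdx m du dω)) :=
  {z | ∑ i, ‖block z i‖ ≤ R}

/-- The matrix `Y t` with `Y t · 𝔢(M) = ∑_{i<m} M i (ω (t - i))`, where `ω s = 0` for `s ≤ 0`. -/
def embed {du dω : ℕ} (m : ℕ) (ω : ℕ → Vec (Fin dω)) (t : ℕ) :
    Matrix (Fin du) (PIdx m du dω) ℝ :=
  Matrix.of fun a p => if a = p.2.1 ∧ (p.1 : ℕ) < t then ω (t - p.1) p.2.2 else 0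

/-- A minimizer over `K` of `z ↦ ‖Λ^{1/2} (z - p)‖² = (z - p)ᵀ Λ (z - p)`. -/
def projOn {ι : Type} [Fintype ι] (K : Set (Vec ι)) (Λ : Matrix ι ι ℝ) (p : Vec ι) : Vec ι :=
  Classical.epsilon fun z => z ∈ K ∧
    ∀ z' ∈ K, inner ℝ (z - p) (act Λ (z - p)) ≤ inner ℝ (z' - p) (act Λ (z' - p))

/-- Inputs of the algorithm: DRC length `m`, memory `h`, step size `η`, regularization `lam`,
radius `RM`, and the two Markov operators. -/
structure AlgInput (dy du dω : ℕ) where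
  m : ℕ
  h : ℕ
  η : ℝ
  lam : ℝ
  RM : ℝ
  Gv : ℕ → Matrix (Fin dy ⊕ Fin du) (Fin du) ℝ
  Gω : ℕ → Matrix (Fin dω) (Fin du) ℝ

/-- Memory of the algorithm at the beginning of a round: past exogenous inputs, past recovered
`ω^nat`, the current parameter `z`, and `Λ`. -/
structure AlgState (m du dω : ℕ) where
  uex : ℕ → Vec (Fin du)
  omegaHat : ℕ → Vec (Fin dω)
  z : Vec (PIdx m du dω)
  Lam : Matrix (PIdx m du dω) (PIdx m du dω) ℝ

section Algorithm

variable {dx ds dy du dω : ℕ}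

/-- Memory before the first round, for the initial parameter `z₁`: `Λ = lam I`. -/
def algInit (P : AlgInput dy du dω) (z₁ : Vec (PIdx P.m du dω)) : AlgState P.m du dω where
  uex := 0
  omegaHat := 0
  z := z₁
  Lam := P.lam • 1

/-- First half of round `t`. After observing `ω t`, the algorithm records
`ω^nat t = ω t - ∑_{i=1}^{t-1} Gω (t - i) uex i` and the exogenous input
`uex t = Y t z = ∑_{i<m} M i ω^nat (t - i)`. -/
def algPlay (P : AlgInput dy du dω) (t : ℕ) (a : AlgState P.m du dω) (ω : Vec (Fin dω)) :
    AlgState P.m du dω :=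
  let ωhat := ω - ∑ i ∈ Finset.Ico 1 t, act (P.Gω (t - i)) (a.uex i)
  let omegaHat := Function.update a.omegaHat t ωhat
  { a with
    omegaHat := omegaHat
    uex := Function.update a.uex t (act (embed P.m omegaHat t) a.z) }

/-- Second half of round `t`. After observing `v t = (y t, u t)` and the loss `ℓ`, the algorithm
recovers `v^nat t = v t - ∑_{i=1}^t Gv (t - i) uex i`, forms `H t = ∑_{i=0}^h Gv i Y (t - i)` and
the loss `f(z) = ℓ (v^nat t + H t z)`, and takes a semi-Newton step:
`Λ ← Λ + H tᵀ H t`, followed by the `Λ`-projection of `z - η Λ⁻¹ ∇f(z)` onto the constraint set. -/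
def algUpdate (P : AlgInput dy du dω) (t : ℕ) (a : AlgState P.m du dω)
    (v : Vec (Fin dy ⊕ Fin du)) (ℓ : Vec (Fin dy ⊕ Fin du) → ℝ) : AlgState P.m du dω :=
  let vhat := v - ∑ i ∈ Finset.Icc 1 t, act (P.Gv (t - i)) (a.uex i)
  let H : Matrix (Fin dy ⊕ Fin du) (PIdx P.m du dω) ℝ :=
    ∑ i ∈ Finset.range (P.h + 1), P.Gv i * embed P.m a.omegaHat (t - i)
  let Lam := a.Lam + H.transpose * H
  let grad := gradient (fun z : Vec (PIdx P.m du dω) => ℓ (vhat + act H z)) a.z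
  { a with
    Lam := Lam
    z := projOn (paramSet P.m du dω P.RM) Lam (a.z - P.η • act Lam⁻¹ grad) }

/-- System, nominal controller and algorithm at the beginning of a round. -/
structure LoopState (dx ds m du dω : ℕ) where
  x : Vec (Fin dx)
  s : Vec (Fin ds)
  alg : AlgState m du dω

/-- The output `y t`, the memory after `algPlay`, and the input `u t` of round `t`. -/
def loopRound (S : LinSys dx dy du) (π₀ : NominalController ds dy du dω)
    (e : ℕ → Vec (Fin dy)) (P : AlgInput dy du dω) (t : ℕ) (p : LoopState dx ds P.m du dω) :
    Vec (Fin dy) × AlgState P.m du dω × Vec (Fin du) :=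
  let y := act S.C p.x + e t
  let a := algPlay P t p.alg (act π₀.Cω p.s + act π₀.Dω y)
  (y, a, a.uex t + act π₀.C p.s + act π₀.D y)

/-- The algorithm in closed loop with the system and the nominal controller. -/
def loopState (S : LinSys dx dy du) (π₀ : NominalController ds dy du dω)
    (w : ℕ → Vec (Fin dx)) (e : ℕ → Vec (Fin dy))
    (ℓ : ℕ → Vec (Fin dy ⊕ Fin du) → ℝ) (P : AlgInput dy du dω)
    (z₁ : Vec (PIdx P.m du dω)) : ℕ → LoopState dx ds P.m du dω :=
  trajectory
    (fun t p =>
      let r := loopRound S π₀ e P t p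
      let y := r.1
      let a := r.2.1
      let u := r.2.2
      { x := act S.A p.x + act S.B u + w t
        s := act π₀.A p.s + act π₀.B y + act π₀.Bex (a.uex t)
        alg := algUpdate P t a (joint y u) (ℓ t) })
    ⟨0, 0, algInit P z₁⟩

/-- `v^alg t = (y^alg t, u^alg t)`. -/
def algIterate (S : LinSys dx dy du) (π₀ : NominalController ds dy du dω)
    (w : ℕ → Vec (Fin dx)) (e : ℕ → Vec (Fin dy))
    (ℓ : ℕ → Vec (Fin dy ⊕ Fin du) → ℝ) (P : AlgInput dy du dω)
    (z₁ : Vec (PIdx P.m du dω)) (t : ℕ) : Vec (Fin dy ⊕ Fin du) :=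
  let r := loopRound S π₀ e P t (loopState S π₀ w e ℓ P z₁ t)
  joint r.1 r.2.2

/-- `ControlReg_T(alg; Π) = ∑_{t ≤ T} ℓ_t(v t) - inf_{π ∈ Π} ∑_{t ≤ T} ℓ_t(v^π t)`, as an extended
real (the infimum over the empty class is `+∞`). -/
def controlReg (S : LinSys dx dy du) (w : ℕ → Vec (Fin dx)) (e : ℕ → Vec (Fin dy))
    (ℓ : ℕ → Vec (Fin dy ⊕ Fin du) → ℝ) (T : ℕ) (v : ℕ → Vec (Fin dy ⊕ Fin du))
    (Pol : Set (LDC dy du)) : EReal :=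
  ((∑ t ∈ Finset.Icc 1 T, ℓ t (v t) : ℝ) : EReal) -
    ⨅ π ∈ Pol, ((∑ t ∈ Finset.Icc 1 T, ℓ t (policyIterate S π w e t) : ℝ) : EReal)

end Algorithm

end Drc

end

/-!
Since the two Markov operators are known, the algorithm recovers nature's iterates exactly, so its
loss in round `t` is a function of the parameters `z_t, z_{t-1}, …` through the convolution of the
inputs `Y_s z_s` with `G_v`: online optimization with memory. The policy `π` is matched, up to
`O(c / T)` per round, by the first `m` coefficients of its conversion operator.

If one parameter had been in use forever, strong convexity would make the online Newton step
logarithmic: its regret is at most a sum of leverages `tr (Λ_t⁻¹ H_tᵀ H_t)`, which telescopes into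
the growth of `log det Λ_t`. What remains is the cost of movement, `‖Y_r (z_r - z_t)‖` for
`r ≤ t ≤ r + h`. The Newton steps are short where the past outputs `H_s` have been large, whereas
the `Y_r` are inputs. Invertibility bridges the two: `κ ∑ ‖u_n‖² ≤ ∑ ‖(G_v * u)_n‖²`, applied to
`Y_n x` with a slowly decaying cutoff, bounds the quadratic form of the inputs by that of the
outputs, as long as the joint second moments do not double within a window of length
`K ≈ h R_{π₀} / √κ`. Each doubling increases `log det` by a constant, so the exceptional rounds
number `O(K log det)`, and the movement cost is logarithmic as well.
-/

namespace Drc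

open scoped Matrix

section Act

variable {ι κ μ σ : Type} [Fintype ι] [Fintype κ] [Fintype μ]

lemma act_eq_toEuclideanLin [DecidableEq κ] (M : Matrix ι κ ℝ) (x : Vec κ) :
    act M x = Matrix.toEuclideanLin M x := rfl

@[simp] lemma act_add (M : Matrix ι κ ℝ) (x y : Vec κ) : act M (x + y) = act M x + act M y := by
  classical simp only [act_eq_toEuclideanLin, map_add]

@[simp] lemma act_sub (M : Matrix ι κ ℝ) (x y : Vec κ) : act M (x - y) = act M x - act M y := by
  classical simp only [act_eq_toEuclideanLin, map_sub]

@[simp] lemma act_neg (M : Matrix ι κ ℝ) (x : Vec κ) : act M (-x) = -act M x := by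
  classical simp only [act_eq_toEuclideanLin, map_neg]

@[simp] lemma act_smul (M : Matrix ι κ ℝ) (c : ℝ) (x : Vec κ) : act M (c • x) = c • act M x := by
  classical simp only [act_eq_toEuclideanLin, map_smul]

@[simp] lemma act_zero (M : Matrix ι κ ℝ) : act M (0 : Vec κ) = 0 := by
  classical simp only [act_eq_toEuclideanLin, map_zero]

lemma act_sum (M : Matrix ι κ ℝ) (s : Finset σ) (f : σ → Vec κ) :
    act M (∑ i ∈ s, f i) = ∑ i ∈ s, act M (f i) := by
  classical simp only [act_eq_toEuclideanLin, map_sum]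

@[simp] lemma zero_act (x : Vec κ) : act (0 : Matrix ι κ ℝ) x = 0 := by
  classical simp only [act_eq_toEuclideanLin, map_zero, LinearMap.zero_apply]

@[simp] lemma add_act (M N : Matrix ι κ ℝ) (x : Vec κ) : act (M + N) x = act M x + act N x := by
  classical simp only [act_eq_toEuclideanLin, map_add, LinearMap.add_apply]

@[simp] lemma smul_act (c : ℝ) (M : Matrix ι κ ℝ) (x : Vec κ) : act (c • M) x = c • act M x := by
  classical simp only [act_eq_toEuclideanLin, map_smul, LinearMap.smul_apply]

lemma sum_act (s : Finset σ) (f : σ → Matrix ι κ ℝ) (x : Vec κ) :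
    act (∑ i ∈ s, f i) x = ∑ i ∈ s, act (f i) x := by
  classical simp only [act_eq_toEuclideanLin, map_sum, LinearMap.sum_apply]

lemma mul_act (M : Matrix ι κ ℝ) (N : Matrix κ μ ℝ) (x : Vec μ) :
    act (M * N) x = act M (act N x) := by
  simp only [act, Matrix.mulVec_mulVec]

@[simp] lemma one_act [DecidableEq ι] (x : Vec ι) : act (1 : Matrix ι ι ℝ) x = x := by
  simp only [act, Matrix.one_mulVec]

lemma inner_act (M : Matrix ι κ ℝ) (x : Vec ι) (y : Vec κ) :
    inner ℝ x (act M y) = inner ℝ (act Mᵀ x) y := by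
  classical
  rw [← Matrix.conjTranspose_eq_transpose_of_trivial, act_eq_toEuclideanLin, act_eq_toEuclideanLin,
    Matrix.toEuclideanLin_conjTranspose_eq_adjoint, LinearMap.adjoint_inner_left]

lemma norm_act_le [DecidableEq κ] (M : Matrix ι κ ℝ) (x : Vec κ) :
    ‖act M x‖ ≤ ‖M‖ * ‖x‖ :=
  Matrix.l2_opNorm_mulVec M x

lemma continuous_act (M : Matrix ι κ ℝ) : Continuous (act M) := by
  unfold act; fun_prop

end Act

section Quadratic

lemma posSemidef_transpose_mul_self {ι κ : Type} [Finite ι] [Fintype κ]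
    (P : Matrix κ ι ℝ) : (Pᵀ * P).PosSemidef := by
  simpa only [Matrix.conjTranspose_eq_transpose_of_trivial] using
    Matrix.posSemidef_conjTranspose_mul_self P

lemma transpose_eq_of_posSemidef {ι : Type} {S : Matrix ι ι ℝ} (hS : S.PosSemidef) : Sᵀ = S := by
  simpa only [Matrix.conjTranspose_eq_transpose_of_trivial] using hS.isHermitian.eq

variable {ι κ σ : Type} [Fintype ι] [Fintype κ]

/-- The quadratic form `xᵀ S x` of a square matrix, on Euclidean vectors. It carries all the
weighted norms `‖S^{1/2} x‖²` of the analysis without taking matrix square roots. -/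
noncomputable def quad (S : Matrix ι ι ℝ) (x : Vec ι) : ℝ := inner ℝ x (act S x)

lemma quad_transpose_mul_self (P : Matrix κ ι ℝ) (x : Vec ι) :
    quad (Pᵀ * P) x = ‖act P x‖ ^ 2 := by
  rw [quad, mul_act, inner_act, Matrix.transpose_transpose, real_inner_self_eq_norm_sq]

lemma add_quad (S R : Matrix ι ι ℝ) (x : Vec ι) : quad (S + R) x = quad S x + quad R x := by
  simp only [quad, add_act, inner_add_right]

lemma smul_quad (c : ℝ) (S : Matrix ι ι ℝ) (x : Vec ι) : quad (c • S) x = c * quad S x := by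
  simp only [quad, smul_act, real_inner_smul_right]

lemma sum_quad (s : Finset σ) (f : σ → Matrix ι ι ℝ) (x : Vec ι) :
    quad (∑ i ∈ s, f i) x = ∑ i ∈ s, quad (f i) x := by
  simp only [quad, sum_act, inner_sum]

lemma one_quad [DecidableEq ι] (x : Vec ι) : quad (1 : Matrix ι ι ℝ) x = ‖x‖ ^ 2 := by
  rw [quad, one_act, real_inner_self_eq_norm_sq]

lemma quad_add_smul {S : Matrix ι ι ℝ} (hS : Sᵀ = S) (x y : Vec ι) (c : ℝ) :
    quad S (x + c • y) = quad S x + 2 * c * inner ℝ y (act S x) + c ^ 2 * quad S y := by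
  have hcross : inner ℝ x (act S y) = inner ℝ y (act S x) := by
    rw [inner_act, hS, real_inner_comm]
  simp only [quad, act_add, act_smul, inner_add_left, inner_add_right, real_inner_smul_left,
    real_inner_smul_right, hcross]
  ring

open scoped MatrixOrder in
lemma exists_eq_transpose_mul_self {S : Matrix ι ι ℝ} (hS : S.PosSemidef) :
    ∃ R : Matrix ι ι ℝ, S = Rᵀ * R := by
  classical
  obtain ⟨R, hR⟩ := CStarAlgebra.nonneg_iff_eq_star_mul_self.mp hS.nonneg
  exact ⟨R, by
    simpa only [Matrix.star_eq_conjTranspose, Matrix.conjTranspose_eq_transpose_of_trivial]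
      using hR⟩

lemma quad_nonneg {S : Matrix ι ι ℝ} (hS : S.PosSemidef) (x : Vec ι) : 0 ≤ quad S x := by
  obtain ⟨R, rfl⟩ := exists_eq_transpose_mul_self hS
  rw [quad_transpose_mul_self]
  positivity

lemma inner_act_sq_le {S : Matrix ι ι ℝ} (hS : S.PosSemidef) (x y : Vec ι) :
    inner ℝ x (act S y) ^ 2 ≤ quad S x * quad S y := by
  obtain ⟨R, rfl⟩ := exists_eq_transpose_mul_self hS
  rw [quad_transpose_mul_self, quad_transpose_mul_self, mul_act, inner_act,
    Matrix.transpose_transpose, ← mul_pow]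
  exact sq_le_sq.2 ((abs_real_inner_le_norm _ _).trans (le_abs_self _))

variable [DecidableEq ι]

lemma act_act_inv {S : Matrix ι ι ℝ} (hS : S.PosDef) (x : Vec ι) : act S (act S⁻¹ x) = x := by
  rw [← mul_act, Matrix.mul_nonsing_inv _ ((Matrix.isUnit_iff_isUnit_det _).1 hS.isUnit), one_act]

lemma quad_act_inv {S : Matrix ι ι ℝ} (hS : S.PosDef) (x : Vec ι) :
    quad S (act S⁻¹ x) = quad S⁻¹ x := by
  rw [quad, quad, act_act_inv hS, real_inner_comm]

lemma inner_sq_le_quad_inv_mul_quad {S : Matrix ι ι ℝ} (hS : S.PosDef) (p x : Vec ι) :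
    inner ℝ p x ^ 2 ≤ quad S⁻¹ p * quad S x := by
  have h := inner_act_sq_le hS.posSemidef x (act S⁻¹ p)
  rwa [act_act_inv hS, quad_act_inv hS, real_inner_comm, mul_comm] at h

end Quadratic

section Leverage

variable {ι κ : Type} [Fintype ι] [Fintype κ] [DecidableEq ι]

/-- The leverage `tr (S⁻¹ W)` of `W` relative to `S`: the total size of the form `W` measured in the
geometry of `S`. (For singular `S` it is `0`, the value of Mathlib's `S⁻¹`.) -/
noncomputable def leverage (S W : Matrix ι ι ℝ) : ℝ := (S⁻¹ * W).trace

lemma leverage_transpose_mul_self (S : Matrix ι ι ℝ) (P : Matrix κ ι ℝ) :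
    leverage S (Pᵀ * P) = ∑ k, quad S⁻¹ (WithLp.toLp 2 (P k)) := by
  rw [leverage, ← Matrix.mul_assoc, Matrix.trace_mul_comm, Matrix.trace]
  refine Finset.sum_congr rfl fun k _ => ?_
  simp only [quad, act, EuclideanSpace.inner_toLp_toLp, star_trivial, Matrix.diag_apply,
    Matrix.mul_apply, Matrix.mulVec, dotProduct, Matrix.transpose_apply]
  exact Finset.sum_congr rfl fun i _ => mul_comm _ _

lemma leverage_nonneg {S W : Matrix ι ι ℝ} (hS : S.PosDef) (hW : W.PosSemidef) :
    0 ≤ leverage S W := by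
  obtain ⟨P, rfl⟩ := exists_eq_transpose_mul_self hW
  rw [leverage_transpose_mul_self]
  exact Finset.sum_nonneg fun k _ => quad_nonneg hS.inv.posSemidef _

lemma leverage_add (S V W : Matrix ι ι ℝ) : leverage S (V + W) = leverage S V + leverage S W := by
  rw [leverage, Matrix.mul_add, Matrix.trace_add, leverage, leverage]

lemma leverage_smul (S : Matrix ι ι ℝ) (c : ℝ) (W : Matrix ι ι ℝ) :
    leverage S (c • W) = c * leverage S W := by
  rw [leverage, Matrix.mul_smul, Matrix.trace_smul, smul_eq_mul, leverage]

lemma leverage_self {S : Matrix ι ι ℝ} (hS : S.PosDef) : leverage S S = Fintype.card ι := by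
  rw [leverage, Matrix.nonsing_inv_mul _ ((Matrix.isUnit_iff_isUnit_det _).1 hS.isUnit),
    Matrix.trace_one]

lemma quad_le_leverage_mul_quad {S W : Matrix ι ι ℝ} (hS : S.PosDef) (hW : W.PosSemidef)
    (x : Vec ι) : quad W x ≤ leverage S W * quad S x := by
  obtain ⟨P, rfl⟩ := exists_eq_transpose_mul_self hW
  rw [quad_transpose_mul_self, leverage_transpose_mul_self, EuclideanSpace.real_norm_sq_eq,
    Finset.sum_mul]
  refine Finset.sum_le_sum fun k _ => ?_
  have hrow : (act P x) k = inner ℝ (WithLp.toLp 2 (P k) : Vec ι) x := by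
    rw [real_inner_comm]
    rfl
  rw [hrow]
  exact inner_sq_le_quad_inv_mul_quad hS _ _

lemma quad_inv_transpose_act_le {S : Matrix ι ι ℝ} (hS : S.PosDef) (P : Matrix κ ι ℝ)
    (n : Vec κ) : quad S⁻¹ (act Pᵀ n) ≤ ‖n‖ ^ 2 * leverage S (Pᵀ * P) := by
  set y := act S⁻¹ (act Pᵀ n)
  have hquad : quad S⁻¹ (act Pᵀ n) = quad S y := (quad_act_inv hS _).symm
  have hinner : quad S y = inner ℝ n (act P y) := by
    rw [quad, act_act_inv hS, inner_act, Matrix.transpose_transpose, real_inner_comm]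
  have hlev := leverage_nonneg hS (posSemidef_transpose_mul_self P)
  have hsq : quad S y ^ 2 ≤ ‖n‖ ^ 2 * leverage S (Pᵀ * P) * quad S y := by
    calc quad S y ^ 2 = inner ℝ n (act P y) ^ 2 := by rw [hinner]
      _ ≤ (‖n‖ * ‖act P y‖) ^ 2 :=
        sq_le_sq.2 ((abs_real_inner_le_norm _ _).trans (le_abs_self _))
      _ = ‖n‖ ^ 2 * quad (Pᵀ * P) y := by rw [mul_pow, quad_transpose_mul_self]
      _ ≤ ‖n‖ ^ 2 * (leverage S (Pᵀ * P) * quad S y) := by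
        gcongr
        exact quad_le_leverage_mul_quad hS (posSemidef_transpose_mul_self P) y
      _ = _ := by ring
  rw [hquad]
  rcases (quad_nonneg hS.posSemidef y).eq_or_lt with hzero | hpos
  · rw [← hzero]; positivity
  · exact le_of_mul_le_mul_right (by rwa [← sq]) hpos

end Leverage

section LogDet

variable {ι : Type} [Fintype ι] [DecidableEq ι]

lemma log_det_le_trace_sub_card {A : Matrix ι ι ℝ} (hA : A.PosDef) :
    Real.log A.det ≤ A.trace - Fintype.card ι := by
  rw [hA.isHermitian.det_eq_prod_eigenvalues, hA.isHermitian.trace_eq_sum_eigenvalues]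
  simp only [RCLike.ofReal_real_eq_id, id]
  rw [Real.log_prod fun i _ => (hA.eigenvalues_pos i).ne', ← nsmul_one, ← Finset.card_univ,
    ← Finset.sum_const, ← Finset.sum_sub_distrib]
  exact Finset.sum_le_sum fun i _ => Real.log_le_sub_one_of_pos (hA.eigenvalues_pos i)

lemma log_det_le_of_trace_le {A : Matrix ι ι ℝ} (hA : A.PosDef) {c : ℝ} (hc : 0 < c)
    (htr : A.trace ≤ Fintype.card ι * c) : Real.log A.det ≤ Fintype.card ι * Real.log c := by
  have h := log_det_le_trace_sub_card (hA.smul (inv_pos.2 hc))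
  rw [Matrix.det_smul, Matrix.trace_smul, smul_eq_mul,
    Real.log_mul (by positivity) hA.det_pos.ne', Real.log_pow, Real.log_inv] at h
  have hscaled : c⁻¹ * A.trace ≤ Fintype.card ι := by rwa [inv_mul_le_iff₀' hc]
  linarith

lemma log_det_sub_log_det_le {A B : Matrix ι ι ℝ} (hA : A.PosDef) (hB : B.PosDef) :
    Real.log B.det - Real.log A.det ≤ leverage A B - Fintype.card ι := by
  obtain ⟨R, rfl⟩ := exists_eq_transpose_mul_self hA.posSemidef
  have hRunit : IsUnit R.det := by
    rw [isUnit_iff_ne_zero]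
    intro hzero
    simpa [hzero] using hA.det_pos
  set Q := R⁻¹
  have hcongr : (Qᵀ * B * Q).PosDef := by
    simpa only [Matrix.conjTranspose_eq_transpose_of_trivial] using
      hB.conjTranspose_mul_mul_same (B := Q) (Matrix.mulVec_injective_of_isUnit <|
        (Matrix.isUnit_iff_isUnit_det _).2 (Matrix.isUnit_nonsing_inv_det R hRunit))
  have htrace : (Qᵀ * B * Q).trace = leverage (Rᵀ * R) B := by
    rw [leverage, Matrix.mul_inv_rev, ← Matrix.transpose_nonsing_inv, Matrix.trace_mul_comm,
      Matrix.mul_assoc]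
  have hlog : Real.log (Qᵀ * B * Q).det = Real.log B.det - Real.log (Rᵀ * R).det := by
    rw [← Real.log_div hB.det_pos.ne' hA.det_pos.ne']
    congr 1
    simp only [Matrix.det_mul, Matrix.det_transpose, Q, Matrix.det_nonsing_inv,
      Ring.inverse_eq_inv']
    field_simp
  rw [← hlog, ← htrace]
  exact log_det_le_trace_sub_card hcongr

lemma log_det_add_leverage_le {A W : Matrix ι ι ℝ} (hA : A.PosDef) (hW : W.PosSemidef) :
    Real.log A.det + leverage (A + W) W ≤ Real.log (A + W).det := by
  have hAW : (A + W).PosDef := hA.add_posSemidef hW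
  have hconcave := log_det_sub_log_det_le hAW hA
  have hsplit := leverage_add (A + W) A W
  rw [leverage_self hAW] at hsplit
  linarith

lemma log_det_add_half_le {A W : Matrix ι ι ℝ} (hA : A.PosDef) (hW : W.PosSemidef) {x : Vec ι}
    (hx : 2 * quad A x < quad (A + W) x) :
    Real.log A.det + 1 / 2 ≤ Real.log (A + W).det := by
  have hAW : (A + W).PosDef := hA.add_posSemidef hW
  have hquad := quad_le_leverage_mul_quad hAW hW x
  have hA0 := quad_nonneg hA.posSemidef x
  have hsum := add_quad A W x
  have hhalf : 1 / 2 ≤ leverage (A + W) W := by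
    by_contra! hlt
    nlinarith
  linarith [log_det_add_leverage_le hA hW]

end LogDet

section Potential

variable {ι : Type} [Fintype ι] [DecidableEq ι] {lam : ℝ} {W : ℕ → Matrix ι ι ℝ}

/-- The regularized sum `lam I + W 0 + ⋯ + W t`. Rounds being numbered from `1`, it is meant for
sequences with `W 0 = 0`. -/
noncomputable def regSum (lam : ℝ) (W : ℕ → Matrix ι ι ℝ) (t : ℕ) : Matrix ι ι ℝ :=
  lam • 1 + ∑ s ∈ Finset.range (t + 1), W s

/-- The growth of `log det` from `lam I` to `regSum lam W t`: the potential that pays for all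
leverages. -/
noncomputable def logDetGrowth (lam : ℝ) (W : ℕ → Matrix ι ι ℝ) (t : ℕ) : ℝ :=
  Real.log (regSum lam W t).det - Real.log (lam • (1 : Matrix ι ι ℝ)).det

omit [Fintype ι] in
lemma posDef_regSum (hlam : 0 < lam) (hW : ∀ t, (W t).PosSemidef) (t : ℕ) :
    (regSum lam W t).PosDef :=
  (Matrix.PosDef.one.smul hlam).add_posSemidef (Matrix.posSemidef_sum _ fun s _ => hW s)

omit [Fintype ι] in
lemma regSum_succ (t : ℕ) : regSum lam W (t + 1) = regSum lam W t + W (t + 1) := by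
  rw [regSum, Finset.sum_range_succ, ← add_assoc, regSum]

omit [Fintype ι] in
lemma regSum_add (t k : ℕ) :
    regSum lam W (t + k) = regSum lam W t + ∑ j ∈ Finset.range k, W (t + 1 + j) := by
  rw [regSum, regSum, add_right_comm t k 1, Finset.sum_range_add, add_assoc]

lemma quad_regSum (t : ℕ) (x : Vec ι) :
    quad (regSum lam W t) x = lam * ‖x‖ ^ 2 + ∑ s ∈ Finset.range (t + 1), quad (W s) x := by
  rw [regSum, add_quad, smul_quad, one_quad, sum_quad]

lemma quad_regSum_mono (hW : ∀ t, (W t).PosSemidef) {s t : ℕ} (hst : s ≤ t) (x : Vec ι) :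
    quad (regSum lam W s) x ≤ quad (regSum lam W t) x := by
  obtain ⟨k, rfl⟩ := Nat.exists_eq_add_of_le hst
  rw [regSum_add, add_quad, sum_quad]
  exact le_add_of_nonneg_right (Finset.sum_nonneg fun j _ => quad_nonneg (hW _) x)

lemma logDetGrowth_add_leverage_le (hlam : 0 < lam) (hW : ∀ t, (W t).PosSemidef) (t : ℕ) :
    logDetGrowth lam W t + leverage (regSum lam W (t + 1)) (W (t + 1)) ≤
      logDetGrowth lam W (t + 1) := by
  have h := log_det_add_leverage_le (posDef_regSum hlam hW t) (hW (t + 1))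
  rw [← regSum_succ] at h
  rw [logDetGrowth, logDetGrowth]
  linarith

lemma monotone_logDetGrowth (hlam : 0 < lam) (hW : ∀ t, (W t).PosSemidef) :
    Monotone (logDetGrowth lam W) :=
  monotone_nat_of_le_succ fun t => by
    linarith [logDetGrowth_add_leverage_le hlam hW t,
      leverage_nonneg (posDef_regSum hlam hW (t + 1)) (hW (t + 1))]

lemma sum_leverage_le_logDetGrowth (hlam : 0 < lam) (hW : ∀ t, (W t).PosSemidef) (n : ℕ) :
    ∑ t ∈ Finset.range (n + 1), leverage (regSum lam W t) (W t) ≤ logDetGrowth lam W n := by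
  induction n with
  | zero =>
    have h := log_det_add_leverage_le (Matrix.PosDef.one.smul hlam) (hW 0)
    simp only [zero_add, Finset.sum_range_one, logDetGrowth, regSum]
    linarith
  | succ n ih =>
    rw [Finset.sum_range_succ]
    linarith [logDetGrowth_add_leverage_le hlam hW n]

lemma logDetGrowth_nonneg (hlam : 0 < lam) (hW : ∀ t, (W t).PosSemidef) (n : ℕ) :
    0 ≤ logDetGrowth lam W n :=
  (Finset.sum_nonneg fun t _ => leverage_nonneg (posDef_regSum hlam hW t) (hW t)).trans
    (sum_leverage_le_logDetGrowth hlam hW n)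

lemma logDetGrowth_le (hlam : 0 < lam) (hW : ∀ t, (W t).PosSemidef) (hW0 : W 0 = 0)
    (htr : ∀ t, (W t).trace ≤ Fintype.card ι * lam) (n : ℕ) :
    logDetGrowth lam W n ≤ Fintype.card ι * Real.log (1 + n) := by
  have hsum : ∑ s ∈ Finset.range (n + 1), (W s).trace ≤ n * (Fintype.card ι * lam) := by
    rw [Finset.sum_range_succ', hW0, Matrix.trace_zero, add_zero, ← nsmul_eq_mul]
    exact (Finset.sum_le_card_nsmul _ _ _ fun s _ => htr (s + 1)).trans_eq
      (by rw [Finset.card_range])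
  have htrace : (regSum lam W n).trace ≤ Fintype.card ι * (lam * (1 + n)) := by
    rw [regSum, Matrix.trace_add, Matrix.trace_smul, Matrix.trace_one, Matrix.trace_sum,
      smul_eq_mul]
    linarith
  have hlog := log_det_le_of_trace_le (posDef_regSum hlam hW n) (by positivity) htrace
  rw [Real.log_mul hlam.ne' (by positivity)] at hlog
  rw [logDetGrowth, Matrix.det_smul, Matrix.det_one, mul_one, Real.log_pow]
  linarith

lemma sum_shift_sub_le {f : ℕ → ℝ} (hf : Monotone f) {K N T : ℕ} (h : N + K ≤ T + 1) :
    ∑ r ∈ Finset.range N, (f (r + K) - f r) ≤ K * (f T - f 0) := by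
  induction K with
  | zero => simp
  | succ K ih =>
    have htelescope : ∑ r ∈ Finset.range N, (f (r + (K + 1)) - f r) =
        ∑ r ∈ Finset.range N, (f (r + K) - f r) + (f (N + K) - f K) := by
      have hsub := Finset.sum_range_sub (fun r => f (r + K)) N
      rw [zero_add] at hsub
      rw [← hsub, ← Finset.sum_add_distrib]
      refine Finset.sum_congr rfl fun r _ => ?_
      rw [add_right_comm r 1 K, add_assoc r K 1]
      ring
    have hlast : f (N + K) ≤ f T := hf (by omega)
    have hfirst : f 0 ≤ f K := hf (by omega)
    have hrest := ih (by omega)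
    rw [htelescope]
    push_cast
    linarith

lemma mul_card_filter_le_shift_sub_le {f : ℕ → ℝ} (hf : Monotone f) (δ : ℝ) (K T : ℕ) :
    δ * ((Finset.range (T + 1 - K)).filter fun r => δ ≤ f (r + K) - f r).card ≤
      K * (f T - f 0) := by
  calc δ * ((Finset.range (T + 1 - K)).filter fun r => δ ≤ f (r + K) - f r).card
      ≤ ∑ r ∈ (Finset.range (T + 1 - K)).filter (fun r => δ ≤ f (r + K) - f r),
          (f (r + K) - f r) := by
        rw [mul_comm, ← nsmul_eq_mul]
        exact Finset.card_nsmul_le_sum _ _ _ fun r hr => (Finset.mem_filter.1 hr).2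
    _ ≤ ∑ r ∈ Finset.range (T + 1 - K), (f (r + K) - f r) :=
        Finset.sum_le_sum_of_subset_of_nonneg (Finset.filter_subset _ _) fun r _ _ =>
          sub_nonneg.2 (hf (Nat.le_add_right r K))
    _ ≤ K * (f T - f 0) := by
        rcases le_or_gt (T + 1) K with hle | hlt
        · rw [Nat.sub_eq_zero_of_le hle, Finset.sum_range_zero]
          exact mul_nonneg K.cast_nonneg (sub_nonneg.2 (hf T.zero_le))
        · exact sum_shift_sub_le hf (by omega)

/-- Round `r` is unsettled for the increasing sequence of forms `S` if `S` at least doubles, in some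
direction, between rounds `r` and `r + K`, or if round `r + K` lies beyond the horizon `T`. -/
def IsUnsettled (S : ℕ → Matrix ι ι ℝ) (K T r : ℕ) : Prop :=
  T < r + K ∨ ∃ x, 2 * quad (S r) x < quad (S (r + K)) x

lemma logDetGrowth_add_half_le (hlam : 0 < lam) (hW : ∀ t, (W t).PosSemidef) {K r : ℕ} {x : Vec ι}
    (hx : 2 * quad (regSum lam W r) x < quad (regSum lam W (r + K)) x) :
    1 / 2 ≤ logDetGrowth lam W (r + K) - logDetGrowth lam W r := by
  rw [regSum_add] at hx
  have h := log_det_add_half_le (posDef_regSum hlam hW r)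
    (Matrix.posSemidef_sum _ fun j _ => hW (r + 1 + j)) hx
  rw [logDetGrowth, logDetGrowth, regSum_add]
  linarith

open scoped Classical in
lemma card_isUnsettled_le (hlam : 0 < lam) (hW : ∀ t, (W t).PosSemidef) (K T : ℕ) :
    (((Finset.range (T + 1)).filter (IsUnsettled (regSum lam W) K T)).card : ℝ) ≤
      K + 2 * K * logDetGrowth lam W T := by
  set growing := (Finset.range (T + 1 - K)).filter fun r =>
    1 / 2 ≤ logDetGrowth lam W (r + K) - logDetGrowth lam W r
  have hsubset : (Finset.range (T + 1)).filter (IsUnsettled (regSum lam W) K T) ⊆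
      Finset.Ico (T + 1 - K) (T + 1) ∪ growing := by
    intro r hr
    rw [Finset.mem_filter, Finset.mem_range] at hr
    rw [Finset.mem_union, Finset.mem_Ico, Finset.mem_filter, Finset.mem_range]
    rcases lt_or_ge T (r + K) with hlate | hearly
    · left; omega
    · obtain ⟨x, hx⟩ := hr.2.resolve_left (by omega)
      exact Or.inr ⟨by omega, logDetGrowth_add_half_le hlam hW hx⟩
  have hcard : (((Finset.range (T + 1)).filter (IsUnsettled (regSum lam W) K T)).card : ℝ) ≤
      (Finset.Ico (T + 1 - K) (T + 1)).card + growing.card := by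
    exact_mod_cast (Finset.card_le_card hsubset).trans (Finset.card_union_le _ _)
  have hlate : ((Finset.Ico (T + 1 - K) (T + 1)).card : ℝ) ≤ K := by
    rw [Nat.card_Ico]; exact_mod_cast (by omega)
  have hgrowing := mul_card_filter_le_shift_sub_le (monotone_logDetGrowth hlam hW) (1 / 2) K T
  have hinit := mul_nonneg K.cast_nonneg (logDetGrowth_nonneg hlam hW 0)
  linarith

end Potential

section Convolution

lemma sum_conv_le {β x : ℕ → ℝ} {b : ℝ} (hβ : ∀ i, 0 ≤ β i) (hx : ∀ s, 0 ≤ x s)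
    (hb : ∀ n, ∑ i ∈ Finset.range n, β i ≤ b) (n : ℕ) :
    ∑ t ∈ Finset.range n, ∑ i ∈ Finset.range (t + 1), β i * x (t - i) ≤
      b * ∑ s ∈ Finset.range n, x s := by
  rw [Finset.sum_range_diag_flip n fun i s => β i * x s]
  calc ∑ i ∈ Finset.range n, ∑ s ∈ Finset.range (n - i), β i * x s
      ≤ ∑ i ∈ Finset.range n, β i * ∑ s ∈ Finset.range n, x s := by
        refine Finset.sum_le_sum fun i _ => ?_
        rw [← Finset.mul_sum]
        refine mul_le_mul_of_nonneg_left ?_ (hβ i)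
        exact Finset.sum_le_sum_of_subset_of_nonneg
          (Finset.range_subset_range.2 (Nat.sub_le n i)) fun s _ _ => hx s
    _ ≤ b * ∑ s ∈ Finset.range n, x s := by
        rw [← Finset.sum_mul]
        exact mul_le_mul_of_nonneg_right (hb n) (Finset.sum_nonneg fun s _ => hx s)

lemma sum_sq_conv_le {β x : ℕ → ℝ} {b : ℝ} (hβ : ∀ i, 0 ≤ β i)
    (hb : ∀ n, ∑ i ∈ Finset.range n, β i ≤ b) (n : ℕ) :
    ∑ t ∈ Finset.range n, (∑ i ∈ Finset.range (t + 1), β i * x (t - i)) ^ 2 ≤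
      b ^ 2 * ∑ s ∈ Finset.range n, x s ^ 2 := by
  have hb0 : 0 ≤ b := by simpa using hb 0
  have hcauchy : ∀ t, (∑ i ∈ Finset.range (t + 1), β i * x (t - i)) ^ 2 ≤
      b * ∑ i ∈ Finset.range (t + 1), β i * x (t - i) ^ 2 := fun t =>
    (Finset.sum_sq_le_sum_mul_sum_of_sq_le_mul _ (fun i _ => hβ i)
      (fun i _ => mul_nonneg (hβ i) (sq_nonneg (x (t - i))))
      (fun i _ => by rw [mul_pow, sq (β i), mul_assoc])).trans
    (mul_le_mul_of_nonneg_right (hb _)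
      (Finset.sum_nonneg fun i _ => mul_nonneg (hβ i) (sq_nonneg _)))
  calc ∑ t ∈ Finset.range n, (∑ i ∈ Finset.range (t + 1), β i * x (t - i)) ^ 2
      ≤ b * ∑ t ∈ Finset.range n, ∑ i ∈ Finset.range (t + 1), β i * x (t - i) ^ 2 := by
        rw [Finset.mul_sum]
        exact Finset.sum_le_sum fun t _ => hcauchy t
    _ ≤ b * (b * ∑ s ∈ Finset.range n, x s ^ 2) :=
        mul_le_mul_of_nonneg_left (sum_conv_le hβ (fun s => sq_nonneg _) hb n) hb0
    _ = b ^ 2 * ∑ s ∈ Finset.range n, x s ^ 2 := by ring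

lemma sum_range_eq_sum_ite {E : Type*} [AddCommMonoid E] {f : ℕ → E} {n : ℕ}
    (hf : ∀ i, n < i → f i = 0) (h : ℕ) :
    ∑ i ∈ Finset.range (h + 1), f i =
      ∑ i ∈ Finset.range (n + 1), if i ≤ h then f i else 0 := by
  rw [← Finset.sum_filter]
  refine (Finset.sum_subset_zero_on_sdiff (fun i hi => ?_) (fun i hi => ?_) fun _ _ => rfl).symm
  · simp only [Finset.mem_filter, Finset.mem_range] at hi ⊢; omega
  · simp only [Finset.mem_sdiff, Finset.mem_filter, Finset.mem_range] at hi
    exact hf i (by omega)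

lemma sum_ite_lt_le {f : ℕ → ℝ} (hf : ∀ s, 0 ≤ f s) (M N : ℕ) :
    ∑ s ∈ Finset.range M, (if s < N then f s else 0) ≤ ∑ s ∈ Finset.range N, f s := by
  rw [← Finset.sum_filter]
  exact Finset.sum_le_sum_of_subset_of_nonneg
    (fun s hs => Finset.mem_range.2 (Finset.mem_filter.1 hs).2) fun s _ _ => hf s

lemma sum_sum_Ico_le {f : ℕ → ℝ} (hf : ∀ s, 0 ≤ f s) (h N : ℕ) :
    ∑ t ∈ Finset.range N, ∑ s ∈ Finset.Ico (t - h) t, f s ≤ h * ∑ s ∈ Finset.range N, f s := by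
  rw [Finset.sum_comm' (t' := Finset.range N)
    (s' := fun s => (Finset.Ioc s (s + h)).filter (· < N)) fun t s => by
      simp only [Finset.mem_range, Finset.mem_Ico, Finset.mem_filter, Finset.mem_Ioc]; omega,
    Finset.mul_sum]
  refine Finset.sum_le_sum fun s _ => ?_
  rw [Finset.sum_const, nsmul_eq_mul]
  refine mul_le_mul_of_nonneg_right (Nat.cast_le.2 ?_) (hf s)
  exact (Finset.card_filter_le _ _).trans_eq (by rw [Nat.card_Ioc, Nat.add_sub_cancel_left])

end Convolution

section Ramp

/-- The cutoff equal to `1` up to `t` that decreases linearly to `0` on `[t, t + K]`. Truncated in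
time by it, a signal is still almost compatible with convolutions of memory much shorter than
`K`. -/
noncomputable def ramp (t K s : ℕ) : ℝ := max 0 (min 1 (1 - ((s : ℝ) - t) / K))

/-- The weight of the `i`-th Markov parameter in the error made when a convolution is truncated to
memory `h` and its input is cut off by a `ramp` of length `K`: the ramp varies by at most `h / K`
over the memory, and the parameters beyond the memory are lost. -/
noncomputable def truncationWeight (h K i : ℕ) : ℝ := if i ≤ h then (h : ℝ) / K else 1

lemma ramp_nonneg (t K s : ℕ) : 0 ≤ ramp t K s := le_max_left _ _

lemma ramp_le_one (t K s : ℕ) : ramp t K s ≤ 1 := max_le zero_le_one (min_le_left _ _)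

lemma ramp_eq_one {t s : ℕ} (K : ℕ) (h : s ≤ t) : ramp t K s = 1 := by
  have hslope : ((s : ℝ) - t) / K ≤ 0 :=
    div_nonpos_of_nonpos_of_nonneg (sub_nonpos.2 (by exact_mod_cast h)) (Nat.cast_nonneg K)
  rw [ramp, min_eq_left (by linarith), max_eq_right zero_le_one]

lemma ramp_eq_zero {t K s : ℕ} (hK : 0 < K) (h : t + K ≤ s) : ramp t K s = 0 := by
  have hslope : 1 ≤ ((s : ℝ) - t) / K := by
    rw [le_div_iff₀ (by exact_mod_cast hK)]
    have : (t : ℝ) + K ≤ s := by exact_mod_cast h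
    linarith
  rw [ramp, max_eq_left ((min_le_right _ _).trans (by linarith))]

lemma abs_ramp_sub_ramp_le (t K s i : ℕ) : |ramp t K s - ramp t K (s + i)| ≤ i / K := by
  have hquot : (0 : ℝ) ≤ i / K := by positivity
  unfold ramp
  refine (abs_max_sub_max_le_max _ _ _ _).trans (max_le (by rwa [sub_self, abs_zero]) ?_)
  refine (abs_min_sub_min_le_max _ _ _ _).trans
    (max_le (by rwa [sub_self, abs_zero]) (le_of_eq ?_))
  rw [← abs_of_nonneg hquot]
  congr 1
  push_cast
  ring

lemma truncationWeight_nonneg (h K i : ℕ) : 0 ≤ truncationWeight h K i := by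
  unfold truncationWeight
  split_ifs <;> positivity

lemma abs_ramp_sub_ite_le (t h K : ℕ) {i n : ℕ} (hin : i ≤ n) :
    |ramp t K (n - i) - if i ≤ h then ramp t K n else 0| ≤ truncationWeight h K i := by
  unfold truncationWeight
  split_ifs with hih
  · have hslope := abs_ramp_sub_ramp_le t K (n - i) i
    rw [Nat.sub_add_cancel hin] at hslope
    exact hslope.trans (by gcongr)
  · rw [sub_zero, abs_of_nonneg (ramp_nonneg _ _ _)]
    exact ramp_le_one _ _ _

lemma sum_sq_ramp_mul_le (f : ℕ → ℝ) {K : ℕ} (hK : 0 < K) (t M : ℕ) :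
    ∑ n ∈ Finset.range M, (ramp t K n * f n) ^ 2 ≤ ∑ n ∈ Finset.range (t + K), f n ^ 2 := by
  refine le_trans (Finset.sum_le_sum fun n _ => ?_) (sum_ite_lt_le (fun n => sq_nonneg (f n)) M _)
  split_ifs with hn
  · rw [mul_pow]
    exact mul_le_of_le_one_left (sq_nonneg _) (pow_le_one₀ (ramp_nonneg _ _ _) (ramp_le_one _ _ _))
  · rw [ramp_eq_zero hK (not_lt.1 hn), zero_mul, zero_pow two_ne_zero]

end Ramp

section Invertibility

variable {ι κ : Type} [Fintype ι] [Fintype κ]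

lemma invModulus_le_one (G : ℕ → Matrix ι κ ℝ) : invModulus G ≤ 1 := by
  rw [invModulus]
  exact ENNReal.toReal_le_of_le_ofReal zero_le_one (by simp)

lemma invModulus_nonneg (G : ℕ → Matrix ι κ ℝ) : 0 ≤ invModulus G := ENNReal.toReal_nonneg

lemma enorm_sq_eq_ofReal (x : Vec ι) : ‖x‖ₑ ^ 2 = ENNReal.ofReal (‖x‖ ^ 2) := by
  rw [← ofReal_norm, ENNReal.ofReal_pow (norm_nonneg _)]

lemma invModulus_le_of_sum_le (G : ℕ → Matrix ι κ ℝ) {u : ℕ → Vec κ} {N : ℕ}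
    (hu : ∀ n, N ≤ n → u n = 0) (hunit : ∑ n ∈ Finset.range N, ‖u n‖ ^ 2 = 1) {B : ℝ}
    (hB : ∀ M, ∑ n ∈ Finset.range M,
      ‖∑ i ∈ Finset.range (n + 1), act (G i) (u (n - i))‖ ^ 2 ≤ B) :
    invModulus G ≤ B := by
  have htsum : ∑' n, ‖u n‖ₑ ^ 2 = 1 := by
    rw [tsum_eq_sum (s := Finset.range N) fun n hn => by
      rw [hu n (by simpa using hn), enorm_zero, zero_pow two_ne_zero]]
    simp_rw [enorm_sq_eq_ofReal]
    rw [← ENNReal.ofReal_sum_of_nonneg fun n _ => sq_nonneg _, hunit, ENNReal.ofReal_one]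
  refine ENNReal.toReal_le_of_le_ofReal (by simpa using hB 0)
    ((min_le_right _ _).trans ((iInf₂_le u htsum).trans ?_))
  refine ENNReal.tsum_le_of_sum_range_le fun M => ?_
  simp_rw [enorm_sq_eq_ofReal]
  rw [← ENNReal.ofReal_sum_of_nonneg fun n _ => sq_nonneg _]
  exact ENNReal.ofReal_le_ofReal (hB M)

lemma invModulus_mul_sum_le (G : ℕ → Matrix ι κ ℝ) {u : ℕ → Vec κ} {N : ℕ}
    (hu : ∀ n, N ≤ n → u n = 0) {B : ℝ}
    (hB : ∀ M, ∑ n ∈ Finset.range M,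
      ‖∑ i ∈ Finset.range (n + 1), act (G i) (u (n - i))‖ ^ 2 ≤ B) :
    invModulus G * ∑ n ∈ Finset.range N, ‖u n‖ ^ 2 ≤ B := by
  set A := ∑ n ∈ Finset.range N, ‖u n‖ ^ 2
  have hA : 0 ≤ A := Finset.sum_nonneg fun n _ => sq_nonneg _
  rcases hA.eq_or_lt with hzero | hpos
  · rw [← hzero, mul_zero]; simpa using hB 0
  have hscale : ∀ {σ : Type} [Fintype σ] (x : Vec σ), ‖(√A)⁻¹ • x‖ ^ 2 = A⁻¹ * ‖x‖ ^ 2 := by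
    intro σ _ x
    rw [norm_smul, mul_pow, norm_inv, Real.norm_of_nonneg (Real.sqrt_nonneg A), inv_pow,
      Real.sq_sqrt hA]
  have hnormalized : invModulus G ≤ A⁻¹ * B := by
    refine invModulus_le_of_sum_le G (u := fun n => (√A)⁻¹ • u n) (N := N)
      (fun n hn => by rw [hu n hn, smul_zero]) ?_ fun M => ?_
    · simp_rw [hscale]
      rw [← Finset.mul_sum, inv_mul_cancel₀ hpos.ne']
    · simp_rw [act_smul, ← Finset.smul_sum, hscale]
      rw [← Finset.mul_sum]
      exact mul_le_mul_of_nonneg_left (hB M) (inv_nonneg.2 hA)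
  rwa [inv_mul_eq_div, le_div_iff₀ hpos] at hnormalized

variable [DecidableEq κ]

lemma norm_sum_act_ramp_smul_le (G : ℕ → Matrix ι κ ℝ) {q : ℕ → Vec κ} (hq : q 0 = 0)
    {K : ℕ} (hK : 0 < K) (h t n : ℕ) :
    ‖∑ i ∈ Finset.range (n + 1), act (G i) (ramp t K (n - i) • q (n - i))‖ ≤
      ramp t K n * ‖∑ i ∈ Finset.range (h + 1), act (G i) (q (n - i))‖ +
        ∑ i ∈ Finset.range (n + 1), ‖G i‖ * truncationWeight h K i *
          (if n - i < t + K then ‖q (n - i)‖ else 0) := by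
  have hsplit : ∑ i ∈ Finset.range (n + 1), act (G i) (ramp t K (n - i) • q (n - i)) =
      ramp t K n • ∑ i ∈ Finset.range (h + 1), act (G i) (q (n - i)) +
        ∑ i ∈ Finset.range (n + 1),
          act (G i) ((ramp t K (n - i) - if i ≤ h then ramp t K n else 0) • q (n - i)) := by
    rw [sum_range_eq_sum_ite (n := n)
      (fun i hi => by rw [Nat.sub_eq_zero_of_le hi.le, hq, act_zero]) h,
      Finset.smul_sum, ← Finset.sum_add_distrib]
    refine Finset.sum_congr rfl fun i _ => ?_
    split_ifs
    · rw [sub_smul, act_sub, act_smul _ (ramp t K n), add_sub_cancel]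
    · rw [smul_zero, zero_add, sub_zero]
  rw [hsplit]
  refine (norm_add_le _ _).trans (add_le_add ?_ ?_)
  · rw [norm_smul, Real.norm_of_nonneg (ramp_nonneg _ _ _)]
  refine (norm_sum_le _ _).trans (Finset.sum_le_sum fun i hi => ?_)
  have hin : i ≤ n := Nat.lt_succ_iff.1 (Finset.mem_range.1 hi)
  refine (norm_act_le _ _).trans ?_
  rw [mul_assoc, norm_smul, Real.norm_eq_abs]
  refine mul_le_mul_of_nonneg_left ?_ (norm_nonneg _)
  rcases lt_or_ge (n - i) (t + K) with hlt | hge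
  · rw [if_pos hlt]
    exact mul_le_mul_of_nonneg_right (abs_ramp_sub_ite_le t h K hin) (norm_nonneg _)
  · rw [ramp_eq_zero hK hge, ramp_eq_zero hK (hge.trans (n.sub_le i)), ite_self, sub_zero, abs_zero,
      zero_mul, if_neg hge.not_gt, mul_zero]

lemma invModulus_mul_sum_le_truncated (G : ℕ → Matrix ι κ ℝ) {q : ℕ → Vec κ} (hq : q 0 = 0)
    {h K : ℕ} (hK : 0 < K) {b : ℝ}
    (hb : ∀ n, ∑ i ∈ Finset.range n, ‖G i‖ * truncationWeight h K i ≤ b) (t : ℕ) :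
    invModulus G * ∑ s ∈ Finset.range (t + 1), ‖q s‖ ^ 2 ≤
      2 * ∑ s ∈ Finset.range (t + K),
          ‖∑ i ∈ Finset.range (h + 1), act (G i) (q (s - i))‖ ^ 2 +
        2 * b ^ 2 * ∑ s ∈ Finset.range (t + K), ‖q s‖ ^ 2 := by
  set β : ℕ → ℝ := fun i => ‖G i‖ * truncationWeight h K i
  set p : ℕ → ℝ := fun n => ‖∑ i ∈ Finset.range (h + 1), act (G i) (q (n - i))‖
  set r : ℕ → ℝ := fun s => if s < t + K then ‖q s‖ else 0
  have hβ : ∀ i, 0 ≤ β i := fun i => mul_nonneg (norm_nonneg _) (truncationWeight_nonneg _ _ _)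
  have hr : ∀ M, ∑ s ∈ Finset.range M, r s ^ 2 ≤ ∑ s ∈ Finset.range (t + K), ‖q s‖ ^ 2 := by
    intro M
    simp only [r, ite_pow, zero_pow two_ne_zero]
    exact sum_ite_lt_le (fun s => sq_nonneg ‖q s‖) M _
  have hcut : ∀ M, ∑ n ∈ Finset.range M,
      ‖∑ i ∈ Finset.range (n + 1), act (G i) (ramp t K (n - i) • q (n - i))‖ ^ 2 ≤
      2 * ∑ s ∈ Finset.range (t + K), p s ^ 2 +
        2 * b ^ 2 * ∑ s ∈ Finset.range (t + K), ‖q s‖ ^ 2 := by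
    intro M
    calc _ ≤ ∑ n ∈ Finset.range M, 2 * ((ramp t K n * p n) ^ 2 +
            (∑ i ∈ Finset.range (n + 1), β i * r (n - i)) ^ 2) :=
          Finset.sum_le_sum fun n _ => (pow_le_pow_left₀ (norm_nonneg _)
            (norm_sum_act_ramp_smul_le G hq hK h t n) 2).trans add_sq_le
      _ ≤ _ := by
          rw [← Finset.mul_sum, Finset.sum_add_distrib]
          linarith [sum_sq_ramp_mul_le p hK t M, sum_sq_conv_le (x := r) hβ hb M,
            mul_le_mul_of_nonneg_left (hr M) (sq_nonneg b)]
  calc invModulus G * ∑ s ∈ Finset.range (t + 1), ‖q s‖ ^ 2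
      = invModulus G * ∑ s ∈ Finset.range (t + 1), ‖ramp t K s • q s‖ ^ 2 := by
        congr 1
        refine Finset.sum_congr rfl fun s hs => ?_
        rw [ramp_eq_one K (Nat.lt_succ_iff.1 (Finset.mem_range.1 hs)), one_smul]
    _ ≤ invModulus G * ∑ s ∈ Finset.range (t + K), ‖ramp t K s • q s‖ ^ 2 :=
        mul_le_mul_of_nonneg_left (Finset.sum_le_sum_of_subset_of_nonneg
          (Finset.range_subset_range.2 (by omega)) fun s _ _ => sq_nonneg _) (invModulus_nonneg G)
    _ ≤ _ := invModulus_mul_sum_le G (u := fun n => ramp t K n • q n)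
        (fun n hn => by rw [ramp_eq_zero hK hn, zero_smul]) hcut

end Invertibility

section Projection

lemma norm_sub_le_of_closest {E : Type*} [NormedAddCommGroup E] [InnerProductSpace ℝ E]
    {C : Set E} (hC : Convex ℝ C) {p z x : E} (hz : z ∈ C) (hx : x ∈ C)
    (hmin : ∀ y ∈ C, ‖z - p‖ ≤ ‖y - p‖) : ‖z - x‖ ≤ ‖p - x‖ := by
  have hclosest : ‖p - z‖ = ⨅ y : C, ‖p - y‖ := by
    have : Nonempty C := ⟨⟨z, hz⟩⟩
    refine le_antisymm (le_ciInf fun y => ?_) (ciInf_le ⟨0, ?_⟩ (⟨z, hz⟩ : C))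
    · rw [norm_sub_rev p, norm_sub_rev p]
      exact hmin y y.2
    · rintro _ ⟨y, rfl⟩
      exact norm_nonneg _
  have hobtuse := (norm_eq_iInf_iff_real_inner_le_zero hC hz).1 hclosest x hx
  have hexpand := norm_sub_sq_real (p - z) (x - z)
  rw [sub_sub_sub_cancel_right] at hexpand
  rw [norm_sub_rev z]
  exact le_of_sq_le_sq (by nlinarith [sq_nonneg ‖p - z‖]) (norm_nonneg _)

variable {ι : Type} [Fintype ι] {K : Set (Vec ι)}

lemma projOn_spec (hK : IsCompact K) (hne : K.Nonempty) (S : Matrix ι ι ℝ) (p : Vec ι) :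
    projOn K S p ∈ K ∧ ∀ x ∈ K, quad S (projOn K S p - p) ≤ quad S (x - p) := by
  have hcont : ContinuousOn (fun z : Vec ι => inner ℝ (z - p) (act S (z - p))) K := by
    have := continuous_act S
    fun_prop
  obtain ⟨z, hz, hmin⟩ := hK.exists_isMinOn hne hcont
  exact Classical.epsilon_spec (p := fun z => z ∈ K ∧
    ∀ z' ∈ K, inner ℝ (z - p) (act S (z - p)) ≤ inner ℝ (z' - p) (act S (z' - p)))
    ⟨z, hz, fun x hx => hmin hx⟩

lemma quad_projOn_sub_le (hK : IsCompact K) (hconv : Convex ℝ K) {S : Matrix ι ι ℝ}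
    (hS : S.PosSemidef) (p : Vec ι) {x : Vec ι} (hx : x ∈ K) :
    quad S (projOn K S p - x) ≤ quad S (p - x) := by
  classical
  obtain ⟨hz, hmin⟩ := projOn_spec hK ⟨x, hx⟩ S p
  obtain ⟨R, rfl⟩ := exists_eq_transpose_mul_self hS
  simp only [quad_transpose_mul_self, act_sub] at hmin ⊢
  refine pow_le_pow_left₀ (norm_nonneg _) (norm_sub_le_of_closest
    (hconv.linear_image (Matrix.toEuclideanLin R)) ⟨_, hz, rfl⟩ ⟨x, hx, rfl⟩ ?_) 2
  rintro _ ⟨y, hy, rfl⟩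
  exact le_of_sq_le_sq (hmin y hy) (norm_nonneg _)

end Projection

section NewtonRun

variable {ι ν υ : Type} [Fintype ι] [Fintype ν] [Fintype υ]

/-- The Gram matrices `H_tᵀ H_t` of a sequence of feature matrices. -/
def gram (H : ℕ → Matrix ν ι ℝ) (t : ℕ) : Matrix ι ι ℝ := (H t)ᵀ * H t

omit [Fintype ι] in
lemma gram_apply (H : ℕ → Matrix ν ι ℝ) (t : ℕ) : gram H t = (H t)ᵀ * H t :=
  rfl

omit [Fintype ι] in
lemma posSemidef_gram [Finite ι] (H : ℕ → Matrix ν ι ℝ) (t : ℕ) : (gram H t).PosSemidef :=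
  posSemidef_transpose_mul_self (H t)

lemma quad_gram (H : ℕ → Matrix ν ι ℝ) (t : ℕ) (x : Vec ι) :
    quad (gram H t) x = ‖act (H t) x‖ ^ 2 :=
  quad_transpose_mul_self (H t) x

variable [DecidableEq ι]

/-- The iterates `z` of the online (semi-)Newton step over the set `K`, with features `H` and
gradients `H_tᵀ n_t`, where `‖n_t‖ ≤ g`. The preconditioner `Λ_t` is `regSum lam (gram H) t`; of the
projection onto `K`, only its being a contraction towards the points of `K` is retained. -/
structure IsNewtonRun (K : Set (Vec ι)) (η lam g : ℝ) (H : ℕ → Matrix ν ι ℝ) (n : ℕ → Vec ν)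
    (z : ℕ → Vec ι) : Prop where
  lam_pos : 0 < lam
  mem : ∀ t, z t ∈ K
  norm_le : ∀ t, ‖n t‖ ≤ g
  step : ∀ t, ∀ x ∈ K, quad (regSum lam (gram H) t) (z (t + 1) - x) ≤
    quad (regSum lam (gram H) t) (z t - η • act (regSum lam (gram H) t)⁻¹ (act (H t)ᵀ (n t)) - x)

namespace IsNewtonRun

variable {K : Set (Vec ι)} {η lam g : ℝ} {H : ℕ → Matrix ν ι ℝ} {n : ℕ → Vec ν} {z : ℕ → Vec ι}

lemma posDef (hrun : IsNewtonRun K η lam g H n z) (t : ℕ) : (regSum lam (gram H) t).PosDef :=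
  posDef_regSum hrun.lam_pos (posSemidef_gram H) t

lemma g_nonneg (hrun : IsNewtonRun K η lam g H n z) : 0 ≤ g :=
  (norm_nonneg _).trans (hrun.norm_le 0)

lemma leverage_gram_nonneg (hrun : IsNewtonRun K η lam g H n z) (t : ℕ) :
    0 ≤ leverage (regSum lam (gram H) t) (gram H t) :=
  leverage_nonneg (hrun.posDef t) (posSemidef_gram H t)

lemma quad_step_le (hrun : IsNewtonRun K η lam g H n z) (t : ℕ) {x : Vec ι} (hx : x ∈ K) :
    quad (regSum lam (gram H) t) (z (t + 1) - x) ≤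
      quad (regSum lam (gram H) t) (z t - x) - 2 * η * inner ℝ (n t) (act (H t) (z t - x)) +
        η ^ 2 * (g ^ 2 * leverage (regSum lam (gram H) t) (gram H t)) := by
  refine (hrun.step t x hx).trans ?_
  have hlev := hrun.leverage_gram_nonneg t
  set S := regSum lam (gram H) t
  have hS : S.PosDef := hrun.posDef t
  have hsymm := transpose_eq_of_posSemidef hS.posSemidef
  set d := act (H t)ᵀ (n t)
  have hcross : inner ℝ (act S⁻¹ d) (act S (z t - x)) = inner ℝ (n t) (act (H t) (z t - x)) := by
    rw [inner_act, hsymm, act_act_inv hS, inner_act]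
  have hnoise : quad S⁻¹ d ≤ g ^ 2 * leverage S (gram H t) :=
    (quad_inv_transpose_act_le hS (H t) (n t)).trans <| mul_le_mul_of_nonneg_right
      (pow_le_pow_left₀ (norm_nonneg _) (hrun.norm_le t) 2) hlev
  rw [show z t - η • act S⁻¹ d - x = (z t - x) + (-η) • act S⁻¹ d by rw [neg_smul]; abel,
    quad_add_smul hsymm, hcross, quad_act_inv hS]
  linarith [mul_le_mul_of_nonneg_left hnoise (sq_nonneg η)]

lemma quad_movement_le (hrun : IsNewtonRun K η lam g H n z) (t : ℕ) :
    quad (regSum lam (gram H) t) (z (t + 1) - z t) ≤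
      η ^ 2 * (g ^ 2 * leverage (regSum lam (gram H) t) (gram H t)) := by
  simpa only [quad, sub_self, act_zero, inner_zero_right, mul_zero, zero_add] using
    hrun.quad_step_le t (hrun.mem t)

lemma regret_add_quad_le (hrun : IsNewtonRun K η lam g H n z) {x : Vec ι} (hx : x ∈ K) (N : ℕ) :
    ∑ t ∈ Finset.range N, (2 * η * inner ℝ (n t) (act (H t) (z t - x)) -
        ‖act (H t) (z t - x)‖ ^ 2) +
      (lam * ‖z N - x‖ ^ 2 + ∑ s ∈ Finset.range N, ‖act (H s) (z N - x)‖ ^ 2) ≤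
      lam * ‖z 0 - x‖ ^ 2 + η ^ 2 * g ^ 2 *
        ∑ t ∈ Finset.range N, leverage (regSum lam (gram H) t) (gram H t) := by
  induction N with
  | zero => simp only [Finset.sum_range_zero, mul_zero, add_zero, zero_add, le_refl]
  | succ N ih =>
    have hstep := hrun.quad_step_le N hx
    simp only [quad_regSum, quad_gram] at hstep
    rw [Finset.sum_range_succ (fun s => ‖act (H s) (z N - x)‖ ^ 2)] at hstep
    rw [Finset.sum_range_succ (fun t => 2 * η * inner ℝ (n t) (act (H t) (z t - x)) -
      ‖act (H t) (z t - x)‖ ^ 2),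
      Finset.sum_range_succ (fun t => leverage (regSum lam (gram H) t) (gram H t))]
    linarith

/-- Dividing by `2 η = 2 / α` turns the left-hand side into the lower bound that `α`-strong
convexity gives for the regret. -/
lemma regret_le (hrun : IsNewtonRun K η lam g H n z) {x : Vec ι} (hx : x ∈ K) (N : ℕ) :
    ∑ t ∈ Finset.range N, (2 * η * inner ℝ (n t) (act (H t) (z t - x)) -
        ‖act (H t) (z t - x)‖ ^ 2) ≤
      lam * ‖z 0 - x‖ ^ 2 + η ^ 2 * g ^ 2 *
        ∑ t ∈ Finset.range N, leverage (regSum lam (gram H) t) (gram H t) :=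
  (le_add_of_nonneg_right (add_nonneg (mul_nonneg hrun.lam_pos.le (sq_nonneg _))
    (Finset.sum_nonneg fun _ _ => sq_nonneg _))).trans (hrun.regret_add_quad_le hx N)

lemma norm_act_step_le (hrun : IsNewtonRun K η lam g H n z) (hη : 0 ≤ η) {S : Matrix ι ι ℝ}
    (hS : S.PosDef) (P : Matrix υ ι ℝ) {c : ℝ} (hc : 0 < c) {s : ℕ}
    (hdom : ∀ x, quad S x ≤ 2 * quad (regSum lam (gram H) s) x) :
    ‖act P (z (s + 1) - z s)‖ ≤ η * g * (c * leverage S (Pᵀ * P) +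
      c⁻¹ * leverage (regSum lam (gram H) s) (gram H s)) := by
  have hg := hrun.g_nonneg
  have hχ := hrun.leverage_gram_nonneg s
  have hmove := hrun.quad_movement_le s
  have hτ := leverage_nonneg hS (posSemidef_transpose_mul_self P)
  set δ := z (s + 1) - z s
  set χ := leverage (regSum lam (gram H) s) (gram H s)
  set τ := leverage S (Pᵀ * P)
  have hsq : ‖act P δ‖ ^ 2 ≤ τ * (2 * (η ^ 2 * (g ^ 2 * χ))) := by
    rw [← quad_transpose_mul_self]
    refine (quad_le_leverage_mul_quad hS (posSemidef_transpose_mul_self P) δ).trans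
      (mul_le_mul_of_nonneg_left ?_ hτ)
    linarith [hdom δ]
  have hamgm : 2 * (τ * χ) ≤ (c * τ + c⁻¹ * χ) ^ 2 := by
    have hprod : (c * τ) * (c⁻¹ * χ) = τ * χ := by field_simp
    nlinarith [sq_nonneg (c * τ), sq_nonneg (c⁻¹ * χ)]
  refine le_of_sq_le_sq (hsq.trans ?_) (by positivity)
  calc τ * (2 * (η ^ 2 * (g ^ 2 * χ))) = (η * g) ^ 2 * (2 * (τ * χ)) := by ring
    _ ≤ (η * g) ^ 2 * (c * τ + c⁻¹ * χ) ^ 2 := mul_le_mul_of_nonneg_left hamgm (by positivity)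
    _ = (η * g * (c * τ + c⁻¹ * χ)) ^ 2 := (mul_pow _ _ _).symm

lemma norm_act_sub_le (hrun : IsNewtonRun K η lam g H n z) (hη : 0 ≤ η) {S : Matrix ι ι ℝ}
    (hS : S.PosDef) (P : Matrix υ ι ℝ) {c : ℝ} (hc : 0 < c) {r t h : ℕ}
    (hdom : ∀ x, quad S x ≤ 2 * quad (regSum lam (gram H) r) x) (hrt : r ≤ t) (hth : t ≤ r + h) :
    ‖act P (z r - z t)‖ ≤ η * g * h * c * leverage S (Pᵀ * P) +
      η * g * c⁻¹ * ∑ s ∈ Finset.Ico (t - h) t, leverage (regSum lam (gram H) s) (gram H s) := by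
  have hg := hrun.g_nonneg
  have hτ := leverage_nonneg hS (posSemidef_transpose_mul_self P)
  have hstep : ∀ s ∈ Finset.Ico r t, ‖act P (z (s + 1) - z s)‖ ≤ η * g * (c * leverage S (Pᵀ * P) +
      c⁻¹ * leverage (regSum lam (gram H) s) (gram H s)) := fun s hs =>
    hrun.norm_act_step_le hη hS P hc fun x => (hdom x).trans <| mul_le_mul_of_nonneg_left
      (quad_regSum_mono (posSemidef_gram H) (Finset.mem_Ico.1 hs).1 x) zero_le_two
  have hlag : ((t - r : ℕ) : ℝ) ≤ h := by exact_mod_cast (by omega)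
  have hwindow : ∑ s ∈ Finset.Ico r t, leverage (regSum lam (gram H) s) (gram H s) ≤
      ∑ s ∈ Finset.Ico (t - h) t, leverage (regSum lam (gram H) s) (gram H s) :=
    Finset.sum_le_sum_of_subset_of_nonneg (Finset.Ico_subset_Ico_left (by omega))
      fun s _ _ => hrun.leverage_gram_nonneg s
  rw [← neg_sub, act_neg, norm_neg, ← Finset.sum_Ico_sub z hrt, act_sum]
  calc ‖∑ s ∈ Finset.Ico r t, act P (z (s + 1) - z s)‖
      ≤ ∑ s ∈ Finset.Ico r t, η * g * (c * leverage S (Pᵀ * P) +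
          c⁻¹ * leverage (regSum lam (gram H) s) (gram H s)) :=
        (norm_sum_le _ _).trans (Finset.sum_le_sum hstep)
    _ = η * g * ((t - r : ℕ) : ℝ) * c * leverage S (Pᵀ * P) + η * g * c⁻¹ *
          ∑ s ∈ Finset.Ico r t, leverage (regSum lam (gram H) s) (gram H s) := by
        simp only [mul_add, Finset.sum_add_distrib, ← Finset.mul_sum, Finset.sum_const,
          Nat.card_Ico, nsmul_eq_mul]
        ring
    _ ≤ _ := by gcongr

end IsNewtonRun

end NewtonRun

section Memory

variable {ι ν υ : Type} [Fintype ι] [Fintype ν] [Fintype υ]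

/-- The features `H_t = ∑_{i ≤ h} G_i Y_{t-i}` of the convolution of `Y` with `G`, truncated
at lag `h`. Since `t - i` is truncated to `0`, it is meant for sequences with `Y 0 = 0`. -/
def features (G : ℕ → Matrix ν υ ℝ) (Y : ℕ → Matrix υ ι ℝ) (h t : ℕ) : Matrix ν ι ℝ :=
  ∑ i ∈ Finset.range (h + 1), G i * Y (t - i)

lemma act_features (G : ℕ → Matrix ν υ ℝ) (Y : ℕ → Matrix υ ι ℝ) (h t : ℕ) (x : Vec ι) :
    act (features G Y h t) x = ∑ i ∈ Finset.range (h + 1), act (G i) (act (Y (t - i)) x) := by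
  simp only [features, sum_act, mul_act]

/-- The joint second moments `H_tᵀ H_t + (κ / 9) Y_tᵀ Y_t` of the features `H` and of the inputs
`Y`. The factor `1 / 9` leaves room for the error of truncating and cutting off convolutions. -/
noncomputable def jointGram (G : ℕ → Matrix ν υ ℝ) (Y : ℕ → Matrix υ ι ℝ) (h t : ℕ) :
    Matrix ι ι ℝ :=
  gram (features G Y h) t + (invModulus G / 9) • gram Y t

omit [Fintype ι] in
lemma posSemidef_jointGram [Finite ι] (G : ℕ → Matrix ν υ ℝ) (Y : ℕ → Matrix υ ι ℝ) (h t : ℕ) :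
    (jointGram G Y h t).PosSemidef :=
  (posSemidef_gram _ t).add
    ((posSemidef_gram Y t).smul (div_nonneg (invModulus_nonneg G) (by norm_num)))

lemma sum_norm_act_lag_le [DecidableEq υ] {G : ℕ → Matrix ν υ ℝ} {Y : ℕ → Matrix υ ι ℝ}
    (hY : Y 0 = 0) {ρ : ℝ} (hρ : ∀ n, ∑ i ∈ Finset.range n, ‖G i‖ ≤ ρ) {z : ℕ → Vec ι} {h : ℕ}
    {X C : ℕ → ℝ} (hX : ∀ r, 0 ≤ X r) (hC : ∀ t, 0 ≤ C t)
    (hlag : ∀ r t, r ≤ t → t ≤ r + h → ‖act (Y r) (z r - z t)‖ ≤ X r + C t) (N : ℕ) :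
    ∑ t ∈ Finset.range N, ∑ i ∈ Finset.range (h + 1),
        ‖act (G i) (act (Y (t - i)) (z (t - i) - z t))‖ ≤
      ρ * (∑ r ∈ Finset.range N, X r + ∑ t ∈ Finset.range N, C t) := by
  have hround : ∀ t, ∑ i ∈ Finset.range (h + 1),
      ‖act (G i) (act (Y (t - i)) (z (t - i) - z t))‖ ≤
        ∑ i ∈ Finset.range (t + 1), ‖G i‖ * X (t - i) + ρ * C t := by
    intro t
    rw [sum_range_eq_sum_ite (n := t) fun i hi => by
      rw [Nat.sub_eq_zero_of_le hi.le, hY, zero_act, act_zero, norm_zero]]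
    calc _ ≤ ∑ i ∈ Finset.range (t + 1), (‖G i‖ * X (t - i) + ‖G i‖ * C t) := by
          refine Finset.sum_le_sum fun i hi => ?_
          have hit : i ≤ t := Nat.lt_succ_iff.1 (Finset.mem_range.1 hi)
          rw [← mul_add]
          split_ifs with hih
          · exact (norm_act_le _ _).trans (mul_le_mul_of_nonneg_left
              (hlag _ _ (t.sub_le i) (by omega)) (norm_nonneg _))
          · exact mul_nonneg (norm_nonneg _) (add_nonneg (hX _) (hC t))
      _ ≤ _ := by
          rw [Finset.sum_add_distrib, ← Finset.sum_mul]
          exact add_le_add_right (mul_le_mul_of_nonneg_right (hρ _) (hC t)) _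
  refine (Finset.sum_le_sum fun t _ => hround t).trans ?_
  rw [Finset.sum_add_distrib, ← Finset.mul_sum, mul_add]
  exact add_le_add_left (sum_conv_le (fun i => norm_nonneg _) hX hρ N) _

variable [DecidableEq ι] {G : ℕ → Matrix ν υ ℝ} {Y : ℕ → Matrix υ ι ℝ} {lam : ℝ} {h K T : ℕ}

lemma quad_regSum_jointGram (t : ℕ) (x : Vec ι) :
    quad (regSum lam (jointGram G Y h) t) x = quad (regSum lam (gram (features G Y h)) t) x +
      invModulus G / 9 * ∑ s ∈ Finset.range (t + 1), ‖act (Y s) x‖ ^ 2 := by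
  simp only [quad_regSum, jointGram, add_quad, smul_quad, quad_gram, Finset.sum_add_distrib,
    Finset.mul_sum, add_assoc]

lemma invModulus_mul_sum_leverage_le (hlam : 0 < lam) (N : ℕ) :
    invModulus G / 9 *
        ∑ t ∈ Finset.range (N + 1), leverage (regSum lam (jointGram G Y h) t) (gram Y t) ≤
      logDetGrowth lam (jointGram G Y h) N := by
  refine le_trans ?_ (sum_leverage_le_logDetGrowth hlam (posSemidef_jointGram G Y h) N)
  rw [Finset.mul_sum]
  refine Finset.sum_le_sum fun t _ => ?_
  have hS := posDef_regSum hlam (posSemidef_jointGram G Y h) t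
  generalize regSum lam (jointGram G Y h) t = S at hS ⊢
  rw [jointGram, leverage_add, leverage_smul]
  exact le_add_of_nonneg_left (leverage_nonneg hS (posSemidef_gram _ t))

lemma sqrt_mul_sum_leverage_le (hlam : 0 < lam) (hκ : 0 < invModulus G) (T : ℕ) :
    √(invModulus G) * ∑ r ∈ Finset.range (T + 1), leverage (regSum lam (jointGram G Y h) r)
        (gram Y r) ≤
      9 * (√(invModulus G))⁻¹ * logDetGrowth lam (jointGram G Y h) T := by
  have hle := invModulus_mul_sum_leverage_le (G := G) (Y := Y) (h := h) hlam T
  have hsq := Real.mul_self_sqrt hκ.le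
  rw [mul_right_comm, ← div_eq_mul_inv, le_div_iff₀ (Real.sqrt_pos.2 hκ), mul_right_comm, hsq]
  linarith

variable [DecidableEq υ]

/-- While the second moments do not double over a stretch `K ≫ h`, cutting the input off along this
stretch costs little, so that the invertibility of `G` applies to the truncated convolution. -/
lemma quad_regSum_jointGram_le (hlam : 0 ≤ lam) (hY : Y 0 = 0) (hK : 0 < K)
    (hb : K ≤ T → ∀ n,
      ∑ i ∈ Finset.range n, ‖G i‖ * truncationWeight h K i ≤ √(invModulus G) / 3) {r : ℕ}
    (hr : ¬ IsUnsettled (regSum lam (jointGram G Y h)) K T r) (x : Vec ι) :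
    quad (regSum lam (jointGram G Y h) r) x ≤
      2 * quad (regSum lam (gram (features G Y h)) r) x := by
  rw [IsUnsettled] at hr
  push Not at hr
  have hgrowth := hr.2 x
  have hinvert := invModulus_mul_sum_le_truncated G (q := fun s => act (Y s) x)
    (by rw [hY, zero_act]) hK (hb (by omega)) r
  simp only [← act_features, div_pow, Real.sq_sqrt (invModulus_nonneg G)] at hinvert
  have hfeatures : ∑ s ∈ Finset.range (r + K), ‖act (features G Y h s) x‖ ^ 2 ≤
      quad (regSum lam (gram (features G Y h)) (r + K)) x := by
    simp only [quad_regSum, quad_gram, Finset.sum_range_succ _ (r + K)]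
    nlinarith [mul_nonneg hlam (sq_nonneg ‖x‖), sq_nonneg ‖act (features G Y h (r + K)) x‖]
  have hinputs : invModulus G * ∑ s ∈ Finset.range (r + K), ‖act (Y s) x‖ ^ 2 ≤
      invModulus G * ∑ s ∈ Finset.range (r + K + 1), ‖act (Y s) x‖ ^ 2 := by
    rw [Finset.sum_range_succ _ (r + K)]
    nlinarith [mul_nonneg (invModulus_nonneg G) (sq_nonneg ‖act (Y (r + K)) x‖)]
  have hnonneg : 0 ≤ quad (regSum lam (gram (features G Y h)) r) x := by
    simp only [quad_regSum, quad_gram]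
    positivity
  rw [quad_regSum_jointGram] at hgrowth ⊢
  rw [quad_regSum_jointGram] at hgrowth
  linarith

variable {Z : Set (Vec ι)} {η g R : ℝ} {n : ℕ → Vec ν} {z : ℕ → Vec ι}

open scoped Classical in
lemma norm_act_lag_le (hrun : IsNewtonRun Z η lam g (features G Y h) n z) (hη : 0 ≤ η)
    (hκ : 0 < invModulus G) (hY : Y 0 = 0) (hK : 0 < K)
    (hb : K ≤ T → ∀ n,
      ∑ i ∈ Finset.range n, ‖G i‖ * truncationWeight h K i ≤ √(invModulus G) / 3)
    (hR : ∀ t, ∀ x ∈ Z, ‖act (Y t) x‖ ≤ R) {r t : ℕ} (hrt : r ≤ t) (hth : t ≤ r + h) :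
    ‖act (Y r) (z r - z t)‖ ≤
      (η * g * h * √(invModulus G) * leverage (regSum lam (jointGram G Y h) r) (gram Y r) +
        2 * R * (if IsUnsettled (regSum lam (jointGram G Y h)) K T r then 1 else 0)) +
      η * g * (√(invModulus G))⁻¹ * ∑ s ∈ Finset.Ico (t - h) t,
        leverage (regSum lam (gram (features G Y h)) s) (gram (features G Y h) s) := by
  have hS := posDef_regSum hrun.lam_pos (posSemidef_jointGram G Y h) r
  have hdom := quad_regSum_jointGram_le hrun.lam_pos.le hY hK hb (r := r)
  generalize IsUnsettled (regSum lam (jointGram G Y h)) K T r = unsettled at hdom ⊢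
  generalize regSum lam (jointGram G Y h) r = S at hS hdom ⊢
  split_ifs with hr
  · have hg := hrun.g_nonneg
    have hlev := leverage_nonneg hS (posSemidef_gram Y r)
    have hsum := Finset.sum_nonneg fun s (_ : s ∈ Finset.Ico (t - h) t) =>
      hrun.leverage_gram_nonneg s
    have htriangle : ‖act (Y r) (z r - z t)‖ ≤ 2 * R * 1 := by
      rw [act_sub]
      linarith [norm_sub_le (act (Y r) (z r)) (act (Y r) (z t)), hR r _ (hrun.mem r),
        hR r _ (hrun.mem t)]
    have hsettled : 0 ≤ η * g * h * √(invModulus G) * leverage S (gram Y r) :=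
      mul_nonneg (by positivity) hlev
    have hmoved := mul_nonneg
      (mul_nonneg (mul_nonneg hη hg) (inv_nonneg.2 (Real.sqrt_nonneg (invModulus G)))) hsum
    linarith
  · rw [mul_zero, add_zero, gram_apply]
    exact hrun.norm_act_sub_le hη hS (Y r) (Real.sqrt_pos.2 hκ) (hdom hr) hrt hth

lemma sum_norm_memory_le (hrun : IsNewtonRun Z η lam g (features G Y h) n z) (hη : 0 ≤ η)
    (hκ : 0 < invModulus G) (hY : Y 0 = 0) (hK : 0 < K)
    (hb : K ≤ T → ∀ n,
      ∑ i ∈ Finset.range n, ‖G i‖ * truncationWeight h K i ≤ √(invModulus G) / 3)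
    (hR : ∀ t, ∀ x ∈ Z, ‖act (Y t) x‖ ≤ R) {ρ D : ℝ} (hρ : ∀ n, ∑ i ∈ Finset.range n, ‖G i‖ ≤ ρ)
    (hD : logDetGrowth lam (gram (features G Y h)) T ≤ D)
    (hD_joint : logDetGrowth lam (jointGram G Y h) T ≤ D) :
    ∑ t ∈ Finset.range (T + 1), ∑ i ∈ Finset.range (h + 1),
        ‖act (G i) (act (Y (t - i)) (z (t - i) - z t))‖ ≤
      ρ * (10 * η * g * h * (√(invModulus G))⁻¹ * D + 2 * R * (K + 2 * K * D)) := by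
  classical
  set κ := invModulus G
  set τ : ℕ → ℝ := fun r => leverage (regSum lam (jointGram G Y h) r) (gram Y r)
  set χ : ℕ → ℝ := fun s =>
    leverage (regSum lam (gram (features G Y h)) s) (gram (features G Y h) s)
  set unsettled : ℕ → ℝ := fun r =>
    if IsUnsettled (regSum lam (jointGram G Y h)) K T r then 1 else 0
  have hg := hrun.g_nonneg
  have hpsd := posSemidef_jointGram G Y h
  have hR0 : 0 ≤ R := (norm_nonneg _).trans (hR 0 _ (hrun.mem 0))
  have hρ0 : 0 ≤ ρ := by simpa using hρ 0
  have hτ : ∀ r, 0 ≤ τ r := fun r =>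
    leverage_nonneg (posDef_regSum hrun.lam_pos hpsd r) (posSemidef_gram Y r)
  have hχ : ∀ s, 0 ≤ χ s := hrun.leverage_gram_nonneg
  have hunsettled : ∀ r, 0 ≤ unsettled r := fun r => by
    simp only [unsettled]; split_ifs <;> norm_num
  have hsum_τ : √κ * ∑ r ∈ Finset.range (T + 1), τ r ≤ 9 * (√κ)⁻¹ * D :=
    (sqrt_mul_sum_leverage_le hrun.lam_pos hκ T).trans (by gcongr)
  have hsum_χ : ∑ t ∈ Finset.range (T + 1), ∑ s ∈ Finset.Ico (t - h) t, χ s ≤ h * D :=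
    (sum_sum_Ico_le hχ h _).trans (mul_le_mul_of_nonneg_left
      ((sum_leverage_le_logDetGrowth hrun.lam_pos (posSemidef_gram _) T).trans hD) h.cast_nonneg)
  have hsum_unsettled : ∑ r ∈ Finset.range (T + 1), unsettled r ≤ K + 2 * K * D := by
    rw [Finset.sum_boole]
    exact (card_isUnsettled_le hrun.lam_pos hpsd K T).trans (by gcongr)
  have hmemory := sum_norm_act_lag_le hY hρ (z := z) (h := h)
    (X := fun r => η * g * h * √κ * τ r + 2 * R * unsettled r)
    (C := fun t => η * g * (√κ)⁻¹ * ∑ s ∈ Finset.Ico (t - h) t, χ s)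
    (fun r => by have := hτ r; have := hunsettled r; positivity)
    (fun t => mul_nonneg (by positivity) (Finset.sum_nonneg fun s _ => hχ s))
    (fun r t hrt hth => norm_act_lag_le hrun hη hκ hY hK hb hR hrt hth) (T + 1)
  refine hmemory.trans (mul_le_mul_of_nonneg_left ?_ hρ0)
  rw [Finset.sum_add_distrib, ← Finset.mul_sum, ← Finset.mul_sum, ← Finset.mul_sum]
  calc _ = η * g * h * (√κ * ∑ r ∈ Finset.range (T + 1), τ r) +
          2 * R * ∑ r ∈ Finset.range (T + 1), unsettled r +
          η * g * (√κ)⁻¹ * ∑ t ∈ Finset.range (T + 1), ∑ s ∈ Finset.Ico (t - h) t, χ s := by ring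
    _ ≤ η * g * h * (9 * (√κ)⁻¹ * D) + 2 * R * (K + 2 * K * D) +
          η * g * (√κ)⁻¹ * (h * D) := by gcongr
    _ = _ := by ring

end Memory

section Losses

variable {ι : Type} [Fintype ι] {α L : ℝ} {ℓ : Vec ι → ℝ}

lemma gradient_comp_act {κ : Type} [Fintype κ] (hℓ : Differentiable ℝ ℓ) (v : Vec ι)
    (H : Matrix ι κ ℝ) (z : Vec κ) :
    gradient (fun z => ℓ (v + act H z)) z = act Hᵀ (gradient ℓ (v + act H z)) := by
  classical
  have haffine : HasFDerivAt (fun z => v + act H z)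
      (Matrix.toEuclideanLin H).toContinuousLinearMap z := by
    simp only [act_eq_toEuclideanLin]
    exact (Matrix.toEuclideanLin H).toContinuousLinearMap.hasFDerivAt.const_add v
  refine HasGradientAt.gradient (hasGradientAt_iff_hasFDerivAt.2 ?_)
  refine ((hℓ _).hasGradientAt.hasFDerivAt.comp z haffine).congr_fderiv
    (ContinuousLinearMap.ext fun x => ?_)
  simp only [ContinuousLinearMap.comp_apply, InnerProductSpace.toDual_apply_apply,
    LinearMap.coe_toContinuousLinearMap', ← act_eq_toEuclideanLin]
  exact inner_act H (gradient ℓ (v + act H z)) x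

namespace LossRegular

lemma slope_le (hℓ : LossRegular α L ℓ) (v v' : Vec ι) {t : ℝ} (ht : 0 < t) (ht1 : t ≤ 1) :
    t⁻¹ * (ℓ (v + t • (v' - v)) - ℓ v) ≤
      ℓ v' - ℓ v - (1 - t) * (α / 2 * ‖v - v'‖ ^ 2) := by
  have hconv := hℓ.2.1.2 (Set.mem_univ v) (Set.mem_univ v') (sub_nonneg.2 ht1) ht.le
    (sub_add_cancel 1 t)
  rw [show (1 - t) • v + t • v' = v + t • (v' - v) by module] at hconv
  simp only [smul_eq_mul] at hconv
  rw [inv_mul_le_iff₀ ht]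
  linarith

lemma sub_le (hℓ : LossRegular α L ℓ) (v v' : Vec ι) :
    ℓ v - ℓ v' ≤ inner ℝ (gradient ℓ v) (v - v') - α / 2 * ‖v - v'‖ ^ 2 := by
  have hline : HasDerivAt (fun t : ℝ => v + t • (v' - v)) (v' - v) 0 := by
    simpa using ((hasDerivAt_id (0 : ℝ)).smul_const (v' - v)).const_add v
  have hgrad : HasFDerivAt ℓ (InnerProductSpace.toDual ℝ (Vec ι) (gradient ℓ v))
      (v + (0 : ℝ) • (v' - v)) := by
    simpa using (hℓ.1 v).hasGradientAt.hasFDerivAt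
  have hslope := (hgrad.comp_hasDerivAt (0 : ℝ) hline).tendsto_slope_zero_right
  have hbound : Filter.Tendsto (fun t : ℝ => ℓ v' - ℓ v - (1 - t) * (α / 2 * ‖v - v'‖ ^ 2))
      (nhdsWithin 0 (Set.Ioi 0)) (nhds (ℓ v' - ℓ v - (1 - 0) * (α / 2 * ‖v - v'‖ ^ 2))) :=
    (Continuous.tendsto (by fun_prop) 0).mono_left nhdsWithin_le_nhds
  have hlim := le_of_tendsto_of_tendsto hslope hbound (by
    filter_upwards [Ioo_mem_nhdsGT (zero_lt_one' ℝ)] with t ht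
    simpa using hℓ.slope_le v v' ht.1 ht.2.le)
  rw [InnerProductSpace.toDual_apply_apply, ← neg_sub v v', inner_neg_right] at hlim
  linarith

lemma sub_le_norm (hα : 0 ≤ α) (hℓ : LossRegular α L ℓ) {v v' : Vec ι} {g : ℝ}
    (hg : ‖gradient ℓ v‖ ≤ g) : ℓ v - ℓ v' ≤ g * ‖v - v'‖ :=
  calc ℓ v - ℓ v' ≤ inner ℝ (gradient ℓ v) (v - v') - α / 2 * ‖v - v'‖ ^ 2 := hℓ.sub_le v v'
    _ ≤ inner ℝ (gradient ℓ v) (v - v') := sub_le_self _ (by positivity)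
    _ ≤ ‖gradient ℓ v‖ * ‖v - v'‖ := real_inner_le_norm _ _
    _ ≤ g * ‖v - v'‖ := by gcongr

lemma norm_gradient_le (hℓ : LossRegular α L ℓ) (hL : 0 ≤ L) {v : Vec ι} {r : ℝ} (hr : 1 ≤ r)
    (hv : ‖v‖ ≤ r) : ‖gradient ℓ v‖ ≤ L * r :=
  (hℓ.2.2 v).trans (mul_le_mul_of_nonneg_left (max_le hr hv) hL)

/-- Compare the gradients at two antipodal unit vectors. -/
lemma modulus_le [Nonempty ι] (hℓ : LossRegular α L ℓ) : α ≤ L := by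
  obtain ⟨v, hv⟩ := exists_norm_eq (Vec ι) zero_le_one
  have hgrad : ‖gradient ℓ v‖ ≤ L := by simpa [hv] using hℓ.2.2 v
  have hgrad_neg : ‖gradient ℓ (-v)‖ ≤ L := by simpa [hv] using hℓ.2.2 (-v)
  have hdiam : ‖v - -v‖ = 2 := by
    rw [sub_neg_eq_add, ← two_smul ℝ v, norm_smul, hv, Real.norm_ofNat, mul_one]
  have hdiam_neg : ‖-v - v‖ = 2 := by rw [← hdiam, norm_sub_rev]
  have hdesc := hℓ.sub_le v (-v)
  have hasc := hℓ.sub_le (-v) v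
  have hinner := real_inner_le_norm (gradient ℓ v) (v - -v)
  have hinner_neg := real_inner_le_norm (gradient ℓ (-v)) (-v - v)
  rw [hdiam] at hdesc hinner
  rw [hdiam_neg] at hasc hinner_neg
  linarith

end LossRegular

end Losses

section Truncation

variable {ι κ : Type} [Fintype ι] [Fintype κ]

lemma norm_sum_act_le [DecidableEq κ] {σ : Type} {s : Finset σ} {G : σ → Matrix ι κ ℝ}
    {u : σ → Vec κ} {a b : ℝ} (ha : ∑ i ∈ s, ‖G i‖ ≤ a) (hb : 0 ≤ b) (hu : ∀ i ∈ s, ‖u i‖ ≤ b) :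
    ‖∑ i ∈ s, act (G i) (u i)‖ ≤ a * b :=
  calc _ ≤ ∑ i ∈ s, ‖G i‖ * b := norm_sum_le_of_le s fun i hi =>
        (norm_act_le _ _).trans (mul_le_mul_of_nonneg_left (hu i hi) (norm_nonneg _))
    _ ≤ a * b := by
        rw [← Finset.sum_mul]
        exact mul_le_mul_of_nonneg_right ha hb

lemma conv_sub_truncated_eq (G : ℕ → Matrix ι κ ℝ) {u : ℕ → Vec κ} (hu : u 0 = 0) (k t : ℕ) :
    ∑ i ∈ Finset.range (t + 1), act (G i) (u (t - i)) -
        ∑ i ∈ Finset.range k, act (G i) (u (t - i)) =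
      ∑ i ∈ Finset.range (t + 1), act (G (k + i)) (u (t - (k + i))) := by
  have hextend : ∑ i ∈ Finset.range (t + 1), act (G i) (u (t - i)) =
      ∑ i ∈ Finset.range (k + (t + 1)), act (G i) (u (t - i)) := by
    refine Finset.sum_subset (Finset.range_subset_range.2 (by omega)) fun i _ hi => ?_
    rw [Finset.mem_range] at hi
    rw [show t - i = 0 by omega, hu, act_zero]
  rw [hextend, Finset.sum_range_add, add_sub_cancel_left]

lemma norm_conv_sub_truncated_le [DecidableEq κ] (G : ℕ → Matrix ι κ ℝ) {u : ℕ → Vec κ}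
    (hu : u 0 = 0) {b c : ℝ} {k : ℕ} (hb : ∀ n, ∑ i ∈ Finset.range n, ‖G (k + i)‖ ≤ b)
    (hc : ∀ s, ‖u s‖ ≤ c) (t : ℕ) :
    ‖∑ i ∈ Finset.range (t + 1), act (G i) (u (t - i)) -
      ∑ i ∈ Finset.range k, act (G i) (u (t - i))‖ ≤ b * c := by
  rw [conv_sub_truncated_eq G hu]
  exact norm_sum_act_le (hb _) ((norm_nonneg _).trans (hc 0)) fun _ _ => hc _

lemma sum_mul_truncationWeight_le {f : ℕ → ℝ} (hf : ∀ i, 0 ≤ f i) {a b : ℝ} {h : ℕ}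
    (ha : ∀ n, ∑ i ∈ Finset.range n, f i ≤ a)
    (hb : ∀ n, ∑ i ∈ Finset.range n, f (h + 1 + i) ≤ b) (K n : ℕ) :
    ∑ i ∈ Finset.range n, f i * truncationWeight h K i ≤ a * (h / K) + b := by
  calc _ ≤ ∑ i ∈ Finset.range (h + 1 + n), f i * truncationWeight h K i :=
        Finset.sum_le_sum_of_subset_of_nonneg (Finset.range_subset_range.2 (by omega))
          fun i _ _ => mul_nonneg (hf i) (truncationWeight_nonneg h K i)
    _ = (∑ i ∈ Finset.range (h + 1), f i) * (h / K) + ∑ i ∈ Finset.range n, f (h + 1 + i) := by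
        rw [Finset.sum_range_add, Finset.sum_mul]
        congr 1
        · refine Finset.sum_congr rfl fun i hi => ?_
          rw [truncationWeight, if_pos (Nat.lt_succ_iff.1 (Finset.mem_range.1 hi))]
        · refine Finset.sum_congr rfl fun i _ => ?_
          rw [truncationWeight, if_neg (by omega), mul_one]
    _ ≤ _ := add_le_add (mul_le_mul_of_nonneg_right (ha _) (by positivity)) (hb n)

lemma sum_mul_truncationWeight_le_third {f : ℕ → ℝ} (hf : ∀ i, 0 ≤ f i) {ρ r : ℝ} {h K T : ℕ}
    (hr : 0 < r) (hρ0 : 0 < ρ) (hh : 0 < h)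
    (hρ : ∀ n, ∑ i ∈ Finset.range n, f i ≤ ρ)
    (hb : ∀ n, ∑ i ∈ Finset.range n, f (h + 1 + i) ≤ ρ / T)
    (hK : 6 * h * ρ * r⁻¹ ≤ K) (hKT : K ≤ T) (n : ℕ) :
    ∑ i ∈ Finset.range n, f i * truncationWeight h K i ≤ r / 3 := by
  have hh1 : (1 : ℝ) ≤ h := by exact_mod_cast hh
  have hK0 : (0 : ℝ) < K := lt_of_lt_of_le (by positivity) hK
  have hwindow : 6 * h * ρ ≤ K * r := by
    rwa [← div_eq_mul_inv, div_le_iff₀ hr] at hK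
  have hhead : ρ * (h / K) ≤ r / 6 := by
    rw [← mul_div_assoc, div_le_iff₀ hK0]
    linarith
  have htail : ρ / T ≤ r / 6 := by
    calc ρ / T ≤ ρ / K := by gcongr
      _ ≤ r / 6 := by
          rw [div_le_iff₀ hK0]
          nlinarith
  linarith [sum_mul_truncationWeight_le hf hρ hb K n]

end Truncation

section Trace

variable {ι κ : Type} [Fintype ι] [Fintype κ] [DecidableEq κ]

lemma trace_transpose_mul_self_le (P : Matrix ι κ ℝ) {b : ℝ}
    (hb : ∀ p, ‖act P (EuclideanSpace.single p 1)‖ ≤ b) :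
    (Pᵀ * P).trace ≤ Fintype.card κ * b ^ 2 := by
  have hcolumn : ∀ p, (Pᵀ * P) p p = ‖act P (EuclideanSpace.single p 1)‖ ^ 2 := fun p => by
    rw [EuclideanSpace.real_norm_sq_eq]
    simp [act, Matrix.mul_apply, sq]
  calc (Pᵀ * P).trace = ∑ p, ‖act P (EuclideanSpace.single p 1)‖ ^ 2 :=
        Finset.sum_congr rfl fun p _ => hcolumn p
    _ ≤ ∑ _p : κ, b ^ 2 := Finset.sum_le_sum fun p _ => pow_le_pow_left₀ (norm_nonneg _) (hb p) 2
    _ = _ := by simp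

variable {ν υ : Type} [Fintype ν] [Fintype υ] [DecidableEq υ] {G : ℕ → Matrix ν υ ℝ}
  {Y : ℕ → Matrix υ κ ℝ} {ρ r lam : ℝ}

lemma trace_gram_features_le (hρ : ∀ n, ∑ i ∈ Finset.range n, ‖G i‖ ≤ ρ) (hr : 0 ≤ r)
    (hY : ∀ t p, ‖act (Y t) (EuclideanSpace.single p 1)‖ ≤ r) (h t : ℕ) :
    (gram (features G Y h) t).trace ≤ Fintype.card κ * (ρ * r) ^ 2 :=
  trace_transpose_mul_self_le _ fun p => by
    rw [act_features]
    exact norm_sum_act_le (hρ _) hr fun i _ => hY (t - i) p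

lemma logDetGrowth_features_le (hY0 : Y 0 = 0) (hρ : ∀ n, ∑ i ∈ Finset.range n, ‖G i‖ ≤ ρ)
    (hr : 0 ≤ r) (hY : ∀ t p, ‖act (Y t) (EuclideanSpace.single p 1)‖ ≤ r) (hlam : 0 < lam)
    (hlam_ge : (ρ * r) ^ 2 ≤ lam) (h T : ℕ) :
    logDetGrowth lam (gram (features G Y h)) T ≤ Fintype.card κ * Real.log (1 + T) :=
  logDetGrowth_le hlam (posSemidef_gram _) (by simp [gram, features, hY0])
    (fun t => (trace_gram_features_le hρ hr hY h t).trans (by gcongr)) T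

lemma logDetGrowth_jointGram_le (hY0 : Y 0 = 0) (hρ1 : 1 ≤ ρ)
    (hρ : ∀ n, ∑ i ∈ Finset.range n, ‖G i‖ ≤ ρ) (hr : 0 ≤ r)
    (hY : ∀ t p, ‖act (Y t) (EuclideanSpace.single p 1)‖ ≤ r) (hlam : 0 < lam)
    (hlam_ge : 2 * (ρ * r) ^ 2 ≤ lam) (h T : ℕ) :
    logDetGrowth lam (jointGram G Y h) T ≤ Fintype.card κ * Real.log (1 + T) := by
  refine logDetGrowth_le hlam (posSemidef_jointGram G Y h)
    (by simp [jointGram, gram, features, hY0]) (fun t => ?_) T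
  have hinput : invModulus G / 9 * (gram Y t).trace ≤ 1 * (Fintype.card κ * (ρ * r) ^ 2) := by
    refine mul_le_mul (by linarith [invModulus_le_one G]) ?_ (posSemidef_gram Y t).trace_nonneg
      zero_le_one
    exact trace_transpose_mul_self_le _ fun p => (hY t p).trans (le_mul_of_one_le_left hr hρ1)
  have hfeatures := trace_gram_features_le hρ hr hY h t
  calc (jointGram G Y h t).trace
      = (gram (features G Y h) t).trace + invModulus G / 9 * (gram Y t).trace := by
        rw [jointGram, Matrix.trace_add, Matrix.trace_smul, smul_eq_mul]
    _ ≤ Fintype.card κ * (2 * (ρ * r) ^ 2) := by linarith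
    _ ≤ Fintype.card κ * lam := by gcongr

end Trace

section Memoryless

variable {ι ν υ : Type} [Fintype ι] [Fintype ν] [Fintype υ]

/-- The outputs `a t + ∑_{i ≤ t} G i (Y (t - i) (z (t - i)))` generated by the parameters `z`: the
offset plus the response of `G` to the inputs `Y s (z s)`. -/
def memoryOutput (G : ℕ → Matrix ν υ ℝ) (Y : ℕ → Matrix υ ι ℝ) (a : ℕ → Vec ν) (z : ℕ → Vec ι)
    (t : ℕ) : Vec ν :=
  a t + ∑ i ∈ Finset.range (t + 1), act (G i) (act (Y (t - i)) (z (t - i)))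

/-- The idealized output of round `t` for which the parameter `x` would have been in use forever
and `G` would vanish beyond lag `h`. -/
def memorylessOutput (G : ℕ → Matrix ν υ ℝ) (Y : ℕ → Matrix υ ι ℝ) (a : ℕ → Vec ν) (h : ℕ)
    (x : Vec ι) (t : ℕ) : Vec ν :=
  a t + act (features G Y h t) x

/-- The gradient of the loss of round `t` at the memoryless output of the current parameter. Rounds
are numbered from `1`, so the value at `0` is set to `0`. -/
noncomputable def memorylessGradient (ℓ : ℕ → Vec ν → ℝ) (G : ℕ → Matrix ν υ ℝ)
    (Y : ℕ → Matrix υ ι ℝ) (a : ℕ → Vec ν) (h : ℕ) (z : ℕ → Vec ι) (t : ℕ) : Vec ν :=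
  if t = 0 then 0 else gradient (ℓ t) (memorylessOutput G Y a h (z t) t)

variable [DecidableEq ι] [DecidableEq υ]

/-- Size bounds on a model with memory whose parameters range over `Z`: the impulse response `G` has
`ℓ₁` norm at most `ρ`, the inputs `Y t x` with `x ∈ Z` are bounded by `R`, the offsets `a t` by
`ρ * R`, and the inputs generated by unit coordinate vectors by `r`. -/
structure IsBoundedModel (Z : Set (Vec ι)) (G : ℕ → Matrix ν υ ℝ) (Y : ℕ → Matrix υ ι ℝ)
    (a : ℕ → Vec ν) (ρ r R : ℝ) : Prop where
  one_le_gain : 1 ≤ ρ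
  scale_nonneg : 0 ≤ r
  one_le_radius : 1 ≤ R
  input_zero : Y 0 = 0
  sum_norm_le : ∀ n, ∑ i ∈ Finset.range n, ‖G i‖ ≤ ρ
  norm_offset_le : ∀ t, 1 ≤ t → ‖a t‖ ≤ ρ * R
  norm_input_le : ∀ t, ∀ x ∈ Z, ‖act (Y t) x‖ ≤ R
  norm_input_single_le : ∀ t p, ‖act (Y t) (EuclideanSpace.single p 1)‖ ≤ r
  norm_sq_mul_le : ∀ x ∈ Z, ‖x‖ ^ 2 * r ^ 2 ≤ Fintype.card ι * R ^ 2

namespace IsBoundedModel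

variable {Z : Set (Vec ι)} {G : ℕ → Matrix ν υ ℝ} {Y : ℕ → Matrix υ ι ℝ} {a : ℕ → Vec ν}
  {α L ρ r R : ℝ} {h t T : ℕ} {x : Vec ι} {z : ℕ → Vec ι} {ℓ : ℕ → Vec ν → ℝ}

lemma one_le_bound (hM : IsBoundedModel Z G Y a ρ r R) : 1 ≤ ρ * R :=
  one_le_mul_of_one_le_of_one_le hM.one_le_gain hM.one_le_radius

lemma norm_offset_add_le (hM : IsBoundedModel Z G Y a ρ r R) {u : ℕ → Vec υ}
    (hu : ∀ s, ‖u s‖ ≤ R) (k : ℕ) (ht : 1 ≤ t) :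
    ‖a t + ∑ i ∈ Finset.range k, act (G i) (u (t - i))‖ ≤ 2 * (ρ * R) := by
  have hconv : ‖∑ i ∈ Finset.range k, act (G i) (u (t - i))‖ ≤ ρ * R :=
    norm_sum_act_le (hM.sum_norm_le k) (zero_le_one.trans hM.one_le_radius) fun _ _ => hu _
  linarith [norm_add_le_of_le (hM.norm_offset_le t ht) hconv]

lemma norm_memorylessOutput_le (hM : IsBoundedModel Z G Y a ρ r R) (hx : x ∈ Z) (h : ℕ)
    (ht : 1 ≤ t) : ‖memorylessOutput G Y a h x t‖ ≤ 2 * (ρ * R) := by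
  rw [memorylessOutput, act_features]
  exact hM.norm_offset_add_le (u := fun s => act (Y s) x) (fun s => hM.norm_input_le s x hx) _ ht

lemma norm_gradient_memorylessOutput_le (hM : IsBoundedModel Z G Y a ρ r R) {f : Vec ν → ℝ}
    (hf : LossRegular α L f) (hL : 0 ≤ L) (hx : x ∈ Z) (h : ℕ) (ht : 1 ≤ t) :
    ‖gradient f (memorylessOutput G Y a h x t)‖ ≤ L * (2 * (ρ * R)) :=
  hf.norm_gradient_le hL (by linarith [hM.one_le_bound]) (hM.norm_memorylessOutput_le hx h ht)

lemma norm_memorylessGradient_le (hM : IsBoundedModel Z G Y a ρ r R)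
    (hℓ : ∀ t, 1 ≤ t → LossRegular α L (ℓ t)) (hL : 0 ≤ L) (hz : ∀ t, z t ∈ Z) (h t : ℕ) :
    ‖memorylessGradient ℓ G Y a h z t‖ ≤ L * (2 * (ρ * R)) := by
  rw [memorylessGradient]
  split_ifs with ht
  · have := hM.one_le_bound
    rw [norm_zero]
    positivity
  · have ht1 := Nat.one_le_iff_ne_zero.2 ht
    exact hM.norm_gradient_memorylessOutput_le (hℓ t ht1) hL (hz t) h ht1

lemma norm_memoryOutput_sub_le (hM : IsBoundedModel Z G Y a ρ r R) (hz : ∀ t, z t ∈ Z) {b : ℝ}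
    (hb : ∀ n, ∑ i ∈ Finset.range n, ‖G (h + 1 + i)‖ ≤ b) (t : ℕ) :
    ‖memoryOutput G Y a z t - memorylessOutput G Y a h (z t) t‖ ≤
      b * R + ∑ i ∈ Finset.range (h + 1), ‖act (G i) (act (Y (t - i)) (z (t - i) - z t))‖ := by
  set u : ℕ → Vec υ := fun s => act (Y s) (z s)
  have hsplit : memoryOutput G Y a z t - memorylessOutput G Y a h (z t) t =
      (∑ i ∈ Finset.range (t + 1), act (G i) (u (t - i)) -
        ∑ i ∈ Finset.range (h + 1), act (G i) (u (t - i))) +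
      ∑ i ∈ Finset.range (h + 1), act (G i) (act (Y (t - i)) (z (t - i) - z t)) := by
    simp only [memoryOutput, memorylessOutput, act_features, act_sub, Finset.sum_sub_distrib, u]
    abel
  rw [hsplit]
  refine norm_add_le_of_le (norm_conv_sub_truncated_le G ?_ hb (fun s => ?_) t) (norm_sum_le _ _)
  · simp only [u, hM.input_zero, zero_act]
  · exact hM.norm_input_le s _ (hz s)

lemma sum_loss_memoryOutput_sub_le (hM : IsBoundedModel Z G Y a ρ r R) (hα : 0 ≤ α) (hL : 0 ≤ L)
    (hℓ : ∀ t, 1 ≤ t → LossRegular α L (ℓ t)) (hz : ∀ t, z t ∈ Z) {b : ℝ}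
    (hb : ∀ n, ∑ i ∈ Finset.range n, ‖G (h + 1 + i)‖ ≤ b) (T : ℕ) :
    ∑ t ∈ Finset.Icc 1 T,
        (ℓ t (memoryOutput G Y a z t) - ℓ t (memorylessOutput G Y a h (z t) t)) ≤
      L * (2 * (ρ * R)) * (T * (b * R) + ∑ t ∈ Finset.range (T + 1), ∑ i ∈ Finset.range (h + 1),
        ‖act (G i) (act (Y (t - i)) (z (t - i) - z t))‖) := by
  have hbound := hM.one_le_bound
  have hround : ∀ t ∈ Finset.Icc 1 T,
      ℓ t (memoryOutput G Y a z t) - ℓ t (memorylessOutput G Y a h (z t) t) ≤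
        L * (2 * (ρ * R)) * (b * R +
          ∑ i ∈ Finset.range (h + 1), ‖act (G i) (act (Y (t - i)) (z (t - i) - z t))‖) := by
    intro t ht
    have ht1 := (Finset.mem_Icc.1 ht).1
    have hgrad : ‖gradient (ℓ t) (memoryOutput G Y a z t)‖ ≤ L * (2 * (ρ * R)) :=
      (hℓ t ht1).norm_gradient_le hL (by linarith) (hM.norm_offset_add_le
        (u := fun s => act (Y s) (z s)) (fun s => hM.norm_input_le s _ (hz s)) _ ht1)
    exact ((hℓ t ht1).sub_le_norm hα hgrad).trans
      (mul_le_mul_of_nonneg_left (hM.norm_memoryOutput_sub_le hz hb t) (by positivity))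
  have hsubset : Finset.Icc 1 T ⊆ Finset.range (T + 1) := fun t ht =>
    Finset.mem_range.2 (Nat.lt_succ_iff.2 (Finset.mem_Icc.1 ht).2)
  refine (Finset.sum_le_sum hround).trans ?_
  rw [← Finset.mul_sum, Finset.sum_add_distrib, Finset.sum_const, Nat.card_Icc, nsmul_eq_mul,
    Nat.add_sub_cancel]
  gcongr

lemma norm_memorylessOutput_sub_le (hM : IsBoundedModel Z G Y a ρ r R) (hx : x ∈ Z) {b δ : ℝ}
    (hb : ∀ n, ∑ i ∈ Finset.range n, ‖G (h + 1 + i)‖ ≤ b) {u : ℕ → Vec υ}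
    (hu : ∀ s, ‖act (Y s) x - u s‖ ≤ δ) (t : ℕ) :
    ‖memorylessOutput G Y a h x t -
        (a t + ∑ i ∈ Finset.range (t + 1), act (G i) (u (t - i)))‖ ≤ ρ * δ + b * R := by
  set q : ℕ → Vec υ := fun s => act (Y s) x
  have hsplit : memorylessOutput G Y a h x t -
        (a t + ∑ i ∈ Finset.range (t + 1), act (G i) (u (t - i))) =
      ∑ i ∈ Finset.range (t + 1), act (G i) (q (t - i) - u (t - i)) -
        (∑ i ∈ Finset.range (t + 1), act (G i) (q (t - i)) -
          ∑ i ∈ Finset.range (h + 1), act (G i) (q (t - i))) := by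
    simp only [memorylessOutput, act_features, act_sub, Finset.sum_sub_distrib, q]
    abel
  rw [hsplit]
  refine norm_sub_le_of_le ?_ (norm_conv_sub_truncated_le G ?_ hb (fun s => ?_) t)
  · exact norm_sum_act_le (hM.sum_norm_le _) ((norm_nonneg _).trans (hu 0)) fun i _ => hu (t - i)
  · simp only [q, hM.input_zero, zero_act]
  · exact hM.norm_input_le s x hx

lemma sum_loss_memorylessOutput_sub_le (hM : IsBoundedModel Z G Y a ρ r R) (hα : 0 ≤ α)
    (hL : 0 ≤ L) (hℓ : ∀ t, 1 ≤ t → LossRegular α L (ℓ t)) (hx : x ∈ Z) {b δ : ℝ}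
    (hb : ∀ n, ∑ i ∈ Finset.range n, ‖G (h + 1 + i)‖ ≤ b) {u : ℕ → Vec υ}
    (hu : ∀ s, ‖act (Y s) x - u s‖ ≤ δ) (T : ℕ) :
    ∑ t ∈ Finset.Icc 1 T, (ℓ t (memorylessOutput G Y a h x t) -
        ℓ t (a t + ∑ i ∈ Finset.range (t + 1), act (G i) (u (t - i)))) ≤
      T * (L * (2 * (ρ * R)) * (ρ * δ + b * R)) := by
  have hbound := hM.one_le_bound
  calc _ ≤ ∑ _t ∈ Finset.Icc 1 T, L * (2 * (ρ * R)) * (ρ * δ + b * R) := by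
        refine Finset.sum_le_sum fun t ht => ?_
        have ht1 := (Finset.mem_Icc.1 ht).1
        exact ((hℓ t ht1).sub_le_norm hα
          (hM.norm_gradient_memorylessOutput_le (hℓ t ht1) hL hx h ht1)).trans
            (mul_le_mul_of_nonneg_left (hM.norm_memorylessOutput_sub_le hx hb hu t) (by positivity))
    _ = _ := by rw [Finset.sum_const, Nat.card_Icc, Nat.add_sub_cancel, nsmul_eq_mul]

end IsBoundedModel

end Memoryless

section Regret

variable {ι ν υ : Type} [Fintype ι] [Fintype ν] [Fintype υ]
  {Z : Set (Vec ι)} {G : ℕ → Matrix ν υ ℝ} {Y : ℕ → Matrix υ ι ℝ} {a : ℕ → Vec ν}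
  {α L lam g D : ℝ} {h : ℕ} {z : ℕ → Vec ι} {ℓ : ℕ → Vec ν → ℝ}

lemma loss_memorylessOutput_sub_le (hα : 0 < α) {t : ℕ} (hℓ : LossRegular α L (ℓ t)) (ht : 1 ≤ t)
    (x : Vec ι) :
    ℓ t (memorylessOutput G Y a h (z t) t) - ℓ t (memorylessOutput G Y a h x t) ≤
      α / 2 * (2 * (1 / α) * inner ℝ (memorylessGradient ℓ G Y a h z t)
          (act (features G Y h t) (z t - x)) - ‖act (features G Y h t) (z t - x)‖ ^ 2) := by
  have hquad := hℓ.sub_le (memorylessOutput G Y a h (z t) t) (memorylessOutput G Y a h x t)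
  have hdiff : memorylessOutput G Y a h (z t) t - memorylessOutput G Y a h x t =
      act (features G Y h t) (z t - x) := by
    rw [memorylessOutput, memorylessOutput, add_sub_add_left_eq_sub, ← act_sub]
  rw [hdiff] at hquad
  rw [memorylessGradient, if_neg (Nat.one_le_iff_ne_zero.1 ht)]
  refine hquad.trans (le_of_eq ?_)
  field_simp

variable [DecidableEq ι]

lemma IsNewtonRun.sum_loss_memorylessOutput_sub_le (hα : 0 < α)
    (hℓ : ∀ t, 1 ≤ t → LossRegular α L (ℓ t)) (hY : Y 0 = 0)
    (hrun : IsNewtonRun Z (1 / α) lam g (features G Y h) (memorylessGradient ℓ G Y a h z) z)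
    {x : Vec ι} (hx : x ∈ Z) {T : ℕ}
    (hD : logDetGrowth lam (gram (features G Y h)) T ≤ D) :
    ∑ t ∈ Finset.Icc 1 T,
        (ℓ t (memorylessOutput G Y a h (z t) t) - ℓ t (memorylessOutput G Y a h x t)) ≤
      α / 2 * (lam * ‖z 0 - x‖ ^ 2) + g ^ 2 * D / (2 * α) := by
  set f : ℕ → ℝ := fun t => 2 * (1 / α) * inner ℝ (memorylessGradient ℓ G Y a h z t)
    (act (features G Y h t) (z t - x)) - ‖act (features G Y h t) (z t - x)‖ ^ 2 with hf
  have hf0 : f 0 = 0 := by simp [hf, features, hY, zero_act]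
  have hshift : ∑ t ∈ Finset.Icc 1 T, f t = ∑ t ∈ Finset.range (T + 1), f t := by
    rw [Finset.range_eq_Ico, Finset.sum_eq_sum_Ico_succ_bot T.succ_pos, hf0, zero_add]
    rfl
  calc _ ≤ ∑ t ∈ Finset.Icc 1 T, α / 2 * f t := Finset.sum_le_sum fun t ht =>
        have ht1 := (Finset.mem_Icc.1 ht).1
        loss_memorylessOutput_sub_le hα (hℓ t ht1) ht1 x
    _ = α / 2 * ∑ t ∈ Finset.range (T + 1), f t := by rw [← Finset.mul_sum, hshift]
    _ ≤ α / 2 * (lam * ‖z 0 - x‖ ^ 2 + (1 / α) ^ 2 * g ^ 2 * ∑ t ∈ Finset.range (T + 1),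
          leverage (regSum lam (gram (features G Y h)) t) (gram (features G Y h) t)) :=
        mul_le_mul_of_nonneg_left (hrun.regret_le hx (T + 1)) (by positivity)
    _ ≤ α / 2 * (lam * ‖z 0 - x‖ ^ 2 + (1 / α) ^ 2 * g ^ 2 * D) := by
        have := (sum_leverage_le_logDetGrowth hrun.lam_pos (posSemidef_gram _) T).trans hD
        gcongr
    _ = _ := by field_simp

end Regret

lemma half_le_log_one_add {T : ℕ} (hT : 0 < T) : 1 / 2 ≤ Real.log (1 + T) := by
  have hT1 : (1 : ℝ) ≤ T := by exact_mod_cast hT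
  have hlog : Real.log 2 ≤ Real.log (1 + T) := Real.log_le_log two_pos (by linarith)
  linarith [Real.log_two_gt_d9]

lemma ceil_add_two_mul_ceil_mul_le {s D : ℝ} (hs : 1 ≤ s) (hD : 1 / 2 ≤ D) :
    (⌈6 * s⌉₊ : ℝ) + 2 * ⌈6 * s⌉₊ * D ≤ 28 * (s * D) := by
  have hceil : (⌈6 * s⌉₊ : ℝ) ≤ 7 * s := by
    linarith [Nat.ceil_lt_add_one (show 0 ≤ 6 * s by linarith)]
  calc (⌈6 * s⌉₊ : ℝ) + 2 * ⌈6 * s⌉₊ * D = ⌈6 * s⌉₊ * (1 + 2 * D) := by ring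
    _ ≤ 7 * s * (4 * D) := by gcongr; linarith
    _ = 28 * (s * D) := by ring

lemma one_le_inv_sqrt_invModulus {ν υ : Type} [Fintype ν] [Fintype υ] {G : ℕ → Matrix ν υ ℝ}
    (hκ : 0 < invModulus G) : 1 ≤ (√(invModulus G))⁻¹ :=
  one_le_inv_iff₀.2 ⟨Real.sqrt_pos.2 hκ, Real.sqrt_le_one.2 (invModulus_le_one G)⟩

section Assembly

variable {ι ν υ : Type} [Fintype ι] [Fintype ν] [Fintype υ] [DecidableEq ι] [DecidableEq υ]
  {Z : Set (Vec ι)} {G : ℕ → Matrix ν υ ℝ} {Y : ℕ → Matrix υ ι ℝ} {a : ℕ → Vec ν}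
  {α L ρ r R D : ℝ} {h T : ℕ} {x : Vec ι} {z : ℕ → Vec ι} {ℓ : ℕ → Vec ν → ℝ}

namespace IsBoundedModel

lemma one_le_mul_inv_sqrt_invModulus (hM : IsBoundedModel Z G Y a ρ r R) (hκ : 0 < invModulus G)
    (hh : 0 < h) : 1 ≤ h * ρ * (√(invModulus G))⁻¹ :=
  one_le_mul_of_one_le_of_one_le
    (one_le_mul_of_one_le_of_one_le (by exact_mod_cast hh) hM.one_le_gain)
    (one_le_inv_sqrt_invModulus hκ)

lemma norm_sub_sq_mul_le (hM : IsBoundedModel Z G Y a ρ r R) {y : Vec ι} (hy : y ∈ Z)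
    (hx : x ∈ Z) : ‖y - x‖ ^ 2 * r ^ 2 ≤ 4 * (Fintype.card ι * R ^ 2) := by
  have hsq : ‖y - x‖ ^ 2 ≤ 2 * ‖y‖ ^ 2 + 2 * ‖x‖ ^ 2 := by
    nlinarith [parallelogram_law_with_norm ℝ y x, sq_nonneg ‖y + x‖]
  nlinarith [hM.norm_sq_mul_le y hy, hM.norm_sq_mul_le x hx,
    mul_le_mul_of_nonneg_right hsq (sq_nonneg r)]

lemma sum_loss_memory_le (hM : IsBoundedModel Z G Y a ρ r R) (hα : 0 < α) (hαL : α ≤ L)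
    (hℓ : ∀ t, 1 ≤ t → LossRegular α L (ℓ t)) {lam : ℝ}
    (hrun : IsNewtonRun Z (1 / α) lam (L * (2 * (ρ * R))) (features G Y h)
      (memorylessGradient ℓ G Y a h z) z)
    (hκ : 0 < invModulus G) (hh : 0 < h) (hT : 0 < T)
    (hb : ∀ n, ∑ i ∈ Finset.range n, ‖G (h + 1 + i)‖ ≤ ρ / T) (hD_half : 1 / 2 ≤ D)
    (hD : logDetGrowth lam (gram (features G Y h)) T ≤ D)
    (hD_joint : logDetGrowth lam (jointGram G Y h) T ≤ D) :
    ∑ t ∈ Finset.Icc 1 T,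
        (ℓ t (memoryOutput G Y a z t) - ℓ t (memorylessOutput G Y a h (z t) t)) ≤
      156 * (α⁻¹ * (L * (ρ * R)) ^ 2 * (h * ρ * (√(invModulus G))⁻¹ * D)) := by
  set q := (√(invModulus G))⁻¹
  have hL := hα.trans_le hαL
  have hT' : (T : ℝ) ≠ 0 := by positivity
  have hρ := zero_lt_one.trans_le hM.one_le_gain
  have hR := zero_lt_one.trans_le hM.one_le_radius
  have hs : 1 ≤ h * ρ * q := hM.one_le_mul_inv_sqrt_invModulus hκ hh
  have hL_le : L ≤ α⁻¹ * L ^ 2 := by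
    rw [inv_mul_eq_div, le_div_iff₀ hα]
    nlinarith
  have hmemory := sum_norm_memory_le (K := ⌈6 * (h * ρ * q)⌉₊) hrun (by positivity) hκ
    hM.input_zero (Nat.ceil_pos.2 (by linarith))
    (sum_mul_truncationWeight_le_third (fun i => norm_nonneg (G i)) (Real.sqrt_pos.2 hκ) hρ hh
      hM.sum_norm_le hb (by simpa only [mul_assoc] using Nat.le_ceil (6 * (h * ρ * q))))
    hM.norm_input_le hM.sum_norm_le hD hD_joint
  have hwindow := ceil_add_two_mul_ceil_mul_le hs hD_half
  refine (hM.sum_loss_memoryOutput_sub_le hα.le hL.le hℓ hrun.mem hb T).trans ?_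
  calc _ ≤ L * (2 * (ρ * R)) * (T * (ρ / T * R) + ρ * (10 * (1 / α) * (L * (2 * (ρ * R))) * h * q *
            D + 2 * R * (28 * (h * ρ * q * D)))) := by gcongr; exact hmemory.trans (by gcongr)
    _ = 40 * (α⁻¹ * (L * (ρ * R)) ^ 2 * (h * ρ * q * D)) +
          L * (ρ * R) ^ 2 * (2 * 1 + 112 * (h * ρ * q * D)) := by field_simp; ring
    _ ≤ 40 * (α⁻¹ * (L * (ρ * R)) ^ 2 * (h * ρ * q * D)) +
          α⁻¹ * L ^ 2 * (ρ * R) ^ 2 * (2 * (2 * (h * ρ * q * D)) + 112 * (h * ρ * q * D)) := by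
        gcongr
        nlinarith
    _ = _ := by ring

lemma regularization_le (hM : IsBoundedModel Z G Y a ρ r R) (hα : 0 < α) (hαL : α ≤ L)
    {y : Vec ι} (hy : y ∈ Z) (hx : x ∈ Z) (hκ : 0 < invModulus G) (hh : 0 < h)
    (hD : Fintype.card ι ≤ 2 * D) :
    α / 2 * (6 * h * r ^ 2 * ρ ^ 2 * ‖y - x‖ ^ 2) + (L * (2 * (ρ * R))) ^ 2 * D / (2 * α) ≤
      26 * (α⁻¹ * (L * (ρ * R)) ^ 2 * (h * ρ * (√(invModulus G))⁻¹ * D)) := by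
  set q := (√(invModulus G))⁻¹
  have hq : 1 ≤ ρ * q :=
    one_le_mul_of_one_le_of_one_le hM.one_le_gain (one_le_inv_sqrt_invModulus hκ)
  have hh1 : (1 : ℝ) ≤ h := by exact_mod_cast hh
  have hD0 : 0 ≤ D := by linarith [(Fintype.card ι).cast_nonneg (α := ℝ)]
  have hα_le : α ≤ α⁻¹ * L ^ 2 := by
    rw [inv_mul_eq_div, le_div_iff₀ hα]
    nlinarith
  calc _ = 3 * α * h * ρ ^ 2 * (‖y - x‖ ^ 2 * r ^ 2) +
          2 * (α⁻¹ * (L * (ρ * R)) ^ 2 * (1 * 1 * D)) := by field_simp; ring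
    _ ≤ 3 * (α⁻¹ * L ^ 2) * h * ρ ^ 2 * (4 * (2 * D * R ^ 2)) +
          2 * (α⁻¹ * (L * (ρ * R)) ^ 2 * (h * (ρ * q) * D)) := by
        have hdist := (hM.norm_sub_sq_mul_le hy hx).trans
          (by gcongr : 4 * (Fintype.card ι * R ^ 2) ≤ 4 * (2 * D * R ^ 2))
        exact add_le_add (mul_le_mul (by gcongr) hdist (by positivity) (by positivity))
          (by gcongr)
    _ = 24 * (α⁻¹ * (L * (ρ * R)) ^ 2 * (h * 1 * D)) +
          2 * (α⁻¹ * (L * (ρ * R)) ^ 2 * (h * (ρ * q) * D)) := by ring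
    _ ≤ 24 * (α⁻¹ * (L * (ρ * R)) ^ 2 * (h * (ρ * q) * D)) +
          2 * (α⁻¹ * (L * (ρ * R)) ^ 2 * (h * (ρ * q) * D)) := by gcongr
    _ = _ := by ring

lemma sum_loss_comparator_le (hM : IsBoundedModel Z G Y a ρ r R) (hα : 0 < α) (hαL : α ≤ L)
    (hℓ : ∀ t, 1 ≤ t → LossRegular α L (ℓ t)) (hx : x ∈ Z) (hκ : 0 < invModulus G) (hh : 0 < h)
    (hT : 0 < T) (hb : ∀ n, ∑ i ∈ Finset.range n, ‖G (h + 1 + i)‖ ≤ ρ / T) {c : ℝ} (hc : 0 ≤ c)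
    {u : ℕ → Vec υ} (hu : ∀ s, ‖act (Y s) x - u s‖ ≤ c * R / T) (hD_half : 1 / 2 ≤ D) :
    ∑ t ∈ Finset.Icc 1 T, (ℓ t (memorylessOutput G Y a h x t) -
        ℓ t (a t + ∑ i ∈ Finset.range (t + 1), act (G i) (u (t - i)))) ≤
      4 * (1 + c) * (α⁻¹ * (L * (ρ * R)) ^ 2 * (h * ρ * (√(invModulus G))⁻¹ * D)) := by
  set q := (√(invModulus G))⁻¹
  have hL := hα.trans_le hαL
  have hT' : (T : ℝ) ≠ 0 := by positivity
  have hs : 1 ≤ h * ρ * q := hM.one_le_mul_inv_sqrt_invModulus hκ hh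
  have hL_le : L ≤ α⁻¹ * L ^ 2 := by
    rw [inv_mul_eq_div, le_div_iff₀ hα]
    nlinarith
  calc _ ≤ T * (L * (2 * (ρ * R)) * (ρ * (c * R / T) + ρ / T * R)) :=
        hM.sum_loss_memorylessOutput_sub_le hα.le hL.le hℓ hx hb hu T
    _ = 2 * (1 + c) * (L * (ρ * R) ^ 2 * 1) := by field_simp; ring
    _ ≤ 2 * (1 + c) * (α⁻¹ * L ^ 2 * (ρ * R) ^ 2 * (2 * (h * ρ * q * D))) := by
        gcongr
        nlinarith
    _ = _ := by ring

theorem sum_loss_memoryOutput_le (hM : IsBoundedModel Z G Y a ρ r R) [Nonempty ι] (hα : 0 < α)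
    (hαL : α ≤ L) (hℓ : ∀ t, 1 ≤ t → LossRegular α L (ℓ t))
    (hrun : IsNewtonRun Z (1 / α) (6 * h * r ^ 2 * ρ ^ 2) (L * (2 * (ρ * R))) (features G Y h)
      (memorylessGradient ℓ G Y a h z) z)
    (hκ : 0 < invModulus G) (hh : 0 < h) (hT : 0 < T)
    (hb : ∀ n, ∑ i ∈ Finset.range n, ‖G (h + 1 + i)‖ ≤ ρ / T) {c : ℝ} (hc : 0 ≤ c) (hx : x ∈ Z)
    {u : ℕ → Vec υ} (hu : ∀ s, ‖act (Y s) x - u s‖ ≤ c * R / T) :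
    ∑ t ∈ Finset.Icc 1 T, ℓ t (memoryOutput G Y a z t) ≤
      ∑ t ∈ Finset.Icc 1 T, ℓ t (a t + ∑ i ∈ Finset.range (t + 1), act (G i) (u (t - i))) +
        200 * (1 + c) * (α⁻¹ * (L * (ρ * R)) ^ 2 *
          (h * ρ * (√(invModulus G))⁻¹ * (Fintype.card ι * Real.log (1 + T)))) := by
  have hlog := half_le_log_one_add hT
  have hcard : (1 : ℝ) ≤ Fintype.card ι := by exact_mod_cast Fintype.card_pos
  have hh1 : (1 : ℝ) ≤ h := by exact_mod_cast hh
  have hlam_ge : 2 * (ρ * r) ^ 2 ≤ 6 * h * r ^ 2 * ρ ^ 2 := by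
    nlinarith [mul_le_mul_of_nonneg_right hh1 (sq_nonneg (ρ * r)), sq_nonneg (ρ * r)]
  set D : ℝ := Fintype.card ι * Real.log (1 + T)
  have hD_card : Fintype.card ι ≤ 2 * D := by nlinarith
  have hD : logDetGrowth (6 * h * r ^ 2 * ρ ^ 2) (gram (features G Y h)) T ≤ D :=
    logDetGrowth_features_le hM.input_zero hM.sum_norm_le hM.scale_nonneg hM.norm_input_single_le
      hrun.lam_pos (by nlinarith [sq_nonneg (ρ * r)]) h T
  have hD_joint : logDetGrowth (6 * h * r ^ 2 * ρ ^ 2) (jointGram G Y h) T ≤ D :=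
    logDetGrowth_jointGram_le hM.input_zero hM.one_le_gain hM.sum_norm_le hM.scale_nonneg
      hM.norm_input_single_le hrun.lam_pos hlam_ge h T
  have hmemory := hM.sum_loss_memory_le hα hαL hℓ hrun hκ hh hT hb (by linarith) hD hD_joint
  have hregret := hrun.sum_loss_memorylessOutput_sub_le hα hℓ hM.input_zero hx hD
  have hreg := hM.regularization_le hα hαL (hrun.mem 0) hx hκ hh hD_card
  have hcomparator := hM.sum_loss_comparator_le hα hαL hℓ hx hκ hh hT hb hc hu
    (show 1 / 2 ≤ D by linarith)
  rw [Finset.sum_sub_distrib] at hmemory hregret hcomparator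
  have hρ := zero_le_one.trans hM.one_le_gain
  have : 0 ≤ D := by linarith
  have hscale : 0 ≤ α⁻¹ * (L * (ρ * R)) ^ 2 * (h * ρ * (√(invModulus G))⁻¹ * D) := by positivity
  nlinarith [mul_nonneg hc hscale]

end IsBoundedModel

end Assembly

section Joint

variable {a b c d : ℕ}

lemma act_fromBlocks (A : Matrix (Fin a) (Fin c) ℝ) (B : Matrix (Fin a) (Fin d) ℝ)
    (C : Matrix (Fin b) (Fin c) ℝ) (D : Matrix (Fin b) (Fin d) ℝ) (x : Vec (Fin c))
    (y : Vec (Fin d)) :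
    act (Matrix.fromBlocks A B C D) (joint x y) =
      joint (act A x + act B y) (act C x + act D y) := by
  ext i; rcases i with i | i <;> simp [joint, act, Matrix.fromBlocks_mulVec]

lemma act_fromRows (A : Matrix (Fin a) (Fin c) ℝ) (B : Matrix (Fin b) (Fin c) ℝ)
    (x : Vec (Fin c)) : act (Matrix.fromRows A B) x = joint (act A x) (act B x) := by
  ext i; rcases i with i | i <;> simp [joint, act, Matrix.fromRows_mulVec]

lemma act_fromCols (A : Matrix (Fin a) (Fin c) ℝ) (B : Matrix (Fin a) (Fin d) ℝ)
    (x : Vec (Fin c)) (y : Vec (Fin d)) :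
    act (Matrix.fromCols A B) (joint x y) = act A x + act B y := by
  ext i; simp [joint, act, Matrix.fromCols_mulVec]

end Joint

lemma trajectory_succ {σ : Type} (step : ℕ → σ → σ) (init : σ) {t : ℕ} (ht : 1 ≤ t) :
    trajectory step init (t + 1) = step t (trajectory step init t) := by
  obtain ⟨t, rfl⟩ := Nat.exists_eq_add_of_le' ht
  rfl

lemma sum_Icc_act_eq_sum_range {ι κ : Type} [Fintype ι] [Fintype κ] (G : ℕ → Matrix ι κ ℝ)
    {u : ℕ → Vec κ} (hu : u 0 = 0) (t : ℕ) :
    ∑ i ∈ Finset.Icc 1 t, act (G (t - i)) (u i) =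
      ∑ j ∈ Finset.range (t + 1), act (G j) (u (t - j)) := by
  have hflip : ∑ j ∈ Finset.range (t + 1), act (G j) (u (t - j)) =
      ∑ i ∈ Finset.range (t + 1), act (G (t - i)) (u i) := by
    rw [← Finset.sum_flip]
    refine Finset.sum_congr rfl fun i hi => ?_
    rw [Nat.sub_sub_self (Finset.mem_range_succ_iff.1 hi)]
  rw [hflip, Finset.range_eq_Ico, Finset.sum_eq_sum_Ico_succ_bot t.succ_pos, hu, act_zero,
    zero_add]
  rfl

section Superposition

variable {dx ds dy du dω : ℕ} (S : LinSys dx dy du) (π₀ : NominalController ds dy du dω)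

/-- The deviation, caused by the exogenous inputs `u`, of the joint state of the system and the
nominal controller at the beginning of round `t`. -/
def response (u : ℕ → Vec (Fin du)) (t : ℕ) : Vec (Fin dx ⊕ Fin ds) :=
  ∑ i ∈ Finset.Ico 1 t, act (loopA S π₀ ^ (t - 1 - i) * loopB S π₀) (u i)

lemma response_succ (u : ℕ → Vec (Fin du)) {t : ℕ} (ht : 1 ≤ t) :
    response S π₀ u (t + 1) = act (loopA S π₀) (response S π₀ u t) + act (loopB S π₀) (u t) := by
  rw [response, Finset.sum_Ico_succ_top ht, response, act_sum]
  congr 1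
  · refine Finset.sum_congr rfl fun i hi => ?_
    have := Finset.mem_Ico.1 hi
    rw [← mul_act, ← Matrix.mul_assoc, ← pow_succ', show t + 1 - 1 - i = t - 1 - i + 1 by omega]
  · rw [Nat.add_sub_cancel, Nat.sub_self, pow_zero, Matrix.one_mul]

lemma act_response_add_joint (u : ℕ → Vec (Fin du)) {t : ℕ} (ht : 1 ≤ t) :
    act (Matrix.fromBlocks S.C 0 (π₀.D * S.C) π₀.C) (response S π₀ u t) + joint 0 (u t) =
      ∑ i ∈ Finset.Icc 1 t, act (markovV S π₀ (t - i)) (u i) := by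
  rw [← Finset.Ico_add_one_right_eq_Icc, Finset.sum_Ico_succ_top ht, response, act_sum]
  congr 1
  · refine Finset.sum_congr rfl fun i hi => ?_
    have := Finset.mem_Ico.1 hi
    rw [← mul_act, show t - i = t - 1 - i + 1 by omega, markovV, Matrix.mul_assoc]
  · rw [Nat.sub_self, markovV, act_fromRows, zero_act, one_act]

lemma act_response_eq_sum_markovOmega (u : ℕ → Vec (Fin du)) (t : ℕ) :
    act (Matrix.fromCols (π₀.Dω * S.C) π₀.Cω) (response S π₀ u t) =
      ∑ i ∈ Finset.Ico 1 t, act (markovOmega S π₀ (t - i)) (u i) := by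
  rw [response, act_sum]
  refine Finset.sum_congr rfl fun i hi => ?_
  have := Finset.mem_Ico.1 hi
  rw [← mul_act, show t - i = t - 1 - i + 1 by omega, markovOmega, Matrix.mul_assoc]

variable {S π₀} {x x' : Vec (Fin dx)} {s s' : Vec (Fin ds)} {r : Vec (Fin dx ⊕ Fin ds)}

lemma joint_state_succ (hr : joint x s = joint x' s' + r) (u : Vec (Fin du)) (w : Vec (Fin dx))
    (e : Vec (Fin dy)) :
    joint (act S.A x + act S.B (u + act π₀.C s + act π₀.D (act S.C x + e)) + w)
        (act π₀.A s + act π₀.B (act S.C x + e) + act π₀.Bex u) =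
      joint (act S.A x' + act S.B (act π₀.C s' + act π₀.D (act S.C x' + e)) + w)
        (act π₀.A s' + act π₀.B (act S.C x' + e)) +
      (act (loopA S π₀) r + act (loopB S π₀) u) := by
  rw [eq_sub_of_add_eq' hr.symm, act_sub, loopA, loopB, act_fromBlocks, act_fromBlocks,
    act_fromRows]
  ext i
  rcases i with i | i <;>
  · simp only [joint, act_add, add_act, mul_act, WithLp.ofLp_add, Sum.elim_inl, Sum.elim_inr,
      Pi.add_apply, PiLp.add_apply, PiLp.sub_apply]
    ring

lemma joint_output (hr : joint x s = joint x' s' + r) (u : Vec (Fin du)) (e : Vec (Fin dy)) :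
    joint (act S.C x + e) (u + act π₀.C s + act π₀.D (act S.C x + e)) =
      joint (act S.C x' + e) (act π₀.C s' + act π₀.D (act S.C x' + e)) +
      (act (Matrix.fromBlocks S.C 0 (π₀.D * S.C) π₀.C) r + joint 0 u) := by
  rw [eq_sub_of_add_eq' hr.symm, act_sub, act_fromBlocks, act_fromBlocks]
  ext i
  rcases i with i | i <;>
  · simp only [joint, act_add, zero_act, mul_act, WithLp.ofLp_add, WithLp.ofLp_zero, Sum.elim_inl,
      Sum.elim_inr, Pi.add_apply, Pi.zero_apply, PiLp.add_apply, PiLp.sub_apply]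
    ring

lemma auxiliary_output (hr : joint x s = joint x' s' + r) (e : Vec (Fin dy)) :
    act π₀.Cω s + act π₀.Dω (act S.C x + e) =
      act π₀.Cω s' + act π₀.Dω (act S.C x' + e) +
      act (Matrix.fromCols (π₀.Dω * S.C) π₀.Cω) r := by
  rw [eq_sub_of_add_eq' hr.symm, act_sub, act_fromCols, act_fromCols]
  simp only [act_add, mul_act]
  abel

end Superposition

section Embedding

variable {m du dω : ℕ} {ω ω' : ℕ → Vec (Fin dω)}

lemma embed_congr {t : ℕ} (h : ∀ i, 1 ≤ i → i ≤ t → ω i = ω' i) :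
    (embed m ω t : Matrix (Fin du) (PIdx m du dω) ℝ) = embed m ω' t := by
  ext a p
  simp only [embed, Matrix.of_apply]
  split_ifs with hp
  · rw [h _ (by omega) (by omega)]
  · rfl

lemma embed_zero (ω : ℕ → Vec (Fin dω)) :
    (embed m ω 0 : Matrix (Fin du) (PIdx m du dω) ℝ) = 0 := by
  ext a p; simp [embed]

end Embedding

section Loop

variable {dx ds dy du dω : ℕ}

/-- The controller parameter `z t` with which the algorithm plays round `t`. -/
noncomputable def algParam (S : LinSys dx dy du) (π₀ : NominalController ds dy du dω)
    (w : ℕ → Vec (Fin dx)) (e : ℕ → Vec (Fin dy)) (ℓ : ℕ → Vec (Fin dy ⊕ Fin du) → ℝ)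
    (P : AlgInput dy du dω) (z₁ : Vec (PIdx P.m du dω)) (t : ℕ) : Vec (PIdx P.m du dω) :=
  (loopState S π₀ w e ℓ P z₁ t).alg.z

/-- The exogenous input `Y t (z t)` of round `t`, with `Y t` built from nature's iterates instead of
the recovered ones. -/
noncomputable def playedInput (S : LinSys dx dy du) (π₀ : NominalController ds dy du dω)
    (w : ℕ → Vec (Fin dx)) (e : ℕ → Vec (Fin dy)) (ℓ : ℕ → Vec (Fin dy ⊕ Fin du) → ℝ)
    (P : AlgInput dy du dω) (z₁ : Vec (PIdx P.m du dω)) (t : ℕ) : Vec (Fin du) :=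
  act (embed P.m (omegaNat S π₀ w e) t) (algParam S π₀ w e ℓ P z₁ t)

/-- At the beginning of round `t`, the algorithm has recovered nature's iterates exactly, and the
state of the loop is nature's state plus the response to the exogenous inputs. -/
structure LoopInvariant (S : LinSys dx dy du) (π₀ : NominalController ds dy du dω)
    (w : ℕ → Vec (Fin dx)) (e : ℕ → Vec (Fin dy)) (ℓ : ℕ → Vec (Fin dy ⊕ Fin du) → ℝ)
    (P : AlgInput dy du dω) (z₁ : Vec (PIdx P.m du dω)) (t : ℕ) : Prop where
  uex : ∀ i, 1 ≤ i → i < t →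
    (loopState S π₀ w e ℓ P z₁ t).alg.uex i = playedInput S π₀ w e ℓ P z₁ i
  omegaHat : ∀ i, 1 ≤ i → i < t →
    (loopState S π₀ w e ℓ P z₁ t).alg.omegaHat i = omegaNat S π₀ w e i
  Lam : (loopState S π₀ w e ℓ P z₁ t).alg.Lam =
    regSum P.lam (gram (features P.Gv (embed P.m (omegaNat S π₀ w e)) P.h)) (t - 1)
  state : joint (loopState S π₀ w e ℓ P z₁ t).x (loopState S π₀ w e ℓ P z₁ t).s =
    joint (natState S π₀ w e t).1 (natState S π₀ w e t).2 +
      response S π₀ (playedInput S π₀ w e ℓ P z₁) t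

variable {S : LinSys dx dy du} {π₀ : NominalController ds dy du dω} {w : ℕ → Vec (Fin dx)}
  {e : ℕ → Vec (Fin dy)} {ℓ : ℕ → Vec (Fin dy ⊕ Fin du) → ℝ} {P : AlgInput dy du dω}
  {z₁ : Vec (PIdx P.m du dω)} {t : ℕ}

lemma playedInput_zero : playedInput S π₀ w e ℓ P z₁ 0 = 0 := by
  rw [playedInput, embed_zero, zero_act]

lemma alg_loopState_succ (ht : 1 ≤ t) :
    (loopState S π₀ w e ℓ P z₁ (t + 1)).alg =
      algUpdate P t (loopRound S π₀ e P t (loopState S π₀ w e ℓ P z₁ t)).2.1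
        (algIterate S π₀ w e ℓ P z₁ t) (ℓ t) := by
  rw [loopState, trajectory_succ _ _ ht]
  rfl

namespace LoopInvariant

lemma one : LoopInvariant S π₀ w e ℓ P z₁ 1 where
  uex i h1 h2 := by omega
  omegaHat i h1 h2 := by omega
  Lam := by simp [loopState, trajectory, algInit, regSum, gram, features, embed_zero]
  state := by simp [loopState, natState, trajectory, response]

variable (h : LoopInvariant S π₀ w e ℓ P z₁ t)
include h

lemma loopRound_omegaHat (hω : P.Gω = markovOmega S π₀) {i : ℕ} (hi : 1 ≤ i) (hit : i ≤ t) :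
    (loopRound S π₀ e P t (loopState S π₀ w e ℓ P z₁ t)).2.1.omegaHat i =
      omegaNat S π₀ w e i := by
  simp only [loopRound, algPlay]
  rcases hit.eq_or_lt with rfl | hlt
  · have hpast : ∑ j ∈ Finset.Ico 1 i, act (markovOmega S π₀ (i - j))
        ((loopState S π₀ w e ℓ P z₁ i).alg.uex j) =
        ∑ j ∈ Finset.Ico 1 i, act (markovOmega S π₀ (i - j)) (playedInput S π₀ w e ℓ P z₁ j) :=
      Finset.sum_congr rfl fun j hj => by
        rw [h.uex j (Finset.mem_Ico.1 hj).1 (Finset.mem_Ico.1 hj).2]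
    rw [Function.update_self, auxiliary_output h.state, act_response_eq_sum_markovOmega, hω, hpast,
      add_sub_cancel_right, omegaNat]
  · rw [Function.update_of_ne hlt.ne, h.omegaHat i hi hlt]

lemma loopRound_embed (hω : P.Gω = markovOmega S π₀) {i : ℕ} (hit : i ≤ t) :
    (embed P.m (loopRound S π₀ e P t (loopState S π₀ w e ℓ P z₁ t)).2.1.omegaHat i :
      Matrix (Fin du) (PIdx P.m du dω) ℝ) = embed P.m (omegaNat S π₀ w e) i :=
  embed_congr fun _ h1 h2 => h.loopRound_omegaHat hω h1 (h2.trans hit)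

lemma loopRound_uex (hω : P.Gω = markovOmega S π₀) {i : ℕ} (hi : 1 ≤ i) (hit : i ≤ t) :
    (loopRound S π₀ e P t (loopState S π₀ w e ℓ P z₁ t)).2.1.uex i =
      playedInput S π₀ w e ℓ P z₁ i := by
  rcases hit.eq_or_lt with rfl | hlt
  · have hembed := h.loopRound_embed hω le_rfl
    simp only [loopRound, algPlay] at hembed ⊢
    rw [Function.update_self, hembed, playedInput, algParam]
  · simp only [loopRound, algPlay]
    rw [Function.update_of_ne hlt.ne, h.uex i hi hlt]

lemma algIterate_eq (hω : P.Gω = markovOmega S π₀) (ht : 1 ≤ t) :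
    algIterate S π₀ w e ℓ P z₁ t = vNat S π₀ w e t +
      ∑ i ∈ Finset.Icc 1 t, act (markovV S π₀ (t - i)) (playedInput S π₀ w e ℓ P z₁ i) := by
  rw [← act_response_add_joint _ _ _ ht, vNat, ← joint_output h.state,
    ← h.loopRound_uex hω ht le_rfl]
  rfl

lemma recovered_vNat (hv : P.Gv = markovV S π₀) (hω : P.Gω = markovOmega S π₀) (ht : 1 ≤ t) :
    algIterate S π₀ w e ℓ P z₁ t - ∑ i ∈ Finset.Icc 1 t, act (P.Gv (t - i))
        ((loopRound S π₀ e P t (loopState S π₀ w e ℓ P z₁ t)).2.1.uex i) = vNat S π₀ w e t := by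
  rw [hv, Finset.sum_congr rfl fun i hi => by
    rw [h.loopRound_uex hω (Finset.mem_Icc.1 hi).1 (Finset.mem_Icc.1 hi).2]]
  exact sub_eq_of_eq_add (h.algIterate_eq hω ht)

lemma recovered_features (hω : P.Gω = markovOmega S π₀) :
    ∑ i ∈ Finset.range (P.h + 1), P.Gv i *
        embed P.m (loopRound S π₀ e P t (loopState S π₀ w e ℓ P z₁ t)).2.1.omegaHat (t - i) =
      features P.Gv (embed P.m (omegaNat S π₀ w e)) P.h t :=
  Finset.sum_congr rfl fun i _ => by rw [h.loopRound_embed hω (Nat.sub_le t i)]; rfl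

lemma Lam_succ (hω : P.Gω = markovOmega S π₀) (ht : 1 ≤ t) :
    (loopState S π₀ w e ℓ P z₁ (t + 1)).alg.Lam =
      regSum P.lam (gram (features P.Gv (embed P.m (omegaNat S π₀ w e)) P.h)) t := by
  obtain ⟨t, rfl⟩ := Nat.exists_eq_add_of_le' ht
  rw [alg_loopState_succ ht, regSum_succ]
  simp only [algUpdate, h.recovered_features hω]
  exact congrArg (· + _) h.Lam

lemma algParam_succ (hv : P.Gv = markovV S π₀) (hω : P.Gω = markovOmega S π₀) (ht : 1 ≤ t) :
    algParam S π₀ w e ℓ P z₁ (t + 1) = projOn (paramSet P.m du dω P.RM)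
      (loopState S π₀ w e ℓ P z₁ (t + 1)).alg.Lam
      (algParam S π₀ w e ℓ P z₁ t - P.η • act (loopState S π₀ w e ℓ P z₁ (t + 1)).alg.Lam⁻¹
        (gradient (fun z => ℓ t (vNat S π₀ w e t +
          act (features P.Gv (embed P.m (omegaNat S π₀ w e)) P.h t) z))
          (algParam S π₀ w e ℓ P z₁ t))) := by
  rw [algParam, alg_loopState_succ ht]
  simp only [algUpdate, h.recovered_features hω, h.recovered_vNat hv hω ht]
  rfl

lemma succ (hω : P.Gω = markovOmega S π₀) (ht : 1 ≤ t) :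
    LoopInvariant S π₀ w e ℓ P z₁ (t + 1) where
  uex i h1 h2 := by
    rw [alg_loopState_succ ht]
    exact h.loopRound_uex hω h1 (Nat.lt_succ_iff.1 h2)
  omegaHat i h1 h2 := by
    rw [alg_loopState_succ ht]
    exact h.loopRound_omegaHat hω h1 (Nat.lt_succ_iff.1 h2)
  Lam := h.Lam_succ hω ht
  state := by
    rw [response_succ _ _ _ ht, natState, trajectory_succ _ _ ht, ← natState, loopState,
      trajectory_succ _ _ ht, ← loopState, ← h.loopRound_uex hω ht le_rfl]
    exact joint_state_succ h.state _ _ _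

end LoopInvariant

lemma loopInvariant (hω : P.Gω = markovOmega S π₀) (ht : 1 ≤ t) :
    LoopInvariant S π₀ w e ℓ P z₁ t := by
  induction t, ht using Nat.le_induction with
  | base => exact LoopInvariant.one
  | succ t ht ih => exact ih.succ hω ht

lemma algIterate_eq_memoryOutput (hω : P.Gω = markovOmega S π₀) (ht : 1 ≤ t) :
    algIterate S π₀ w e ℓ P z₁ t =
      memoryOutput (markovV S π₀) (embed P.m (omegaNat S π₀ w e)) (vNat S π₀ w e)
        (algParam S π₀ w e ℓ P z₁) t := by
  rw [(loopInvariant hω ht).algIterate_eq hω ht, sum_Icc_act_eq_sum_range _ playedInput_zero]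
  rfl

lemma IsConversion.policyIterate_eq {π : LDC dy du} {G : ℕ → Matrix (Fin du) (Fin dω) ℝ}
    (hG : IsConversion S π₀ w e π G) (ht : 1 ≤ t) :
    policyIterate S π w e t = vNat S π₀ w e t + ∑ i ∈ Finset.range (t + 1),
      act (markovV S π₀ i)
        (∑ j ∈ Finset.Icc 1 (t - i), act (G (t - i - j)) (omegaNat S π₀ w e j)) := by
  rw [hG t ht, sum_Icc_act_eq_sum_range _
    (u := fun s => ∑ j ∈ Finset.Icc 1 s, act (G (s - j)) (omegaNat S π₀ w e j)) (by simp)]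

end Loop

section ImpulseResponse

variable {ι κ : Type} [Fintype ι] [Fintype κ] [DecidableEq κ] {G : ℕ → Matrix ι κ ℝ} {b : ℝ}

lemma sum_norm_le_of_l1op_le (hb : 0 ≤ b) (h : l1op G ≤ ENNReal.ofReal b) (n : ℕ) :
    ∑ i ∈ Finset.range n, ‖G i‖ ≤ b := by
  have hsum := (ENNReal.sum_le_tsum (Finset.range n)).trans h
  simp_rw [← ofReal_norm] at hsum
  rw [← ENNReal.ofReal_sum_of_nonneg fun i _ => norm_nonneg _] at hsum
  exact (ENNReal.ofReal_le_ofReal_iff hb).1 hsum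

lemma sum_norm_le_of_decay_le (hb : 0 ≤ b) {k : ℕ} (h : decay G k ≤ ENNReal.ofReal b) (n : ℕ) :
    ∑ i ∈ Finset.range n, ‖G (k + i)‖ ≤ b :=
  sum_norm_le_of_l1op_le hb h n

lemma abs_entry_le_norm (M : Matrix ι κ ℝ) (i : ι) (j : κ) : |M i j| ≤ ‖M‖ := by
  have hentry : act M (EuclideanSpace.single j 1) i = M i j := by simp [act, Matrix.mulVec_single]
  calc |M i j| = ‖act M (EuclideanSpace.single j 1) i‖ := by rw [hentry, Real.norm_eq_abs]
    _ ≤ ‖act M (EuclideanSpace.single j 1)‖ := PiLp.norm_apply_le _ _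
    _ ≤ ‖M‖ := by simpa using norm_act_le M (EuclideanSpace.single j 1)

end ImpulseResponse

section ParamSet

variable {m du dω : ℕ} {R r : ℝ} {z : Vec (PIdx m du dω)}

lemma mem_paramSet : z ∈ paramSet m du dω R ↔ ∑ i, ‖block z i‖ ≤ R := Iff.rfl

/-- `block` as a linear map in the vectorized parameter. -/
def blockLinear (i : Fin m) : Vec (PIdx m du dω) →ₗ[ℝ] Matrix (Fin du) (Fin dω) ℝ where
  toFun z := block z i
  map_add' x y := by ext; simp [block]
  map_smul' c x := by ext; simp [block]

lemma convex_paramSet : Convex ℝ (paramSet m du dω R) := by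
  have hsum : ∀ s : Finset (Fin m),
      ConvexOn ℝ Set.univ fun z : Vec (PIdx m du dω) => ∑ i ∈ s, ‖block z i‖ := by
    intro s
    induction s using Finset.induction_on with
    | empty => simpa using convexOn_const (𝕜 := ℝ) (0 : ℝ) convex_univ
    | insert i s hi ih =>
      simp only [Finset.sum_insert hi]
      exact (convexOn_univ_norm.comp_linearMap (blockLinear i)).add ih
  simpa [paramSet] using (hsum Finset.univ).convex_le R

lemma norm_sq_le_of_mem_paramSet (hz : z ∈ paramSet m du dω R) : ‖z‖ ^ 2 ≤ du * dω * R ^ 2 := by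
  rw [mem_paramSet] at hz
  have hR : 0 ≤ R := (Finset.sum_nonneg fun i _ => norm_nonneg (block z i)).trans hz
  have hblock : ∀ i, ‖block z i‖ ≤ R := fun i =>
    (Finset.single_le_sum (fun j _ => norm_nonneg (block z j)) (Finset.mem_univ i)).trans hz
  have hentry : ∀ i a b, z (i, a, b) ^ 2 ≤ R * ‖block z i‖ := fun i a b => by
    have habs : |z (i, a, b)| ≤ ‖block z i‖ := abs_entry_le_norm (block z i) a b
    rw [← sq_abs, sq]
    exact mul_le_mul (habs.trans (hblock i)) habs (abs_nonneg _) hR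
  calc ‖z‖ ^ 2 = ∑ i, ∑ a, ∑ b, z (i, a, b) ^ 2 := by
        rw [EuclideanSpace.real_norm_sq_eq, Fintype.sum_prod_type]
        simp only [Fintype.sum_prod_type]
    _ ≤ ∑ i, ∑ _a : Fin du, ∑ _b : Fin dω, R * ‖block z i‖ :=
        Finset.sum_le_sum fun i _ => Finset.sum_le_sum fun a _ => Finset.sum_le_sum fun b _ =>
          hentry i a b
    _ = du * dω * (R * ∑ i, ‖block z i‖) := by
        simp only [Finset.sum_const, Finset.card_univ, Fintype.card_fin, nsmul_eq_mul,
          Finset.mul_sum, mul_assoc]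
    _ ≤ du * dω * R ^ 2 := by rw [sq]; gcongr

lemma isCompact_paramSet : IsCompact (paramSet m du dω R) := by
  refine Metric.isCompact_of_isClosed_isBounded ?_ ?_
  · exact isClosed_le (continuous_finsetSum _ fun i _ =>
      (blockLinear i).continuous_of_finiteDimensional.norm) continuous_const
  · refine (Metric.isBounded_closedBall (x := 0) (r := √(du * dω * R ^ 2))).subset fun z hz => ?_
    rw [mem_closedBall_zero_iff]
    exact Real.le_sqrt_of_sq_le (norm_sq_le_of_mem_paramSet hz)

end ParamSet

section Inputs

variable {m du dω : ℕ} {R r : ℝ} {ω : ℕ → Vec (Fin dω)}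

/- Extending `ω` by `0` to round `0` makes truncated subtraction agree with the convention
`ω s = 0` for `s ≤ 0`. -/
lemma act_embed (ω : ℕ → Vec (Fin dω)) (t : ℕ) (z : Vec (PIdx m du dω)) :
    act (embed m ω t) z = ∑ i, act (block z i) (Function.update ω 0 0 (t - i)) := by
  ext a
  simp only [act, Matrix.mulVec, dotProduct, embed, Matrix.of_apply, Fintype.sum_prod_type,
    WithLp.ofLp_sum, Finset.sum_apply]
  refine Finset.sum_congr rfl fun i _ => ?_
  rcases lt_or_ge (i : ℕ) t with hi | hi
  · rw [Function.update_of_ne (Nat.sub_ne_zero_of_lt hi)]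
    simp only [hi, and_true, block]
    rw [Finset.sum_eq_single a (fun b _ hb => by simp [hb.symm]) (by simp)]
    exact Finset.sum_congr rfl fun b _ => by rw [if_pos rfl, mul_comm]; rfl
  · simp [hi.not_gt, Nat.sub_eq_zero_of_le hi]

lemma norm_update_zero_le (hr : 0 ≤ r) (hω : ∀ t, 1 ≤ t → ‖ω t‖ ≤ r) (t : ℕ) :
    ‖Function.update ω 0 0 t‖ ≤ r := by
  rcases t.eq_zero_or_pos with rfl | ht
  · simpa using hr
  · rw [Function.update_of_ne ht.ne']
    exact hω t ht

lemma norm_act_embed_le (hr : 0 ≤ r) (hω : ∀ t, 1 ≤ t → ‖ω t‖ ≤ r) {z : Vec (PIdx m du dω)}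
    (hz : z ∈ paramSet m du dω R) (t : ℕ) : ‖act (embed m ω t) z‖ ≤ R * r := by
  rw [act_embed]
  exact norm_sum_act_le hz hr fun i _ => norm_update_zero_le hr hω _

lemma norm_act_embed_single_le (hr : 0 ≤ r) (hω : ∀ t, 1 ≤ t → ‖ω t‖ ≤ r) (t : ℕ)
    (p : PIdx m du dω) :
    ‖act (embed m ω t : Matrix (Fin du) _ ℝ) (EuclideanSpace.single p 1)‖ ≤ r := by
  have hsingle : act (embed m ω t) (EuclideanSpace.single p 1) =
      EuclideanSpace.single p.2.1 (Function.update ω 0 0 (t - p.1) p.2.2) := by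
    ext a
    rcases lt_or_ge (p.1 : ℕ) t with ht | ht
    · rw [Function.update_of_ne (Nat.sub_ne_zero_of_lt ht)]
      by_cases ha : a = p.2.1 <;> simp [act, embed, Matrix.mulVec_single, ha, ht]
    · simp [act, embed, Matrix.mulVec_single, ht.not_gt, Nat.sub_eq_zero_of_le ht]
  rw [hsingle, PiLp.norm_single]
  exact (PiLp.norm_apply_le _ _).trans (norm_update_zero_le hr hω _)

lemma isBoundedModel_embed {ν : Type} [Fintype ν] {G : ℕ → Matrix ν (Fin du) ℝ} {a : ℕ → Vec ν}
    {ρ : ℝ} (hm : 0 < m) (hρ : 1 ≤ ρ) (hr : 1 ≤ r) (hR : 1 ≤ R)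
    (hG : ∀ n, ∑ i ∈ Finset.range n, ‖G i‖ ≤ ρ) (ha : ∀ t, 1 ≤ t → ‖a t‖ ≤ r)
    (hω : ∀ t, 1 ≤ t → ‖ω t‖ ≤ r) :
    IsBoundedModel (paramSet m du dω R) G (embed m ω) a ρ r (R * r) where
  one_le_gain := hρ
  scale_nonneg := by linarith
  one_le_radius := one_le_mul_of_one_le_of_one_le hR hr
  input_zero := embed_zero ω
  sum_norm_le := hG
  norm_offset_le t ht := by
    have hρR : 1 ≤ ρ * R := one_le_mul_of_one_le_of_one_le hρ hR
    nlinarith [ha t ht]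
  norm_input_le t _ hx := norm_act_embed_le (by linarith) hω hx t
  norm_input_single_le := norm_act_embed_single_le (by linarith) hω
  norm_sq_mul_le x hx := by
    have hm1 : (1 : ℝ) ≤ m := by exact_mod_cast hm
    have hcard : (Fintype.card (PIdx m du dω) : ℝ) = m * (du * dω) := by
      simp [Fintype.card_prod]
    calc ‖x‖ ^ 2 * r ^ 2 ≤ du * dω * R ^ 2 * r ^ 2 := by
          gcongr; exact norm_sq_le_of_mem_paramSet hx
      _ ≤ m * (du * dω * R ^ 2 * r ^ 2) := le_mul_of_one_le_left (by positivity) hm1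
      _ = Fintype.card (PIdx m du dω) * (R * r) ^ 2 := by rw [hcard]; ring

/-- The vectorized controller parameter consisting of the first `m` coefficients of `G`. -/
def truncatedParam (m : ℕ) (G : ℕ → Matrix (Fin du) (Fin dω) ℝ) : Vec (PIdx m du dω) :=
  WithLp.toLp 2 fun p => G p.1 p.2.1 p.2.2

variable {G : ℕ → Matrix (Fin du) (Fin dω) ℝ}

lemma block_truncatedParam (i : Fin m) : block (truncatedParam m G) i = G i := rfl

lemma truncatedParam_mem_paramSet (hG : ∑ i ∈ Finset.range m, ‖G i‖ ≤ R) :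
    truncatedParam m G ∈ paramSet m du dω R := by
  rw [mem_paramSet]
  simpa only [block_truncatedParam, Fin.sum_univ_eq_sum_range fun i => ‖G i‖] using hG

lemma norm_act_embed_truncatedParam_sub_le (hr : 0 ≤ r) (hω : ∀ t, 1 ≤ t → ‖ω t‖ ≤ r) {b : ℝ}
    (hG : ∀ n, ∑ i ∈ Finset.range n, ‖G (m + i)‖ ≤ b) (t : ℕ) :
    ‖act (embed m ω t) (truncatedParam m G) - ∑ j ∈ Finset.Icc 1 t, act (G (t - j)) (ω j)‖ ≤
      b * r := by
  have hstatic : act (embed m ω t) (truncatedParam m G) =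
      ∑ i ∈ Finset.range m, act (G i) (Function.update ω 0 0 (t - i)) := by
    simp only [act_embed, block_truncatedParam]
    exact Fin.sum_univ_eq_sum_range (fun i => act (G i) (Function.update ω 0 0 (t - i))) m
  have hdynamic : ∑ j ∈ Finset.Icc 1 t, act (G (t - j)) (ω j) =
      ∑ i ∈ Finset.range (t + 1), act (G i) (Function.update ω 0 0 (t - i)) := by
    rw [← sum_Icc_act_eq_sum_range G (Function.update_self 0 0 ω)]
    refine Finset.sum_congr rfl fun j hj => ?_
    rw [Function.update_of_ne (Nat.one_le_iff_ne_zero.1 (Finset.mem_Icc.1 hj).1)]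
  rw [hstatic, hdynamic, norm_sub_rev]
  exact norm_conv_sub_truncated_le G (Function.update_self 0 0 ω) hG
    (norm_update_zero_le hr hω) t

end Inputs

section Regret

variable {dx ds dy du dω : ℕ} {S : LinSys dx dy du} {π₀ : NominalController ds dy du dω}
  {w : ℕ → Vec (Fin dx)} {e : ℕ → Vec (Fin dy)} {ℓ : ℕ → Vec (Fin dy ⊕ Fin du) → ℝ}

lemma one_le_of_l1op_markovV_le {ρ : ℝ} (hdu : 0 < du)
    (h : l1op (markovV S π₀) ≤ ENNReal.ofReal ρ) : 1 ≤ ρ := by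
  have hentry : 1 ≤ ‖markovV S π₀ 0‖ := by
    simpa [markovV] using abs_entry_le_norm (markovV S π₀ 0) (Sum.inr ⟨0, hdu⟩) ⟨0, hdu⟩
  rw [← ENNReal.one_le_ofReal]
  calc 1 ≤ ‖markovV S π₀ 0‖ₑ := by rwa [← ofReal_norm, ENNReal.one_le_ofReal]
    _ ≤ l1op (markovV S π₀) := ENNReal.le_tsum 0
    _ ≤ ENNReal.ofReal ρ := h

section Parameter

variable {P : AlgInput dy du dω} {z₁ : Vec (PIdx P.m du dω)}

lemma algParam_mem_paramSet (hv : P.Gv = markovV S π₀) (hω : P.Gω = markovOmega S π₀)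
    (hz₁ : z₁ ∈ paramSet P.m du dω P.RM) (t : ℕ) :
    algParam S π₀ w e ℓ P z₁ t ∈ paramSet P.m du dω P.RM := by
  match t with
  | 0 => exact hz₁
  | 1 => exact hz₁
  | t + 2 =>
    have ht := Nat.le_add_left 1 t
    rw [(loopInvariant hω ht).algParam_succ hv hω ht]
    exact (projOn_spec isCompact_paramSet ⟨z₁, hz₁⟩ _ _).1

lemma isNewtonRun_algParam (hv : P.Gv = markovV S π₀) (hω : P.Gω = markovOmega S π₀)
    (hz₁ : z₁ ∈ paramSet P.m du dω P.RM) (hlam : 0 < P.lam)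
    (hℓ : ∀ t, 1 ≤ t → Differentiable ℝ (ℓ t)) {g : ℝ}
    (hg : ∀ t, ‖memorylessGradient ℓ P.Gv (embed P.m (omegaNat S π₀ w e)) (vNat S π₀ w e) P.h
      (algParam S π₀ w e ℓ P z₁) t‖ ≤ g) :
    IsNewtonRun (paramSet P.m du dω P.RM) P.η P.lam g
      (features P.Gv (embed P.m (omegaNat S π₀ w e)) P.h)
      (memorylessGradient ℓ P.Gv (embed P.m (omegaNat S π₀ w e)) (vNat S π₀ w e) P.h
        (algParam S π₀ w e ℓ P z₁))
      (algParam S π₀ w e ℓ P z₁) where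
  lam_pos := hlam
  mem := algParam_mem_paramSet hv hω hz₁
  norm_le := hg
  step t x hx := by
    rcases t.eq_zero_or_pos with rfl | ht
    · have hz : algParam S π₀ w e ℓ P z₁ 1 = algParam S π₀ w e ℓ P z₁ 0 := rfl
      simp [memorylessGradient, act_zero, hz]
    · have hinv := loopInvariant (w := w) (e := e) (ℓ := ℓ) (z₁ := z₁) hω ht
      rw [hinv.algParam_succ hv hω ht, hinv.Lam_succ hω ht, gradient_comp_act (hℓ t ht),
        memorylessGradient, if_neg ht.ne']
      exact quad_projOn_sub_le isCompact_paramSet convex_paramSet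
        (posDef_regSum hlam (posSemidef_gram _) t).posSemidef _ hx

end Parameter

variable {m h T : ℕ} {α L ρ r R c : ℝ} {z₁ : Vec (PIdx m du dω)} {ψ : ℕ → ℝ}

theorem sum_loss_algIterate_le (hdu : 0 < du) (hdω : 0 < dω) (hm : 0 < m) (hh : 0 < h)
    (hT : 0 < T) (hα : 0 < α) (hℓ : ∀ t, 1 ≤ t → LossRegular α L (ℓ t))
    (hρ : l1op (markovV S π₀) ≤ ENNReal.ofReal ρ)
    (hρh : decay (markovV S π₀) (h + 1) ≤ ENNReal.ofReal (ρ / T)) (hr : 1 ≤ r)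
    (hvNat : ∀ t, 1 ≤ t → ‖vNat S π₀ w e t‖ ≤ r) (hωNat : ∀ t, 1 ≤ t → ‖omegaNat S π₀ w e t‖ ≤ r)
    (hκ : 0 < invModulus (markovV S π₀)) (hc : 0 ≤ c) (hR : 1 ≤ R)
    (hz₁ : z₁ ∈ paramSet m du dω R) {π : LDC dy du} {G : ℕ → Matrix (Fin du) (Fin dω) ℝ}
    (hG : IsConversion S π₀ w e π G) (hGR : l1op G ≤ ENNReal.ofReal R)
    (hGm : decay G m ≤ ENNReal.ofReal (c * R / T)) :
    ∑ t ∈ Finset.Icc 1 T, ℓ t (algIterate S π₀ w e ℓ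
        { m := m, h := h, η := 1 / α, lam := 6 * h * r ^ 2 * ρ ^ 2, RM := R,
          Gv := markovV S π₀, Gω := markovOmega S π₀ } z₁ t) ≤
      ∑ t ∈ Finset.Icc 1 T, ℓ t (policyIterate S π w e t) +
        200 * (1 + c) * ((α * √(invModulus (markovV S π₀)))⁻¹ * m * h * du * dω * ρ ^ 3 *
          r ^ 2 * R ^ 2 * L ^ 2 * Real.log (1 + T)) := by
  set P : AlgInput dy du dω :=
    { m := m, h := h, η := 1 / α, lam := 6 * h * r ^ 2 * ρ ^ 2, RM := R,
      Gv := markovV S π₀, Gω := markovOmega S π₀ }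
  have hρ1 : 1 ≤ ρ := one_le_of_l1op_markovV_le hdu hρ
  have hαL : α ≤ L := by
    have : Nonempty (Fin dy ⊕ Fin du) := ⟨Sum.inr ⟨0, hdu⟩⟩
    exact (hℓ 1 le_rfl).modulus_le
  have : Nonempty (PIdx m du dω) := ⟨⟨0, hm⟩, ⟨0, hdu⟩, ⟨0, hdω⟩⟩
  have hM : IsBoundedModel (paramSet m du dω R) (markovV S π₀) (embed m (omegaNat S π₀ w e))
      (vNat S π₀ w e) ρ r (R * r) :=
    isBoundedModel_embed hm hρ1 hr hR (sum_norm_le_of_l1op_le (by linarith) hρ) hvNat hωNat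
  have hrun := isNewtonRun_algParam (P := P) (z₁ := z₁) rfl rfl hz₁
    (by simp only [P]; positivity) (fun t ht => (hℓ t ht).1)
    (hM.norm_memorylessGradient_le hℓ (hα.le.trans hαL)
      (algParam_mem_paramSet (P := P) rfl rfl hz₁) h)
  have hinput := norm_act_embed_truncatedParam_sub_le (by linarith) hωNat
    (sum_norm_le_of_decay_le (b := c * R / T) (by positivity) hGm)
  have hbound := hM.sum_loss_memoryOutput_le hα hαL hℓ hrun hκ hh hT
    (sum_norm_le_of_decay_le (by positivity) hρh) hc
    (truncatedParam_mem_paramSet (sum_norm_le_of_l1op_le (by linarith) hGR m))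
    fun s => (hinput s).trans_eq (by ring)
  have halg : ∀ t ∈ Finset.Icc 1 T, ℓ t (algIterate S π₀ w e ℓ P z₁ t) = _ := fun t ht =>
    congrArg (ℓ t) (algIterate_eq_memoryOutput rfl (Finset.mem_Icc.1 ht).1)
  have hpolicy : ∀ t ∈ Finset.Icc 1 T, ℓ t (policyIterate S π w e t) = _ := fun t ht =>
    congrArg (ℓ t) (hG.policyIterate_eq (Finset.mem_Icc.1 ht).1)
  rw [Finset.sum_congr rfl halg, Finset.sum_congr rfl hpolicy]
  refine hbound.trans_eq ?_
  simp only [Fintype.card_prod, Fintype.card_fin, Nat.cast_mul, mul_inv]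
  ring

lemma controlReg_le_of_forall {v : ℕ → Vec (Fin dy ⊕ Fin du)} {Pol : Set (LDC dy du)} {B : ℝ}
    (h : ∀ π ∈ Pol, ∑ t ∈ Finset.Icc 1 T, ℓ t (v t) ≤
      ∑ t ∈ Finset.Icc 1 T, ℓ t (policyIterate S π w e t) + B) :
    controlReg S w e ℓ T v Pol ≤ B := by
  refine EReal.sub_le_of_le_add' ?_
  rw [← EReal.sub_le_iff_le_add (Or.inl (EReal.coe_ne_bot _)) (Or.inl (EReal.coe_ne_top _)),
    ← EReal.coe_sub]
  exact le_iInf₂ fun π hπ => EReal.coe_le_coe_iff.2 (sub_le_iff_le_add.2 (h π hπ))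

end Regret

end Drc

theorem mainTheorem1_general {dx ds dy du dω m h T : ℕ} (hdu : 0 < du) (hdω : 0 < dω) (hm : 0 < m)
    (hh : 0 < h) (hT : 0 < T) {S : Drc.LinSys dx dy du} {π₀ : Drc.NominalController ds dy du dω}
    {w : ℕ → Drc.Vec (Fin dx)} {e : ℕ → Drc.Vec (Fin dy)}
    {ℓ : ℕ → Drc.Vec (Fin dy ⊕ Fin du) → ℝ} {α L Rnat Rv Rstar RM c : ℝ} {ψstar : ℕ → ℝ}
    {z₁ : Drc.Vec (Drc.PIdx m du dω)} (hα : 0 < α)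
    (hℓ : ∀ t, 1 ≤ t → Drc.LossRegular α L (ℓ t))
    (hRv : Drc.l1op (Drc.markovV S π₀) ≤ ENNReal.ofReal Rv)
    (hdecay : Drc.decay (Drc.markovV S π₀) (h + 1) ≤ ENNReal.ofReal (Rv / T)) (hRnat : 1 ≤ Rnat)
    (hvNat : ∀ t, 1 ≤ t → ‖Drc.vNat S π₀ w e t‖ ≤ Rnat)
    (hωNat : ∀ t, 1 ≤ t → ‖Drc.omegaNat S π₀ w e t‖ ≤ Rnat)
    (hκ : 0 < Drc.invModulus (Drc.markovV S π₀)) (hc : 0 ≤ c) (hψstar : ψstar m ≤ c * Rstar / T)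
    (hRstar : Rstar ≤ RM) (hRM : 1 ≤ RM) (hz₁ : z₁ ∈ Drc.paramSet m du dω RM) :
    Drc.controlReg S w e ℓ T
        (Drc.algIterate S π₀ w e ℓ
          { m := m, h := h, η := 1 / α, lam := 6 * h * Rnat ^ 2 * Rv ^ 2, RM := RM,
            Gv := Drc.markovV S π₀, Gω := Drc.markovOmega S π₀ } z₁)
        (Drc.comparators S π₀ w e Rstar ψstar) ≤
      ((200 * (1 + c) * ((α * √(Drc.invModulus (Drc.markovV S π₀)))⁻¹ * m * h * du * dω * Rv ^ 3 *
        Rnat ^ 2 * RM ^ 2 * L ^ 2 * Real.log (1 + T)) : ℝ) : EReal) := by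
  refine Drc.controlReg_le_of_forall fun π ⟨G, hG, hGR, hGψ⟩ =>
    Drc.sum_loss_algIterate_le hdu hdω hm hh hT hα hℓ hRv hdecay hRnat hvNat hωNat hκ hc hRM hz₁ hG
      (hGR.trans (ENNReal.ofReal_le_ofReal hRstar)) ((hGψ m).trans (ENNReal.ofReal_le_ofReal ?_))
  exact hψstar.trans (by gcongr)

theorem mainTheorem1 :
    ∃ Cst : ℝ, 0 < Cst ∧
      ∀ (dx ds dy du dω m h T : ℕ), 0 < du → 0 < dω → 0 < m → 0 < h → 0 < T →
      ∀ (S : Drc.LinSys dx dy du) (π₀ : Drc.NominalController ds dy du dω)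
        (w : ℕ → Drc.Vec (Fin dx)) (e : ℕ → Drc.Vec (Fin dy))
        (ℓ : ℕ → Drc.Vec (Fin dy ⊕ Fin du) → ℝ)
        (α L Rnat Rπ₀ Rstar RM c : ℝ) (ψ₀ ψstar : ℕ → ℝ)
        (z₁ : Drc.Vec (Drc.PIdx m du dω)),
        -- cost regularity
        0 < α → (∀ t, 1 ≤ t → Drc.LossRegular α L (ℓ t)) →
        -- stability under the nominal controller
        Drc.nominalRadius S π₀ ≠ ⊤ → Rπ₀ = (Drc.nominalRadius S π₀).toReal →
        Drc.IsDecayFunction ψ₀ →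
        (∀ n, Drc.decay (Drc.markovV S π₀) n ≤ ENNReal.ofReal (ψ₀ n)) →
        (∀ n, Drc.decay (Drc.markovOmega S π₀) n ≤ ENNReal.ofReal (ψ₀ n)) →
        -- bounded nature's iterates
        1 ≤ Rnat →
        (∀ t, 1 ≤ t → ‖Drc.vNat S π₀ w e t‖ ≤ Rnat ∧ ‖Drc.omegaNat S π₀ w e t‖ ≤ Rnat) →
        -- invertibility modulus
        0 < Drc.invModulus (Drc.markovV S π₀) →
        -- choice of the parameters
        Drc.IsDecayFunction ψstar → 0 < c →
        ψ₀ (h + 1) ≤ Rπ₀ / T → ψstar m ≤ c * Rstar / T → Rstar ≤ RM → 1 ≤ RM →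
        z₁ ∈ Drc.paramSet m du dω RM →
        Drc.controlReg S w e ℓ T
            (Drc.algIterate S π₀ w e ℓ
              { m := m, h := h, η := 1 / α, lam := 6 * h * Rnat ^ 2 * Rπ₀ ^ 2, RM := RM,
                Gv := Drc.markovV S π₀, Gω := Drc.markovOmega S π₀ } z₁)
            (Drc.comparators S π₀ w e Rstar ψstar)
          ≤ ((Cst * (1 + c) *
              ((α * √(Drc.invModulus (Drc.markovV S π₀)))⁻¹ * m * h ^ 2 * du * dω * Rπ₀ ^ 3 *
                Rnat ^ 2 * RM ^ 2 * L ^ 2 * Real.log (1 + T)) : ℝ) : EReal) := by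
  refine ⟨200, by norm_num, ?_⟩
  intro dx ds dy du dω m h T hdu hdω hm hh hT S π₀ w e ℓ α L Rnat Rπ₀ Rstar RM c ψ₀ ψstar z₁ hα hℓ
    hfin hRπ₀ _ hψv _ hRnat hnat hκ _ hc hψ₀ hψstar hRstar hRM hz₁
  have hRv : Drc.l1op (Drc.markovV S π₀) ≤ ENNReal.ofReal Rπ₀ := by
    rw [hRπ₀, ENNReal.ofReal_toReal hfin]
    exact le_max_left _ _
  have hh1 : (1 : ℝ) ≤ h := by exact_mod_cast hh
  have hRπ₀_one := Drc.one_le_of_l1op_markovV_le hdu hRv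
  refine (mainTheorem1_general hdu hdω hm hh hT hα hℓ hRv
    ((hψv (h + 1)).trans (ENNReal.ofReal_le_ofReal hψ₀)) hRnat (fun t ht => (hnat t ht).1)
    (fun t ht => (hnat t ht).2) hκ hc.le hψstar hRstar hRM hz₁).trans (EReal.coe_le_coe_iff.2 ?_)
  have hlog : 0 ≤ Real.log (1 + T) := Real.log_nonneg (by simp)
  gcongr
  exact le_self_pow₀ hh1 two_ne_zero
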